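/- Let $\mathbb{F}_q$ be a finite field with $q$ elements, $A=\mathbb{F}_q[\theta]$, $K_\infty=\mathbb{F}_q((1/\theta))$ with $|\theta|=q$, and let $\mathbb{C}_\infty$ be the completion of an algebraic closure of $K_\infty$. Let $\underline t=(t_1,\dots,t_s)$ be variables and let $\mathbb{K}$ be the completion of $\mathbb{C}_\infty(\underline t)$ for the Gauss norm. Let $\tau$ be the continuous automorphism of $\mathbb{K}$ which extends $x\mapsto x^q$ on $\mathbb{C}_\infty$ and fixes $\mathbb{F}_q(\underline t)$; for $k\in\mathbb{Z}$ and $f$ in $\mathbb{K}$, or a matrix or a matrix-valued function $Z\mapsto f(Z)$ with entries or values in $\mathbb{K}$, write $f^{(k)}=\tau^k(f)$ (entrywise and pointwise). Let $\Lambda\subset\mathbb{C}_\infty$ be an $A$-lattice (a finitely generated, strongly discrete $A$-submodule) of rank $r$ with $A$-basis $\lambda_1,\dots,\lambda_r$, and let $\exp_\Lambda(Z)=Z\prod_{\lambda\in\Lambda\setminus\{0\}}(1-Z/\lambda)=\sum_{i\ge0}\alpha_iZ^{q^i}$ be its exponential function, extended to $\mathbb{K}$ by $\exp_\Lambda(x)=\sum_{i\ge0}\alpha_i\tau^i(x)$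 and to matrices entrywise. Let $\chi:A\to\mathbb{F}_q(\underline t)^{n\times n}$ be an injective $\mathbb{F}_q$-algebra morphism. The matrix $\theta I_n-\chi(\theta)$ is invertible over $\mathbb{K}$. Put $$\psi_\Lambda(Z)=\sum_{a_1,\dots,a_r\in A}\frac{1}{Z-a_1\lambda_1-\cdots-a_r\lambda_r}\,(\chi(a_1),\dots,\chi(a_r))\in\mathbb{K}^{n\times rn},$$ where the term with all $a_i=0$ is $0$, and for $j\geq 1$ $$\mathcal{E}_\Lambda(j;\chi)=\sum_{(a_1,\dots,a_r)\ne0}\frac{1}{(a_1\lambda_1+\cdots+a_r\lambda_r)^j}\,(\chi(a_1),\dots,\chi(a_r)),$$ $$\omega_\Lambda=\exp_\Lambda\left((\theta I_n-\chi(\theta))^{-1}\begin{pmatrix}\lambda_1I_n\\ \vdots\\ \lambda_rI_n\end{pmatrix}\right)\in\mathbb{K}^{rn\times n},\qquad \boldsymbol{\Omega}_\Lambda=(\omega_\Lambda,\omega_\Lambda^{(-1)},\dots,\omega_\Lambda^{(1-r)})\in\mathbb{K}^{rn\times rn}.$$ Let $\mathcal{H}$ be the power series expansion at $0$ of $\mathcal{H}(Z)=\exp_\Lambda(Z)^{-1}\exp_\Lambda\big((\theta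 I_n-\chi(\theta))^{-1}Z\big)$, let $\mathcal{D}_m$ be the divided derivative with $\mathcal{D}_m(Z^l)=\binom{l}{m}Z^{l-m}$, and put $\mathcal{H}_k=(\mathcal{D}_{q^k-1}\mathcal{H})^{(-k)}$ for $k\ge0$ and $\boldsymbol{\mathcal{H}}_\Lambda(Z)=(\mathcal{H}_0(Z),\dots,\mathcal{H}_{r-1}(Z))\in\mathbb{K}^{n\times rn}$. Then all the series $\mathcal{E}_\Lambda(j;\chi)$ converge, the matrix $\boldsymbol{\Omega}_\Lambda$ is invertible, and there is $\rho>0$ such that on the disk $D(0,\rho)=\{Z\in\mathbb{C}_\infty:|Z|\le\rho\}$: 1. $\exp_\Lambda$ does not vanish on $D(0,\rho)\setminus\{0\}$, the series $\mathcal{H}$ and all the series $\mathcal{D}_{q^k-1}\mathcal{H}$ ($k\ge0$) converge on $D(0,\rho)$, and the sum of $\mathcal{H}$ at $Z\neq0$ is $\exp_\Lambda(Z)^{-1}\exp_\Lambda\big((\theta I_n-\chi(\theta))^{-1}Z\big)$; 2. the functions $\mathcal{H}_k$ ($k\geq 0$) and $\psi_\Lambda$ are analytic, that is, sums of power series in $Z$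 which converge on $D(0,\rho)$; 3. the series $\psi_\Lambda(Z)$ converges and $$\psi_\Lambda(Z)=-\sum_{j\ge1,\ j\equiv1\ (\mathrm{mod}\ q-1)}Z^{j-1}\,\mathcal{E}_\Lambda(j;\chi);$$ 4. $\psi_\Lambda(Z)=\boldsymbol{\mathcal{H}}_\Lambda(Z)\,\boldsymbol{\Omega}_\Lambda^{-1}$. -/

import Mathlib

open scoped Polynomial NNReal Topology

noncomputable section

namespace Perkins

/-! ### Generalities on absolute values -/

/-- The real absolute value attached to a valuation with values in `ℝ≥0`. -/
def absOfValuation {L : Type*} [Field L] (v : Valuation L ℝ≥0) : AbsoluteValue L ℝ where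
  toFun x := (v x : ℝ)
  map_mul' x y := by simp
  nonneg' x := (v x).2
  eq_zero' x := by simp
  add_le' x y := by
    have h : v (x + y) ≤ v x + v y :=
      (v.map_add x y).trans (max_le le_self_add le_add_self)
    exact_mod_cast h

theorem completion_norm_add_le {L : Type*} [Field L] (v : Valuation L ℝ≥0)
    (x y : (absOfValuation v).Completion) : ‖x + y‖ ≤ max ‖x‖ ‖y‖ := by
  induction x, y using UniformSpace.Completion.induction_on₂ with
  | hp =>
    exact isClosed_le (continuous_norm.comp continuous_add)
      ((continuous_norm.comp continuous_fst).max (continuous_norm.comp continuous_snd))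
  | ih a b =>
    rw [← UniformSpace.Completion.coe_add]
    simp only [UniformSpace.Completion.norm_coe]
    exact_mod_cast v.map_add a.ofAbs b.ofAbs

/-! ### The field `K_∞` -/

section Fields

variable (Fq : Type*) [Field Fq] [Fintype Fq]

/-- The absolute value `|f| = q ^ deg f` of `𝔽_q(θ)`, as a valuation. -/
def inftyVal : Valuation (RatFunc Fq) ℝ≥0 := by
  classical
  exact
  { toFun := fun f => if f = 0 then 0 else (Fintype.card Fq : ℝ≥0) ^ f.intDegree
    map_zero' := by simp
    map_one' := by simp
    map_mul' := fun f g => by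
      have hq : (Fintype.card Fq : ℝ≥0) ≠ 0 := by exact_mod_cast Fintype.card_ne_zero
      by_cases hf : f = 0
      · simp [hf]
      by_cases hg : g = 0
      · simp [hg]
      simp [hf, hg, RatFunc.intDegree_mul hf hg, zpow_add₀ hq]
    map_add_le_max' := fun f g => by
      have hq : (1 : ℝ≥0) ≤ (Fintype.card Fq : ℝ≥0) := by
        exact_mod_cast Fintype.card_pos
      by_cases hf : f = 0
      · simp [hf]
      by_cases hg : g = 0
      · simp [hg]
      by_cases hfg : f + g = 0
      · simp [hfg]
      simp only [hf, hg, hfg, if_false]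
      rcases le_max_iff.1 (RatFunc.intDegree_add_le hg hfg) with h | h
      · exact le_max_of_le_left (zpow_le_zpow_right₀ hq h)
      · exact le_max_of_le_right (zpow_le_zpow_right₀ hq h) }

/-- `K_∞ = 𝔽_q((1/θ))`, the completion of `𝔽_q(θ)` for `|f| = q ^ deg f`. -/
def Kinf : Type _ := (absOfValuation (inftyVal Fq)).Completion

instance : NormedField (Kinf Fq) :=
  inferInstanceAs (NormedField (absOfValuation (inftyVal Fq)).Completion)

instance : CompleteSpace (Kinf Fq) :=
  inferInstanceAs (CompleteSpace (absOfValuation (inftyVal Fq)).Completion)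

instance : IsUltrametricDist (Kinf Fq) :=
  IsUltrametricDist.isUltrametricDist_of_forall_norm_add_le_max_norm
    (completion_norm_add_le (inftyVal Fq))

/-- The embedding `𝔽_q(θ) → K_∞`. -/
def ratToKinf : RatFunc Fq →+* Kinf Fq :=
  (UniformSpace.Completion.coeRingHom :
    WithAbs (absOfValuation (inftyVal Fq)) →+* _).comp
      (WithAbs.equiv (absOfValuation (inftyVal Fq))).symm.toRingHom

theorem norm_ratToKinf (f : RatFunc Fq) : ‖ratToKinf Fq f‖ = (inftyVal Fq f : ℝ) :=
  UniformSpace.Completion.norm_coe (WithAbs.toAbs (absOfValuation (inftyVal Fq)) f)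

theorem norm_ratToKinf_X : ‖ratToKinf Fq RatFunc.X‖ = Fintype.card Fq := by
  rw [norm_ratToKinf]
  simp [inftyVal, RatFunc.X_ne_zero]

instance : NontriviallyNormedField (Kinf Fq) where
  non_trivial := ⟨ratToKinf Fq RatFunc.X, by
    rw [norm_ratToKinf_X]; exact_mod_cast Fintype.one_lt_card⟩

/-! ### The field `ℂ_∞` -/

/-- An algebraic closure of `K_∞`, with the unique extension of the absolute value. -/
def KinfAlg : Type _ := AlgebraicClosure (Kinf Fq)

instance : Field (KinfAlg Fq) := inferInstanceAs (Field (AlgebraicClosure (Kinf Fq)))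

instance : Algebra (Kinf Fq) (KinfAlg Fq) :=
  inferInstanceAs (Algebra (Kinf Fq) (AlgebraicClosure (Kinf Fq)))

instance : IsAlgClosure (Kinf Fq) (KinfAlg Fq) :=
  inferInstanceAs (IsAlgClosure (Kinf Fq) (AlgebraicClosure (Kinf Fq)))

instance : Algebra.IsAlgebraic (Kinf Fq) (KinfAlg Fq) := IsAlgClosure.isAlgebraic

instance : IsAlgClosed (KinfAlg Fq) := IsAlgClosure.isAlgClosed (Kinf Fq)

/-- The absolute value of `KinfAlg`: the spectral norm, as a valuation. -/
def algVal : Valuation (KinfAlg Fq) ℝ≥0 where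
  toFun x := ⟨spectralNorm (Kinf Fq) (KinfAlg Fq) x, spectralNorm_nonneg x⟩
  map_zero' := by ext; exact spectralNorm_zero
  map_one' := by ext; exact spectralNorm_one
  map_mul' x y := by ext; exact map_mul (spectralMulAlgNorm (Kinf Fq) (KinfAlg Fq)) x y
  map_add_le_max' x y := isNonarchimedean_spectralNorm x y

/-- `ℂ_∞`, the completion of an algebraic closure of `K_∞`. -/
def Cinf : Type _ := (absOfValuation (algVal Fq)).Completion

instance : NormedField (Cinf Fq) :=
  inferInstanceAs (NormedField (absOfValuation (algVal Fq)).Completion)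

instance : CompleteSpace (Cinf Fq) :=
  inferInstanceAs (CompleteSpace (absOfValuation (algVal Fq)).Completion)

instance : IsUltrametricDist (Cinf Fq) :=
  IsUltrametricDist.isUltrametricDist_of_forall_norm_add_le_max_norm
    (completion_norm_add_le (algVal Fq))

/-- The embedding of the algebraic closure of `K_∞` in `ℂ_∞`. -/
def algToCinf : KinfAlg Fq →+* Cinf Fq :=
  (UniformSpace.Completion.coeRingHom :
    WithAbs (absOfValuation (algVal Fq)) →+* _).comp
      (WithAbs.equiv (absOfValuation (algVal Fq))).symm.toRingHom

theorem norm_algToCinf (x : KinfAlg Fq) :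
    ‖algToCinf Fq x‖ = spectralNorm (Kinf Fq) (KinfAlg Fq) x :=
  UniformSpace.Completion.norm_coe (WithAbs.toAbs (absOfValuation (algVal Fq)) x)

theorem denseRange_algToCinf : DenseRange (algToCinf Fq) :=
  UniformSpace.Completion.denseRange_coe.comp
    (WithAbs.equiv (absOfValuation (algVal Fq))).symm.surjective.denseRange
    (UniformSpace.Completion.continuous_coe _)

/-- `ℂ_∞` as an algebra over `A = 𝔽_q[θ]`, through `A ⊂ 𝔽_q(θ) ⊂ K_∞ ⊂ ℂ_∞`. -/
instance : Algebra Fq[X] (Cinf Fq) :=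
  ((algToCinf Fq).comp ((algebraMap (Kinf Fq) (KinfAlg Fq)).comp
    ((ratToKinf Fq).comp (algebraMap Fq[X] (RatFunc Fq))))).toAlgebra

instance : Algebra Fq (Cinf Fq) :=
  ((algebraMap Fq[X] (Cinf Fq)).comp Polynomial.C).toAlgebra

/-- The element `θ` of `ℂ_∞`. -/
def theta : Cinf Fq := algebraMap Fq[X] (Cinf Fq) Polynomial.X

theorem norm_theta : ‖theta Fq‖ = Fintype.card Fq := by
  rw [← norm_ratToKinf_X Fq]
  change ‖algToCinf Fq _‖ = _
  rw [norm_algToCinf]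
  simp only [RingHom.coe_comp, Function.comp_apply, RatFunc.algebraMap_X]
  exact spectralNorm_extends _

/-- The Frobenius `x ↦ x ^ q` of `ℂ_∞` is surjective. -/
theorem frobenius_surjective :
    Function.Surjective (FiniteField.frobeniusAlgHom Fq (Cinf Fq)) := by
  set φ := FiniteField.frobeniusAlgHom Fq (Cinf Fq) with hφ
  have hq : Fintype.card Fq ≠ 0 := Fintype.card_ne_zero
  have happ : ∀ x, φ x = x ^ Fintype.card Fq := fun x => rfl
  have hcont : Continuous φ := by
    rw [show (φ : Cinf Fq → Cinf Fq) = fun x => x ^ Fintype.card Fq from funext happ]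
    exact continuous_pow _
  have hanti : ∀ x y, ‖φ x - φ y‖ = ‖x - y‖ ^ Fintype.card Fq := fun x y => by
    rw [← map_sub, happ, norm_pow]
  have hclosed : IsClosed (Set.range φ) := by
    apply IsComplete.isClosed
    have hui : IsUniformInducing φ := by
      refine Metric.isUniformInducing_iff.2
        ⟨uniformContinuous_addMonoidHom_of_continuous (f := φ) hcont, fun δ hδ =>
          ⟨δ ^ Fintype.card Fq, pow_pos hδ _, fun {a b} h => ?_⟩⟩
      rw [dist_eq_norm, hanti] at h
      rw [dist_eq_norm]
      exact lt_of_pow_lt_pow_left₀ _ hδ.le h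
    exact hui.isComplete_range
  have hdense : DenseRange φ := by
    refine (denseRange_algToCinf Fq).mono ?_
    rintro _ ⟨x, rfl⟩
    obtain ⟨y, hy⟩ := IsAlgClosed.exists_pow_nat_eq x (Nat.pos_of_ne_zero hq)
    exact ⟨algToCinf Fq y, by rw [happ, ← map_pow, hy]⟩
  intro x
  have := hdense x
  rwa [hclosed.closure_eq] at this

/-- The Frobenius automorphism `x ↦ x ^ q` of `ℂ_∞`. -/
def frob : Cinf Fq ≃+* Cinf Fq :=
  RingEquiv.ofBijective (FiniteField.frobeniusAlgHom Fq (Cinf Fq)).toRingHom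
    ⟨RingHom.injective _, frobenius_surjective Fq⟩

theorem frob_apply (x : Cinf Fq) : frob Fq x = x ^ Fintype.card Fq := rfl

end Fields

/-! ### The Gauss norm on polynomials -/

section Gauss

variable {L : Type*} [NormedField L] {s : ℕ}

/-- The Gauss norm of a polynomial: the maximum of the absolute values of its coefficients. -/
def gauss (f : MvPolynomial (Fin s) L) : ℝ≥0 := f.support.sup fun m => ‖f.coeff m‖₊

theorem le_gauss (f : MvPolynomial (Fin s) L) (m : Fin s →₀ ℕ) : ‖f.coeff m‖₊ ≤ gauss f := by
  by_cases h : m ∈ f.support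
  · exact Finset.le_sup (f := fun m => ‖f.coeff m‖₊) h
  · simp [MvPolynomial.notMem_support_iff.1 h]

theorem gauss_le {f : MvPolynomial (Fin s) L} {c : ℝ≥0} (h : ∀ m, ‖f.coeff m‖₊ ≤ c) :
    gauss f ≤ c :=
  Finset.sup_le fun m _ => h m

theorem gauss_eq_zero {f : MvPolynomial (Fin s) L} : gauss f = 0 ↔ f = 0 := by
  refine ⟨fun h => ?_, fun h => by simp [h, gauss]⟩
  ext m
  simpa [h] using le_gauss f m

/-- For a nonzero polynomial, there is a lexicographically last monomial at which the Gauss norm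
is attained. -/
theorem exists_last {f : MvPolynomial (Fin s) L} (hf : f ≠ 0) :
    ∃ i, ‖f.coeff i‖₊ = gauss f ∧ ∀ j, toLex i < toLex j → ‖f.coeff j‖₊ < gauss f := by
  classical
  have hs : f.support.Nonempty := MvPolynomial.support_nonempty.2 hf
  obtain ⟨i₀, hi₀, h₀⟩ := Finset.exists_mem_eq_sup f.support hs fun m => ‖f.coeff m‖₊
  have hT : (f.support.filter fun m => ‖f.coeff m‖₊ = gauss f).Nonempty :=
    ⟨i₀, Finset.mem_filter.2 ⟨hi₀, h₀.symm⟩⟩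
  obtain ⟨i, hi, hmax⟩ := Finset.exists_max_image _ (fun m => toLex m) hT
  refine ⟨i, (Finset.mem_filter.1 hi).2, fun j hj => lt_of_le_of_ne (le_gauss f j) fun h => ?_⟩
  refine absurd (hmax j (Finset.mem_filter.2 ⟨?_, h⟩)) (not_le.2 hj)
  rw [MvPolynomial.mem_support_iff]
  intro h0
  rw [h0, nnnorm_zero] at h
  exact hf (gauss_eq_zero.1 h.symm)

variable [IsUltrametricDist L]

theorem gauss_add_le (f g : MvPolynomial (Fin s) L) : gauss (f + g) ≤ max (gauss f) (gauss g) :=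
  gauss_le fun m => by
    rw [MvPolynomial.coeff_add]
    exact (IsUltrametricDist.nnnorm_add_le_max _ _).trans
      (max_le_max (le_gauss f m) (le_gauss g m))

theorem gauss_mul (f g : MvPolynomial (Fin s) L) : gauss (f * g) = gauss f * gauss g := by
  classical
  apply le_antisymm
  · refine gauss_le fun m => ?_
    rw [MvPolynomial.coeff_mul]
    refine IsUltrametricDist.nnnorm_sum_le_of_forall_le fun p _ => ?_
    rw [nnnorm_mul]
    exact mul_le_mul' (le_gauss f _) (le_gauss g _)
  · by_cases hf : f = 0
    · simp [hf, gauss_eq_zero.2]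
    by_cases hg : g = 0
    · simp [hg, gauss_eq_zero.2]
    obtain ⟨i, hi, hi'⟩ := exists_last hf
    obtain ⟨j, hj, hj'⟩ := exists_last hg
    have hfp : 0 < gauss f := pos_iff_ne_zero.2 fun h => hf (gauss_eq_zero.1 h)
    have hgp : 0 < gauss g := pos_iff_ne_zero.2 fun h => hg (gauss_eq_zero.1 h)
    refine le_trans (le_of_eq ?_) (le_gauss (f * g) (i + j))
    rw [MvPolynomial.coeff_mul, IsNonarchimedean.apply_sum_eq_of_lt
      (f := fun x : L => ‖x‖₊) (k := (i, j)) IsUltrametricDist.isNonarchimedean_nnnorm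
      (fun a => (nnnorm_neg a).symm) (Finset.HasAntidiagonal.mem_antidiagonal.2 rfl), nnnorm_mul, hi, hj]
    rintro ⟨a, b⟩ hab hne
    replace hab : a + b = i + j := Finset.HasAntidiagonal.mem_antidiagonal.1 hab
    simp only [nnnorm_mul, hi, hj]
    rcases lt_trichotomy (toLex i) (toLex a) with h | h | h
    · exact (mul_le_mul' le_rfl (le_gauss g b)).trans_lt (mul_lt_mul_of_pos_right (hi' a h) hgp)
    · obtain rfl : i = a := toLex.injective h
      exact absurd (by rw [add_left_cancel hab]) hne
    · have hb : toLex j < toLex b := by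
        by_contra hcon
        have h1 : toLex a + toLex b < toLex i + toLex j :=
          add_lt_add_of_lt_of_le h (not_lt.1 hcon)
        exact h1.ne hab
      exact (mul_le_mul' (le_gauss f a) le_rfl).trans_lt (mul_lt_mul_of_pos_left (hj' b hb) hfp)

variable (L s) in
/-- The Gauss norm on `L[t₁,…,t_s]`, as a valuation. -/
def gaussVal : Valuation (MvPolynomial (Fin s) L) ℝ≥0 where
  toFun := gauss
  map_zero' := gauss_eq_zero.2 rfl
  map_one' := by
    apply le_antisymm
    · refine gauss_le fun m => ?_
      classical
      rw [MvPolynomial.coeff_one]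
      split_ifs <;> simp
    · simpa using le_gauss (1 : MvPolynomial (Fin s) L) 0
  map_mul' := gauss_mul
  map_add_le_max' := gauss_add_le

variable (L s) in
/-- The Gauss norm on `L(t₁,…,t_s)`, as a valuation. -/
def gaussRatVal : Valuation (FractionRing (MvPolynomial (Fin s) L)) ℝ≥0 :=
  (gaussVal L s).extendToLocalization (S := nonZeroDivisors (MvPolynomial (Fin s) L))
    (fun _ hf h => nonZeroDivisors.ne_zero hf (gauss_eq_zero.1 h)) _

theorem gaussRatVal_algebraMap (f : MvPolynomial (Fin s) L) :
    gaussRatVal L s (algebraMap _ _ f) = gauss f :=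
  Valuation.extendToLocalization_apply_map_apply _ _ _ f

end Gauss

/-! ### The field `𝕂` and its Frobenius -/

section BigField

variable (Fq : Type*) [Field Fq] [Fintype Fq] (s : ℕ)

/-- The field `𝕂`, the completion of `ℂ_∞(t₁,…,t_s)` for the Gauss norm. -/
def KK : Type _ := (absOfValuation (gaussRatVal (Cinf Fq) s)).Completion

instance : NormedField (KK Fq s) :=
  inferInstanceAs (NormedField (absOfValuation (gaussRatVal (Cinf Fq) s)).Completion)

instance : CompleteSpace (KK Fq s) :=
  inferInstanceAs (CompleteSpace (absOfValuation (gaussRatVal (Cinf Fq) s)).Completion)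

instance : IsUltrametricDist (KK Fq s) :=
  IsUltrametricDist.isUltrametricDist_of_forall_norm_add_le_max_norm
    (completion_norm_add_le (gaussRatVal (Cinf Fq) s))

/-- The embedding `ℂ_∞(t₁,…,t_s) → 𝕂`. -/
def ratToKK : FractionRing (MvPolynomial (Fin s) (Cinf Fq)) →+* KK Fq s :=
  (UniformSpace.Completion.coeRingHom :
    WithAbs (absOfValuation (gaussRatVal (Cinf Fq) s)) →+* _).comp
      (WithAbs.equiv (absOfValuation (gaussRatVal (Cinf Fq) s))).symm.toRingHom

theorem norm_ratToKK (f : FractionRing (MvPolynomial (Fin s) (Cinf Fq))) :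
    ‖ratToKK Fq s f‖ = (gaussRatVal (Cinf Fq) s f : ℝ) :=
  UniformSpace.Completion.norm_coe (WithAbs.toAbs (absOfValuation (gaussRatVal (Cinf Fq) s)) f)

/-- The embedding `ℂ_∞ → 𝕂`. -/
def cToKK : Cinf Fq →+* KK Fq s :=
  (ratToKK Fq s).comp ((algebraMap (MvPolynomial (Fin s) (Cinf Fq))
    (FractionRing (MvPolynomial (Fin s) (Cinf Fq)))).comp MvPolynomial.C)

theorem cToKK_apply (z : Cinf Fq) : cToKK Fq s z =
    ratToKK Fq s (algebraMap (MvPolynomial (Fin s) (Cinf Fq)) _ (MvPolynomial.C z)) := rfl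

theorem norm_cToKK (z : Cinf Fq) : ‖cToKK Fq s z‖ = ‖z‖ := by
  rw [cToKK_apply, norm_ratToKK, gaussRatVal_algebraMap, ← coe_nnnorm]
  congr 1
  apply le_antisymm
  · refine gauss_le fun m => ?_
    classical
    rw [MvPolynomial.coeff_C]
    split_ifs <;> simp
  · simpa using le_gauss (MvPolynomial.C z : MvPolynomial (Fin s) (Cinf Fq)) 0

/-- The embedding `𝔽_q(t₁,…,t_s) → 𝕂`, the identity on the variables. -/
def constToKK : FractionRing (MvPolynomial (Fin s) Fq) →+* KK Fq s :=
  (ratToKK Fq s).comp (IsFractionRing.map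
    (A := MvPolynomial (Fin s) Fq) (B := MvPolynomial (Fin s) (Cinf Fq))
    (j := MvPolynomial.map (algebraMap Fq (Cinf Fq)))
    (MvPolynomial.map_injective _ (algebraMap Fq (Cinf Fq)).injective))

/-- The automorphism of `ℂ_∞(t₁,…,t_s)` which is `x ↦ x ^ q` on `ℂ_∞` and fixes the variables. -/
def tauRat : FractionRing (MvPolynomial (Fin s) (Cinf Fq)) ≃+*
    FractionRing (MvPolynomial (Fin s) (Cinf Fq)) :=
  IsFractionRing.ringEquivOfRingEquiv (MvPolynomial.mapEquiv (Fin s) (frob Fq))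

theorem gauss_frob (f : MvPolynomial (Fin s) (Cinf Fq)) :
    gauss (MvPolynomial.mapEquiv (Fin s) (frob Fq) f) = gauss f ^ Fintype.card Fq := by
  have hcoeff : ∀ m, ‖(MvPolynomial.mapEquiv (Fin s) (frob Fq) f).coeff m‖₊ =
      ‖f.coeff m‖₊ ^ Fintype.card Fq := fun m => by
    rw [MvPolynomial.mapEquiv_apply, MvPolynomial.coeff_map]
    exact nnnorm_pow _ _
  apply le_antisymm
  · refine gauss_le fun m => ?_
    rw [hcoeff]
    exact pow_le_pow_left' (le_gauss f m) _
  · by_cases hf : f = 0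
    · simp [hf, gauss_eq_zero.2, Fintype.card_ne_zero]
    obtain ⟨i, hi, -⟩ := exists_last hf
    rw [← hi, ← hcoeff]
    exact le_gauss _ i

theorem gaussRatVal_tauRat (f : FractionRing (MvPolynomial (Fin s) (Cinf Fq))) :
    gaussRatVal (Cinf Fq) s (tauRat Fq s f) =
      gaussRatVal (Cinf Fq) s f ^ Fintype.card Fq := by
  obtain ⟨a, b, hb, rfl⟩ := IsFractionRing.div_surjective (A := MvPolynomial (Fin s) (Cinf Fq)) f
  simp only [map_div₀, tauRat, IsFractionRing.ringEquivOfRingEquiv_algebraMap,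
    gaussRatVal_algebraMap, gauss_frob, div_pow]

/-- `tauRat`, seen on the copy of `ℂ_∞(t₁,…,t_s)` that carries the Gauss norm. -/
def tauAbs : WithAbs (absOfValuation (gaussRatVal (Cinf Fq) s)) ≃+*
    WithAbs (absOfValuation (gaussRatVal (Cinf Fq) s)) :=
  ((WithAbs.equiv _).trans (tauRat Fq s)).trans (WithAbs.equiv _).symm

theorem norm_tauAbs (x : WithAbs (absOfValuation (gaussRatVal (Cinf Fq) s))) :
    ‖tauAbs Fq s x‖ = ‖x‖ ^ Fintype.card Fq := by
  change ((gaussRatVal (Cinf Fq) s (tauRat Fq s x.ofAbs) : ℝ≥0) : ℝ) =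
    ((gaussRatVal (Cinf Fq) s x.ofAbs : ℝ≥0) : ℝ) ^ Fintype.card Fq
  rw [gaussRatVal_tauRat, NNReal.coe_pow]

theorem continuous_tauAbs : Continuous (tauAbs Fq s) := by
  refine Metric.continuous_iff.2 fun x ε hε => ?_
  have h : Filter.Tendsto (fun r : ℝ => r ^ Fintype.card Fq) (𝓝 0) (𝓝 0) := by
    have := (continuous_pow (M := ℝ) (Fintype.card Fq)).tendsto 0
    rwa [zero_pow Fintype.card_ne_zero] at this
  obtain ⟨δ, hδ, H⟩ := Metric.tendsto_nhds_nhds.1 h ε hε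
  refine ⟨δ, hδ, fun y hy => ?_⟩
  rw [dist_eq_norm] at hy ⊢
  rw [← map_sub, norm_tauAbs]
  have := H (x := ‖y - x‖) (by simpa using hy)
  rw [dist_zero_right, Real.norm_eq_abs] at this
  exact (le_abs_self _).trans_lt this

theorem continuous_tauAbs_symm : Continuous (tauAbs Fq s).symm := by
  refine Metric.continuous_iff.2 fun x ε hε => ⟨ε ^ Fintype.card Fq, pow_pos hε _, fun y hy => ?_⟩
  rw [dist_eq_norm] at hy ⊢
  rw [← map_sub]
  refine lt_of_pow_lt_pow_left₀ (Fintype.card Fq) hε.le ?_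
  rwa [← norm_tauAbs, RingEquiv.apply_symm_apply]

/-- The automorphism `τ` of `𝕂`: the continuous extension of `x ↦ x ^ q` on `ℂ_∞` which fixes
`𝔽_q(t₁,…,t_s)`. -/
def tau : RingAut (KK Fq s) :=
  UniformSpace.Completion.mapRingEquiv (tauAbs Fq s) (continuous_tauAbs Fq s)
    (continuous_tauAbs_symm Fq s)

theorem tau_ratToKK (f : FractionRing (MvPolynomial (Fin s) (Cinf Fq))) :
    tau Fq s (ratToKK Fq s f) = ratToKK Fq s (tauRat Fq s f) :=
  UniformSpace.Completion.mapRingHom_coe (continuous_tauAbs Fq s)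
    (WithAbs.toAbs (absOfValuation (gaussRatVal (Cinf Fq) s)) f)

theorem tau_cToKK (z : Cinf Fq) :
    tau Fq s (cToKK Fq s z) = cToKK Fq s z ^ Fintype.card Fq := by
  rw [cToKK_apply, tau_ratToKK, tauRat, IsFractionRing.ringEquivOfRingEquiv_algebraMap,
    MvPolynomial.mapEquiv_apply, MvPolynomial.map_C]
  change ratToKK Fq s (algebraMap _ _ (MvPolynomial.C (frob Fq z))) = _
  rw [frob_apply, map_pow, map_pow, map_pow]

theorem tau_constToKK (f : FractionRing (MvPolynomial (Fin s) Fq)) :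
    tau Fq s (constToKK Fq s f) = constToKK Fq s f := by
  obtain ⟨a, b, hb, rfl⟩ := IsFractionRing.div_surjective (A := MvPolynomial (Fin s) Fq) f
  have key : ∀ a : MvPolynomial (Fin s) Fq,
      tau Fq s (constToKK Fq s (algebraMap _ _ a)) = constToKK Fq s (algebraMap _ _ a) := fun a => by
    have h1 : constToKK Fq s (algebraMap _ _ a) = ratToKK Fq s (algebraMap _ _
        (MvPolynomial.map (algebraMap Fq (Cinf Fq)) a)) :=
      congrArg (ratToKK Fq s) (IsLocalization.map_eq _ a)
    have h2 : MvPolynomial.mapEquiv (Fin s) (frob Fq)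
        (MvPolynomial.map (algebraMap Fq (Cinf Fq)) a) =
          MvPolynomial.map (algebraMap Fq (Cinf Fq)) a := by
      ext m
      rw [MvPolynomial.mapEquiv_apply, MvPolynomial.coeff_map, MvPolynomial.coeff_map]
      change frob Fq _ = _
      rw [frob_apply, ← map_pow, FiniteField.pow_card]
    rw [h1, tau_ratToKK, tauRat, IsFractionRing.ringEquivOfRingEquiv_algebraMap, h2]
  rw [map_div₀, map_div₀, key, key]

theorem continuous_tau : Continuous (tau Fq s) :=
  UniformSpace.Completion.continuous_map

end BigField

/-! ### Lattices and exponentials -/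

section Main

variable {Fq : Type*} [Field Fq] [Fintype Fq] {s n r : ℕ}

/-- An `A`-lattice in `ℂ_∞`: a finitely generated strongly discrete `A`-submodule. -/
structure IsLattice (Λ : Submodule Fq[X] (Cinf Fq)) : Prop where
  fg : Λ.FG
  strongly_discrete : ∀ (x : Cinf Fq) (R : ℝ), {l : Cinf Fq | l ∈ Λ ∧ ‖l - x‖ ≤ R}.Finite

/-- The nonzero elements of `Λ`. -/
abbrev Nonzero (Λ : Submodule Fq[X] (Cinf Fq)) : Type _ := {l : Cinf Fq // l ∈ Λ ∧ l ≠ 0}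

/-- The exponential function `exp_Λ(Z) = Z ∏' (1 - Z / λ)` on `ℂ_∞`. -/
def expC (Λ : Submodule Fq[X] (Cinf Fq)) (Z : Cinf Fq) : Cinf Fq :=
  Z * ∏' l : Nonzero Λ, (1 - Z / (l : Cinf Fq))

open scoped PowerSeries.WithPiTopology in
/-- The formal power series `exp_Λ(Z) / Z = ∏' (1 - Z / λ)`, where the product converges
coefficientwise. -/
def expDivSeries (Λ : Submodule Fq[X] (Cinf Fq)) : PowerSeries (Cinf Fq) :=
  ∏' l : Nonzero Λ, (1 - PowerSeries.C (l : Cinf Fq)⁻¹ * PowerSeries.X)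

/-- The coefficient `α_i` of `Z ^ (q ^ i)` in `exp_Λ(Z) = ∑ α_i Z ^ (q ^ i)`. -/
def alpha (Λ : Submodule Fq[X] (Cinf Fq)) (i : ℕ) : Cinf Fq :=
  PowerSeries.coeff (Fintype.card Fq ^ i) (PowerSeries.X * expDivSeries Λ)

/-- The exponential `exp_Λ(x) = ∑ α_i τ^i(x)` on `𝕂`. -/
def expK (Λ : Submodule Fq[X] (Cinf Fq)) (x : KK Fq s) : KK Fq s :=
  ∑' i : ℕ, cToKK Fq s (alpha Λ i) * (tau Fq s ^ i) x

/-- The power series in `Z` of the function `exp_Λ(w Z) = ∑ α_i τ^i(w) Z ^ (q ^ i)`,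
for `w` in `𝕂`. -/
def expSeriesAt (Λ : Submodule Fq[X] (Cinf Fq)) (w : KK Fq s) : PowerSeries (KK Fq s) :=
  PowerSeries.mk fun m => ∑ i ∈ Finset.range (m + 1),
    if Fintype.card Fq ^ i = m then cToKK Fq s (alpha Λ i) * (tau Fq s ^ i) w else 0

/-! ### Power series over `𝕂` in a variable of `ℂ_∞` -/

/-- The value at `Z` in `ℂ_∞` of a power series over `𝕂`. -/
def evalSeries (f : PowerSeries (KK Fq s)) (Z : Cinf Fq) : KK Fq s :=
  ∑' m : ℕ, PowerSeries.coeff m f * cToKK Fq s Z ^ m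

/-- The series `f` converges on the disk `D(0, ρ)`. -/
def ConvergesOnDisk (f : PowerSeries (KK Fq s)) (ρ : ℝ) : Prop :=
  Filter.Tendsto (fun m => ‖PowerSeries.coeff m f‖ * ρ ^ m) Filter.atTop (𝓝 0)

/-- `f` is an analytic function on the disk `D(0, ρ)`: it is the sum of a power series which
converges there. -/
def IsAnalyticOnDisk (f : Cinf Fq → KK Fq s) (ρ : ℝ) : Prop :=
  ∃ g : PowerSeries (KK Fq s), ConvergesOnDisk g ρ ∧
    ∀ Z : Cinf Fq, ‖Z‖ ≤ ρ → HasSum (fun m => PowerSeries.coeff m g * cToKK Fq s Z ^ m) (f Z)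

/-- The divided higher derivative `𝒟_k`, with `𝒟_k(Z ^ m) = binom(m, k) Z ^ (m - k)`. -/
def dividedDeriv (k : ℕ) (f : PowerSeries (KK Fq s)) : PowerSeries (KK Fq s) :=
  PowerSeries.mk fun m => ((m + k).choose k : KK Fq s) * PowerSeries.coeff (m + k) f

/-! ### The objects attached to `χ` -/

/-- `χ(a)`, as a matrix over `𝕂`. -/
def chiK (χ : Fq[X] →ₐ[Fq] Matrix (Fin n) (Fin n) (FractionRing (MvPolynomial (Fin s) Fq)))
    (a : Fq[X]) : Matrix (Fin n) (Fin n) (KK Fq s) :=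
  (χ a).map (constToKK Fq s)

/-- `θ I_n - χ(θ)`. -/
def thetaSubChi
    (χ : Fq[X] →ₐ[Fq] Matrix (Fin n) (Fin n) (FractionRing (MvPolynomial (Fin s) Fq))) :
    Matrix (Fin n) (Fin n) (KK Fq s) :=
  cToKK Fq s (theta Fq) • (1 : Matrix (Fin n) (Fin n) (KK Fq s)) - chiK χ Polynomial.X

/-- The function `exp_Λ((θ I_n - χ(θ))⁻¹ Z)`, with `exp_Λ` applied to each entry. -/
def expChi (Λ : Submodule Fq[X] (Cinf Fq))
    (χ : Fq[X] →ₐ[Fq] Matrix (Fin n) (Fin n) (FractionRing (MvPolynomial (Fin s) Fq)))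
    (Z : Cinf Fq) : Matrix (Fin n) (Fin n) (KK Fq s) :=
  (cToKK Fq s Z • (thetaSubChi χ)⁻¹).map (expK Λ)

/-- The matrix `ω_Λ`, the column of the blocks `exp_Λ((θ I_n - χ(θ))⁻¹ λ_i)`. -/
def omega (Λ : Submodule Fq[X] (Cinf Fq))
    (χ : Fq[X] →ₐ[Fq] Matrix (Fin n) (Fin n) (FractionRing (MvPolynomial (Fin s) Fq)))
    (lam : Fin r → Cinf Fq) : Matrix (Fin r × Fin n) (Fin n) (KK Fq s) :=
  Matrix.of fun p j => expChi Λ χ (lam p.1) p.2 j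

/-- The square matrix `(ω_Λ, ω_Λ^(-1), …, ω_Λ^(1-r))`. -/
def Omega (Λ : Submodule Fq[X] (Cinf Fq))
    (χ : Fq[X] →ₐ[Fq] Matrix (Fin n) (Fin n) (FractionRing (MvPolynomial (Fin s) Fq)))
    (lam : Fin r → Cinf Fq) : Matrix (Fin r × Fin n) (Fin r × Fin n) (KK Fq s) :=
  Matrix.of fun p c => ((tau Fq s)⁻¹ ^ (c.1 : ℕ)) (omega Λ χ lam p c.2)

/-- The entries of `𝓗(Z) = exp_Λ(Z)⁻¹ exp_Λ((θ I_n - χ(θ))⁻¹ Z)` as power series in `Z`;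
numerator and denominator have both been divided by `Z`. -/
def HSeries (Λ : Submodule Fq[X] (Cinf Fq))
    (χ : Fq[X] →ₐ[Fq] Matrix (Fin n) (Fin n) (FractionRing (MvPolynomial (Fin s) Fq)))
    (i j : Fin n) : PowerSeries (KK Fq s) :=
  (PowerSeries.map (cToKK Fq s) (expDivSeries Λ))⁻¹ *
    PowerSeries.mk fun m => PowerSeries.coeff (m + 1) (expSeriesAt Λ ((thetaSubChi χ)⁻¹ i j))

/-- The function `𝓗_k = (𝒟_{q^k-1} 𝓗)^(-k)`. -/
def Hk (Λ : Submodule Fq[X] (Cinf Fq))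
    (χ : Fq[X] →ₐ[Fq] Matrix (Fin n) (Fin n) (FractionRing (MvPolynomial (Fin s) Fq)))
    (k : ℕ) (Z : Cinf Fq) : Matrix (Fin n) (Fin n) (KK Fq s) :=
  Matrix.of fun i j => ((tau Fq s)⁻¹ ^ k)
    (evalSeries (dividedDeriv (Fintype.card Fq ^ k - 1) (HSeries Λ χ i j)) Z)

/-- The matrix of functions `(𝓗_0, …, 𝓗_{r-1})`. -/
def HMatrix (r : ℕ) (Λ : Submodule Fq[X] (Cinf Fq))
    (χ : Fq[X] →ₐ[Fq] Matrix (Fin n) (Fin n) (FractionRing (MvPolynomial (Fin s) Fq)))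
    (Z : Cinf Fq) : Matrix (Fin n) (Fin r × Fin n) (KK Fq s) :=
  Matrix.of fun i c => Hk Λ χ (c.1 : ℕ) Z i c.2

/-- The row `(χ(a_1), …, χ(a_r))`. -/
def chiRow (χ : Fq[X] →ₐ[Fq] Matrix (Fin n) (Fin n) (FractionRing (MvPolynomial (Fin s) Fq)))
    (a : Fin r → Fq[X]) : Matrix (Fin n) (Fin r × Fin n) (KK Fq s) :=
  Matrix.of fun i c => chiK χ (a c.1) i c.2

/-- The lattice element `a_1 λ_1 + ⋯ + a_r λ_r`. -/
def latticePoint (lam : Fin r → Cinf Fq) (a : Fin r → Fq[X]) : Cinf Fq := ∑ i, a i • lam i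

/-- The general term of the Perkins series. -/
def psiTerm (χ : Fq[X] →ₐ[Fq] Matrix (Fin n) (Fin n) (FractionRing (MvPolynomial (Fin s) Fq)))
    (lam : Fin r → Cinf Fq) (Z : Cinf Fq) (a : Fin r → Fq[X]) :
    Matrix (Fin n) (Fin r × Fin n) (KK Fq s) :=
  cToKK Fq s (Z - latticePoint lam a)⁻¹ • chiRow χ a

/-- The Perkins series
`ψ_Λ(Z) = ∑_a (Z - a_1 λ_1 - ⋯ - a_r λ_r)⁻¹ (χ(a_1), …, χ(a_r))`. -/
def psi (χ : Fq[X] →ₐ[Fq] Matrix (Fin n) (Fin n) (FractionRing (MvPolynomial (Fin s) Fq)))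
    (lam : Fin r → Cinf Fq) (Z : Cinf Fq) : Matrix (Fin n) (Fin r × Fin n) (KK Fq s) :=
  ∑' a : Fin r → Fq[X], psiTerm χ lam Z a

/-- The general term of the Eisenstein series of weight `j`. -/
def eisensteinTerm
    (χ : Fq[X] →ₐ[Fq] Matrix (Fin n) (Fin n) (FractionRing (MvPolynomial (Fin s) Fq)))
    (lam : Fin r → Cinf Fq) (j : ℕ) (a : {a : Fin r → Fq[X] // a ≠ 0}) :
    Matrix (Fin n) (Fin r × Fin n) (KK Fq s) :=
  cToKK Fq s (latticePoint lam a.1 ^ j)⁻¹ • chiRow χ a.1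

/-- The Eisenstein series
`ℰ_Λ(j; χ) = ∑'_a (a_1 λ_1 + ⋯ + a_r λ_r)^(-j) (χ(a_1), …, χ(a_r))`. -/
def eisenstein
    (χ : Fq[X] →ₐ[Fq] Matrix (Fin n) (Fin n) (FractionRing (MvPolynomial (Fin s) Fq)))
    (lam : Fin r → Cinf Fq) (j : ℕ) : Matrix (Fin n) (Fin r × Fin n) (KK Fq s) :=
  ∑' a : {a : Fin r → Fq[X] // a ≠ 0}, eisensteinTerm χ lam j a

end Main

end Perkins

end

/-!
The proof rests on a partial fraction expansion and on an elimination argument.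

*Partial fractions.* For a finite `𝔽_q`-subspace `W` of `Λ`, the polynomial
`P_W(Z) = Z ∏ (1 - Z / w)` is `𝔽_q`-linear. With `M = (θ - χ(θ))⁻¹`, the polynomial
`P_W(M Z) - τ^(dim W)(M) P_W(Z)` has degree less than `|W|`, and Lagrange interpolation at the
points of `W` writes `P_W(M Z) / P_W(Z)` as `τ^(dim W)(M) + ∑ P_W(M w) / (Z - w)`
(`twEval_subPoly_mul`). The constant tends to `0` with growing `W`, because the entries of `M` have
size less than `1`. Since `θ M = 1 + χ(θ) M` and `P_W` vanishes on `W`, one has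
`P_W(M λ) = ∑ χ(a_i) P_W(M λ_i)` at `λ = a_1 λ_1 + ⋯ + a_r λ_r` (`twChi_latticePoint`).
In the limit over the spaces of tuples of polynomials of bounded degree,
`exp_Λ(M Z) = exp_Λ(Z) ψ_Λ(Z) ω_Λ` (`IsLatticeBasis.expChi_eq`). For `r = 0` the constant is `M`,
and it is carried along.

*The identity `𝓗 = ψ_Λ Ω_Λ`.* Near the origin each `1 / (Z - λ)` expands in powers of `Z`, and the
sums may be exchanged (`IsLatticeBasis.hasSum_choose_mul`); this gives the expansion of `ψ_Λ` in
Eisenstein series, those of weight not congruent to `1` modulo `q - 1` being zero by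
homogeneity. The divided derivative of order `q^k - 1` replaces `1 / (Z - λ)` by
`1 / (Z - λ)^(q^k) = τ^k(1 / (Z - λ))`, while `χ(a)` is fixed by `τ`. Hence `τ^(-k)` turns
`𝒟_{q^k-1} 𝓗` into `ψ_Λ ω_Λ^(-k)` (`IsLatticeBasis.Hk_apply`).

*Invertibility of `Ω_Λ`.* The products `χ(a) ω_Λ = exp_Λ(M λ)` are evaluated at a shortest lattice
point `λ` among those whose coordinates have given constant terms `c ≠ 0`. No lattice point is then
closer to `λ / θ` than `0`, so `|exp_Λ(λ / θ)|` is as large as the maximum of `|exp_Λ|` on its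
circle, whereas `M` differs from `1 / θ` by terms of size at most `|θ|⁻²`. The matrix
`exp_Λ(M λ)` is therefore dominated by the scalar `exp_Λ(λ / θ)`, which is an injective
`𝔽_q`-linear function of `c` (`IsLatticeBasis.norm_expChi_sub_lt`). A vector in the kernel of `Ω_Λ`
solves the Moore system formed by these matrices and their images under `τ`, and such a system has
no nonzero solution, by an elimination with pivots of least size
(`eq_zero_of_sum_tauMat_mulVec_eq_zero`).
-/

set_option linter.unusedSectionVars false

open scoped Polynomial NNReal Topology

open Filter

noncomputable section

namespace Perkins

/-! ### Ultrametric fields: matrices, products and series -/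

section Ultrametric

variable {E : Type*} [NormedField E]

theorem exists_norm_coord_max {n : ℕ} {v : Fin n → E} (hv : v ≠ 0) :
    ∃ i, v i ≠ 0 ∧ ∀ j, ‖v j‖ ≤ ‖v i‖ := by
  obtain ⟨i₀, hi₀⟩ := Function.ne_iff.1 hv
  have : Nonempty (Fin n) := ⟨i₀⟩
  obtain ⟨i, hi⟩ := Finite.exists_max fun j => ‖v j‖
  refine ⟨i, fun h => hi₀ ?_, hi⟩
  have := hi i₀
  rw [h, norm_zero] at this
  simpa using this

/-- A dominating geometric sequence. -/
theorem norm_mul_pow_le_geometric {a : E} {m : ℕ} {B R : ℝ} (hR : 0 < R)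
    (h : ‖a‖ * R ^ m ≤ B) {x : ℝ} (hx : 0 ≤ x) : ‖a‖ * x ^ m ≤ B * (x / R) ^ m := by
  rw [div_pow, mul_div_assoc', le_div_iff₀ (pow_pos hR m), mul_right_comm]
  exact mul_le_mul_of_nonneg_right h (pow_nonneg hx m)

variable {f g : PowerSeries E} {B B' R : ℝ}

theorem summable_norm_coeff_mul_pow (hR : 0 < R)
    (hf : ∀ m, ‖PowerSeries.coeff m f‖ * R ^ m ≤ B) {x : E} (hx : ‖x‖ < R) :
    Summable fun m => ‖PowerSeries.coeff m f * x ^ m‖ := by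
  refine Summable.of_nonneg_of_le (fun _ => norm_nonneg _) (fun m => ?_)
    ((summable_geometric_of_lt_one (by positivity) ((div_lt_one hR).2 hx)).mul_left B)
  rw [norm_mul, norm_pow]
  exact norm_mul_pow_le_geometric hR (hf m) (norm_nonneg _)

theorem tsum_coeff_mul [CompleteSpace E] (hR : 0 < R)
    (hf : ∀ m, ‖PowerSeries.coeff m f‖ * R ^ m ≤ B)
    (hg : ∀ m, ‖PowerSeries.coeff m g‖ * R ^ m ≤ B') {x : E} (hx : ‖x‖ < R) :
    ∑' m, PowerSeries.coeff m (f * g) * x ^ m =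
      (∑' m, PowerSeries.coeff m f * x ^ m) * ∑' m, PowerSeries.coeff m g * x ^ m := by
  rw [tsum_mul_tsum_eq_tsum_sum_antidiagonal_of_summable_norm
    (summable_norm_coeff_mul_pow hR hf hx) (summable_norm_coeff_mul_pow hR hg hx)]
  refine tsum_congr fun m => ?_
  rw [PowerSeries.coeff_mul, Finset.sum_mul]
  refine Finset.sum_congr rfl fun p hp => ?_
  rw [← Finset.HasAntidiagonal.mem_antidiagonal.1 hp, pow_add]
  ring

variable [IsUltrametricDist E]

/-- A matrix dominated by its scalar part is invertible: a vector of its kernel has no coordinate of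
largest norm. -/
theorem isUnit_of_norm_sub_smul_one_lt {n : ℕ} {B : Matrix (Fin n) (Fin n) E} {c : E}
    (h : ∀ i j, ‖B i j - (c • (1 : Matrix (Fin n) (Fin n) E)) i j‖ < ‖c‖) : IsUnit B := by
  rw [← Matrix.mulVec_injective_iff_isUnit]
  refine (injective_iff_map_eq_zero B.mulVecLin).2 fun v hv => ?_
  by_contra hne
  obtain ⟨i, hi, hmax⟩ := exists_norm_coord_max hne
  have h1 : c * v i = -∑ j, (B i j - (c • (1 : Matrix (Fin n) (Fin n) E)) i j) * v j := by
    have h2 := congrFun hv i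
    simp only [Matrix.mulVecLin_apply, Matrix.mulVec, dotProduct, Pi.zero_apply] at h2
    simp only [sub_mul, Finset.sum_sub_distrib, h2, Matrix.smul_apply, Matrix.one_apply]
    simp
  have hvi : 0 < ‖v i‖ := norm_pos_iff.2 hi
  have h3 : ‖c * v i‖ < ‖c‖ * ‖v i‖ := by
    rw [h1, norm_neg]
    obtain ⟨j, -, hj⟩ := IsUltrametricDist.exists_norm_finsetSum_le_of_nonempty
      (t := (Finset.univ : Finset (Fin n))) ⟨i, Finset.mem_univ i⟩
      (fun j => (B i j - (c • (1 : Matrix (Fin n) (Fin n) E)) i j) * v j)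
    refine hj.trans_lt ?_
    rw [norm_mul]
    exact (mul_le_mul_of_nonneg_left (hmax j) (norm_nonneg _)).trans_lt
      (mul_lt_mul_of_pos_right (h i j) hvi)
  rw [norm_mul] at h3
  exact lt_irrefl _ h3

/-- If a family tends to `0` then so do its finite products, as the finite index set varies. -/
theorem tendsto_finset_prod_cofinite {ι : Type*} {f : ι → ℝ} (h0 : ∀ i, 0 ≤ f i)
    (h : Tendsto f cofinite (𝓝 0)) :
    Tendsto (fun T : Finset ι => ∏ i ∈ T, f i) cofinite (𝓝 0) := by
  classical
  have hfin : ∀ ε > 0, {i | ε ≤ f i}.Finite := fun ε hε => by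
    have := h.eventually (gt_mem_nhds hε)
    rw [eventually_cofinite] at this
    simpa using this
  -- `c`, the product of the terms of size at least `1`, bounds all the finite products.
  set B := (hfin 1 one_pos).toFinset
  set c := ∏ i ∈ B, f i
  have hB : ∀ i ∈ B, 1 ≤ f i := fun i hi => by simpa [B] using hi
  have hB' : ∀ i ∉ B, f i ≤ 1 := fun i hi => by
    have : ¬ 1 ≤ f i := by simpa [B] using hi
    exact (not_le.1 this).le
  have hc : ∀ T : Finset ι, ∏ i ∈ T, f i ≤ c := fun T => by
    have h1 : ∏ i ∈ T, f i ≤ ∏ i ∈ T, (if i ∈ B then f i else 1) :=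
      Finset.prod_le_prod (fun i _ => h0 i) fun i _ => by
        split_ifs with hi
        · exact le_rfl
        · exact hB' i hi
    have h2 : ∏ i ∈ T, (if i ∈ B then f i else 1) ≤ ∏ i ∈ T ∪ B, (if i ∈ B then f i else 1) := by
      refine Finset.prod_le_prod_of_subset_of_one_le Finset.subset_union_left (fun i _ => ?_)
        fun i _ _ => ?_
      · split_ifs
        exacts [h0 i, zero_le_one]
      · split_ifs with hi
        exacts [hB i hi, le_rfl]
    refine h1.trans (h2.trans_eq ?_)
    rw [Finset.prod_ite_mem, Finset.inter_eq_right.2 Finset.subset_union_right]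
  have hcpos : 0 < c := zero_lt_one.trans_le (Finset.one_le_prod hB)
  rw [Metric.tendsto_nhds]
  intro ε hε
  set D := (hfin (ε / c) (div_pos hε hcpos)).toFinset
  rw [eventually_cofinite]
  refine D.powerset.finite_toSet.subset fun T hT => ?_
  simp only [Finset.coe_powerset, Set.mem_preimage, Set.mem_powerset_iff, Finset.coe_subset]
  intro i hi
  by_contra hiD
  have hlt : f i < ε / c := by simpa [D] using hiD
  refine hT ?_
  rw [dist_zero_right, Real.norm_eq_abs, abs_of_nonneg (Finset.prod_nonneg fun i _ => h0 i),
    ← Finset.mul_prod_erase T f hi]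
  calc f i * ∏ x ∈ T.erase i, f x ≤ f i * c := mul_le_mul_of_nonneg_left (hc _) (h0 i)
    _ < ε / c * c := mul_lt_mul_of_pos_right hlt hcpos
    _ = ε := div_mul_cancel₀ _ hcpos.ne'

/-- In a complete ultrametric field, `∏ (1 + f i)` converges as soon as `f i → 0`. -/
theorem multipliable_one_add_of_tendsto [CompleteSpace E] {ι : Type*} {f : ι → E}
    (h : Tendsto f cofinite (𝓝 0)) : Multipliable fun i => 1 + f i := by
  -- The expanded product is the sum of the `∏ i ∈ T, f i` over the finite sets `T`.
  refine multipliable_one_add_of_summable_prod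
    (NonarchimedeanAddGroup.summable_of_tendsto_cofinite_zero ?_)
  rw [tendsto_zero_iff_norm_tendsto_zero] at h ⊢
  simpa [norm_prod] using tendsto_finset_prod_cofinite (fun i => norm_nonneg _) h

open scoped PowerSeries.WithPiTopology in
/-- Over a complete ultrametric field, `∏ (1 + f i X)` converges coefficientwise as soon as
`f i → 0`. -/
theorem multipliable_one_add_C_mul_X [CompleteSpace E] {ι : Type*} {f : ι → E}
    (h : Tendsto f cofinite (𝓝 0)) :
    Multipliable fun i => 1 + PowerSeries.C (f i) * PowerSeries.X := by
  refine multipliable_one_add_of_summable_prod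
    ((PowerSeries.WithPiTopology.summable_iff_summable_coeff _).2 fun m =>
      NonarchimedeanAddGroup.summable_of_tendsto_cofinite_zero ?_)
  rw [tendsto_zero_iff_norm_tendsto_zero] at h ⊢
  refine squeeze_zero (fun _ => norm_nonneg _) (fun T => ?_)
    (tendsto_finset_prod_cofinite (fun i => norm_nonneg _) h)
  rw [Finset.prod_mul_distrib, Finset.prod_const, ← map_prod, PowerSeries.coeff_C_mul,
    PowerSeries.coeff_X_pow, ← norm_prod, norm_mul]
  refine mul_le_of_le_one_right (norm_nonneg _) ?_
  split_ifs <;> simp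

theorem coeff_mul_bound (hR : 0 < R) (hf : ∀ m, ‖PowerSeries.coeff m f‖ * R ^ m ≤ B)
    (hg : ∀ m, ‖PowerSeries.coeff m g‖ * R ^ m ≤ B') (m : ℕ) :
    ‖PowerSeries.coeff m (f * g)‖ * R ^ m ≤ B * B' := by
  rw [← le_div_iff₀ (pow_pos hR m), PowerSeries.coeff_mul]
  have hB : 0 ≤ B := le_trans (by positivity) (hf 0)
  have hB' : 0 ≤ B' := le_trans (by positivity) (hg 0)
  refine IsUltrametricDist.norm_sum_le_of_forall_le_of_nonneg (by positivity) fun p hp => ?_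
  rw [le_div_iff₀ (pow_pos hR m), ← Finset.HasAntidiagonal.mem_antidiagonal.1 hp, pow_add, norm_mul,
    mul_mul_mul_comm]
  exact mul_le_mul (hf _) (hg _) (by positivity) hB

theorem coeff_inv_bound (hR : 0 < R) (hf0 : PowerSeries.coeff 0 f = 1)
    (hf : ∀ m, ‖PowerSeries.coeff m f‖ * R ^ m ≤ 1) (m : ℕ) :
    ‖PowerSeries.coeff m f⁻¹‖ * R ^ m ≤ 1 := by
  induction m using Nat.strong_induction_on with
  | _ m ih =>
    rw [PowerSeries.coeff_inv, ← PowerSeries.coeff_zero_eq_constantCoeff_apply, hf0]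
    split_ifs with hm
    · simp [hm]
    rw [← le_div_iff₀ (pow_pos hR m), inv_one, neg_mul, one_mul, norm_neg]
    refine IsUltrametricDist.norm_sum_le_of_forall_le_of_nonneg (by positivity) fun p hp => ?_
    split_ifs with hlt
    · rw [le_div_iff₀ (pow_pos hR m), ← Finset.HasAntidiagonal.mem_antidiagonal.1 hp, pow_add,
        norm_mul, mul_mul_mul_comm]
      exact mul_le_one₀ (hf _) (by positivity) (ih _ hlt)
    · rw [norm_zero]; positivity

/-- Uniqueness of power series expansions: a power series which vanishes at a sequence of nonzero
points tending to `0` is zero. -/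
theorem eq_zero_of_tsum_coeff_eq_zero [CompleteSpace E] (hR : 0 < R)
    (hf : ∀ m, ‖PowerSeries.coeff m f‖ * R ^ m ≤ B) {x : ℕ → E} (hx0 : ∀ k, x k ≠ 0)
    (hx : Tendsto x atTop (𝓝 0))
    (h : ∀ᶠ k in atTop, ∑' m, PowerSeries.coeff m f * x k ^ m = 0) : f = 0 := by
  ext m
  induction m using Nat.strong_induction_on with
  | _ m ih =>
    simp only [map_zero] at ih ⊢
    have hB : 0 ≤ B := le_trans (by positivity) (hf 0)
    rw [← norm_eq_zero]
    refine le_antisymm (ge_of_tendsto (f := fun k => B / R ^ m * (‖x k‖ / R)) (x := atTop) ?_ ?_)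
      (norm_nonneg _)
    · have := (((tendsto_zero_iff_norm_tendsto_zero.1 hx).div_const R).const_mul (B / R ^ m))
      simpa using this
    · filter_upwards [h, (tendsto_zero_iff_norm_tendsto_zero.1 hx).eventually (gt_mem_nhds hR)]
        with k hk hkR
      have hs := (summable_norm_coeff_mul_pow hR hf hkR).of_norm
      rw [← hs.sum_add_tsum_nat_add (m + 1), Finset.sum_range_succ,
        Finset.sum_eq_zero fun l hl => by rw [ih l (Finset.mem_range.1 hl), zero_mul],
        zero_add, add_eq_zero_iff_eq_neg] at hk
      have hxm : 0 < ‖x k‖ ^ m := pow_pos (norm_pos_iff.2 (hx0 k)) m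
      refine le_of_mul_le_mul_right ?_ hxm
      rw [← norm_pow, ← norm_mul, hk, norm_neg]
      refine IsUltrametricDist.norm_tsum_le_of_forall_le_of_nonneg (by positivity) fun l => ?_
      rw [norm_mul, norm_pow, norm_pow]
      refine (norm_mul_pow_le_geometric hR (hf _) (norm_nonneg _)).trans ?_
      rw [show B / R ^ m * (‖x k‖ / R) * ‖x k‖ ^ m = B * (‖x k‖ / R) ^ (m + 1) by
        rw [div_pow, pow_succ, pow_succ]; field_simp]
      refine mul_le_mul_of_nonneg_left (pow_le_pow_of_le_one (by positivity)
        ((div_le_one hR).2 hkR.le) (by omega)) hB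

end Ultrametric

/-! ### Finite spaces and linearised polynomials -/

section Linearised

variable {Fq : Type*} [Field Fq] [Fintype Fq]

/-- `∏ (x - c) = x ^ q - x`, the product being over `c` in `𝔽_q`. -/
theorem prod_sub_algebraMap {R : Type*} [CommRing R] [Algebra Fq R] (x : R) :
    ∏ c : Fq, (x - algebraMap Fq R c) = x ^ Fintype.card Fq - x := by
  have h := Polynomial.prod_multiset_X_sub_C_of_monic_of_roots_card_eq
    (p := (Polynomial.X ^ Fintype.card Fq - Polynomial.X : Fq[X]))
    (Polynomial.monic_X_pow_sub (by simpa using Fintype.one_lt_card))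
    (by rw [FiniteField.roots_X_pow_card_sub_X,
      FiniteField.X_pow_card_sub_X_natDegree_eq Fq Fintype.one_lt_card]; rfl)
  rw [FiniteField.roots_X_pow_card_sub_X] at h
  have h2 := congrArg (Polynomial.aeval x) h
  change (Polynomial.aeval x) (∏ c : Fq, (Polynomial.X - Polynomial.C c)) = _ at h2
  simpa [map_prod] using h2

variable {L : Type*} [Field L] [Algebra Fq L]

/-- The homogeneous form of `∏ (x - c) = x ^ q - x`. -/
theorem prod_sub_C_mul (T : L[X]) (w : L) :
    ∏ c : Fq, (T - Polynomial.C (algebraMap Fq L c * w)) =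
      T ^ Fintype.card Fq - Polynomial.C (w ^ (Fintype.card Fq - 1)) * T := by
  have hq : Fintype.card Fq - 1 ≠ 0 := Nat.sub_ne_zero_of_lt Fintype.one_lt_card
  by_cases hw : w = 0
  · simp [hw, hq]
  have h := prod_sub_algebraMap (Fq := Fq) (Polynomial.C w⁻¹ * T)
  have h1 : ∀ c : Fq, T - Polynomial.C (algebraMap Fq L c * w) =
      Polynomial.C w * (Polynomial.C w⁻¹ * T - algebraMap Fq L[X] c) := fun c => by
    rw [mul_sub, ← mul_assoc, ← Polynomial.C_mul, mul_inv_cancel₀ hw, Polynomial.C_1, one_mul,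
      mul_comm _ w, Polynomial.C_mul]
    rfl
  rw [Finset.prod_congr rfl fun c _ => h1 c, Finset.prod_mul_distrib, h, Finset.prod_const,
    Finset.card_univ, mul_sub, mul_pow, ← mul_assoc, ← mul_assoc, ← mul_pow, ← Polynomial.C_mul,
    mul_inv_cancel₀ hw]
  obtain ⟨m, hm⟩ : ∃ m, Fintype.card Fq = m + 1 :=
    ⟨_, (Nat.sub_add_cancel Fintype.card_pos).symm⟩
  have h2 : Polynomial.C w ^ (m + 1) * Polynomial.C w⁻¹ = Polynomial.C (w ^ m) := by
    rw [← Polynomial.C_pow, ← Polynomial.C_mul, pow_succ, mul_assoc, mul_inv_cancel₀ hw, mul_one]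
  rw [hm, h2]
  simp

variable (Fq) in
/-- A linearised polynomial of `τ`-degree at most `D`: a combination of the monomials
`X ^ (q ^ i)`, `i ≤ D`. -/
def IsLinearised (D : ℕ) (P : L[X]) : Prop :=
  ∃ α : ℕ → L, P = ∑ i ∈ Finset.range (D + 1),
    Polynomial.C (α i) * Polynomial.X ^ Fintype.card Fq ^ i

theorem IsLinearised.comp_sub {D : ℕ} {P : L[X]} (hP : IsLinearised Fq D P) (c : Fq) (v : L) :
    P.comp (Polynomial.X - Polynomial.C (algebraMap Fq L c * v)) =
      P - Polynomial.C (algebraMap Fq L c * P.eval v) := by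
  obtain ⟨α, rfl⟩ := hP
  have hfrob : ∀ (i : ℕ) (x y : L[X]),
      (x - y) ^ Fintype.card Fq ^ i = x ^ Fintype.card Fq ^ i - y ^ Fintype.card Fq ^ i := by
    intro i
    induction i with
    | zero => simp
    | succ i ih =>
      intro x y
      rw [pow_succ, pow_mul, ih, pow_mul, pow_mul]
      exact map_sub (FiniteField.frobeniusAlgHom Fq L[X]) _ _
  have hc : ∀ i, c ^ Fintype.card Fq ^ i = c := fun i => FiniteField.pow_card_pow i c
  simp only [Polynomial.comp, Polynomial.eval₂_finsetSum, Polynomial.eval₂_mul, Polynomial.eval₂_C,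
    Polynomial.eval₂_pow, Polynomial.eval₂_X, Polynomial.eval_finsetSum, hfrob, mul_sub,
    Finset.sum_sub_distrib, Finset.mul_sum, map_sum]
  congr 1
  refine Finset.sum_congr rfl fun i _ => ?_
  rw [← Polynomial.C_pow, ← Polynomial.C_mul, mul_pow, ← map_pow, hc]
  simp only [Polynomial.eval_mul, Polynomial.eval_C, Polynomial.eval_pow, Polynomial.eval_X]
  congr 1
  ring

/-- The product of the `X - w`, over the combinations `w` with coefficients in `𝔽_q` of a finite
family, is linearised: adjoining `v` to the family changes the product `P` to
`∏ (P - c P(v)) = P ^ q - P(v) ^ (q - 1) P`. -/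
theorem isLinearised_prod_fin {D : ℕ} (v : Fin D → L) :
    IsLinearised Fq D (∏ c : Fin D → Fq,
      (Polynomial.X - Polynomial.C (∑ i, algebraMap Fq L (c i) * v i))) := by
  induction D with
  | zero => exact ⟨fun _ => 1, by simp⟩
  | succ D ih =>
    have hP := ih (Fin.tail v)
    set P := ∏ c : Fin D → Fq,
      (Polynomial.X - Polynomial.C (∑ i, algebraMap Fq L (c i) * Fin.tail v i)) with hPdef
    have hstep : (∏ c : Fin (D + 1) → Fq,
        (Polynomial.X - Polynomial.C (∑ i, algebraMap Fq L (c i) * v i))) =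
          P ^ Fintype.card Fq - Polynomial.C (P.eval (v 0) ^ (Fintype.card Fq - 1)) * P := by
      rw [← prod_sub_C_mul, ← (Fin.consEquiv fun _ => Fq).prod_comp, Fintype.prod_prod_type]
      refine Finset.prod_congr rfl fun c _ => ?_
      rw [← hP.comp_sub, hPdef, Polynomial.prod_comp]
      refine Finset.prod_congr rfl fun c' _ => ?_
      simp [Fin.consEquiv, Fin.sum_univ_succ, Fin.tail, sub_sub]
    rw [hstep]
    obtain ⟨α, hα⟩ := hP
    refine ⟨fun i => (if i = 0 then 0 else α (i - 1) ^ Fintype.card Fq) -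
      P.eval (v 0) ^ (Fintype.card Fq - 1) * (if i ≤ D then α i else 0), ?_⟩
    simp only [Polynomial.C_sub, sub_mul, Finset.sum_sub_distrib]
    congr 1
    · rw [Finset.sum_range_succ', hα]
      have := map_sum (FiniteField.frobeniusAlgHom Fq L[X]) (fun i =>
        Polynomial.C (α i) * Polynomial.X ^ Fintype.card Fq ^ i) (Finset.range (D + 1))
      simp only [FiniteField.frobeniusAlgHom_apply] at this
      rw [this]
      simp [mul_pow, pow_succ, pow_mul]
    · rw [Finset.sum_range_succ]
      simp only [show ¬ D + 1 ≤ D by omega, if_false, mul_zero, map_zero, zero_mul, add_zero]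
      nth_rewrite 2 [hα]
      rw [Finset.mul_sum]
      refine Finset.sum_congr rfl fun i hi => ?_
      rw [if_pos (by simpa [Nat.lt_succ_iff] using hi), Polynomial.C_mul, mul_assoc]

variable {W : Type*} [AddCommGroup W] [Module Fq W] [Fintype W] [DecidableEq W]

/-- The polynomial `X ∏ (1 - X / ℓ(w))`, over `w ≠ 0`, attached to an embedding `ℓ` of a finite
space. -/
def subPoly (ℓ : W →ₗ[Fq] L) : L[X] :=
  Polynomial.X * ∏ w ∈ Finset.univ.erase (0 : W), (1 - Polynomial.C (ℓ w)⁻¹ * Polynomial.X)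

theorem prod_neg_ne_zero {ℓ : W →ₗ[Fq] L} (hℓ : Function.Injective ℓ) :
    ∏ w ∈ Finset.univ.erase (0 : W), (-ℓ w) ≠ 0 := by
  refine Finset.prod_ne_zero_iff.2 fun w hw => neg_ne_zero.2 fun h => ?_
  exact (Finset.mem_erase.1 hw).1 (hℓ (by simpa using h))

theorem prod_X_sub_eq_C_mul_subPoly {ℓ : W →ₗ[Fq] L} (hℓ : Function.Injective ℓ) :
    ∏ w, (Polynomial.X - Polynomial.C (ℓ w)) =
      Polynomial.C (∏ w ∈ Finset.univ.erase (0 : W), (-ℓ w)) * subPoly ℓ := by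
  rw [← Finset.mul_prod_erase _ _ (Finset.mem_univ (0 : W)), subPoly, map_prod,
    mul_left_comm, ← Finset.prod_mul_distrib]
  simp only [map_zero, sub_zero]
  congr 1
  refine Finset.prod_congr rfl fun w hw => ?_
  have hw0 : ℓ w ≠ 0 := fun h => (Finset.mem_erase.1 hw).1 (hℓ (by simpa using h))
  rw [mul_sub, ← mul_assoc, ← Polynomial.C_mul, neg_mul, mul_inv_cancel₀ hw0]
  simp
  ring

theorem isLinearised_subPoly {ℓ : W →ₗ[Fq] L} (hℓ : Function.Injective ℓ) :
    IsLinearised Fq (Module.finrank Fq W) (subPoly ℓ) := by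
  set b := Module.finBasis Fq W
  obtain ⟨α, hα⟩ := isLinearised_prod_fin (Fq := Fq) fun i => ℓ (b i)
  have h1 : (∏ c : Fin (Module.finrank Fq W) → Fq, (Polynomial.X - Polynomial.C
      (∑ i, algebraMap Fq L (c i) * ℓ (b i)))) = ∏ w, (Polynomial.X - Polynomial.C (ℓ w)) := by
    rw [← b.equivFun.symm.toEquiv.prod_comp]
    refine Finset.prod_congr rfl fun c _ => ?_
    simp [Module.Basis.equivFun_symm_apply, Algebra.smul_def]
  rw [h1, prod_X_sub_eq_C_mul_subPoly hℓ] at hα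
  refine ⟨fun i => (∏ w ∈ Finset.univ.erase (0 : W), (-ℓ w))⁻¹ * α i, ?_⟩
  have h2 := congrArg
    (fun P => Polynomial.C (∏ w ∈ Finset.univ.erase (0 : W), (-ℓ w))⁻¹ * P) hα
  simp only [← mul_assoc, ← Polynomial.C_mul] at h2
  rw [inv_mul_cancel₀ (prod_neg_ne_zero hℓ), Polynomial.C_1, one_mul] at h2
  rw [h2, Finset.mul_sum]
  simp only [Polynomial.C_mul, mul_assoc]

theorem eval_subPoly_apply (ℓ : W →ₗ[Fq] L) (w : W) : (subPoly ℓ).eval (ℓ w) = 0 := by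
  by_cases hw : ℓ w = 0
  · simp [subPoly, hw]
  rw [subPoly, Polynomial.eval_mul, Polynomial.eval_prod]
  refine mul_eq_zero_of_right _ (Finset.prod_eq_zero
    (Finset.mem_erase.2 ⟨fun h => hw (by simp [h]), Finset.mem_univ w⟩) ?_)
  simp [hw]

/-- Lagrange interpolation at the points of a finite space; the interpolation weights are all
equal, since translation by a point permutes the space. -/
theorem eval_eq_subPoly_mul_sum {K : Type*} [Field K] (φ : L →+* K) {ℓ : W →ₗ[Fq] L}
    (hℓ : Function.Injective ℓ) {P : K[X]} (hP : P.degree < Fintype.card W) {x : K}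
    (hx : ∀ w, x ≠ φ (ℓ w)) :
    P.eval x = ((subPoly ℓ).map φ).eval x *
      ∑ w, P.eval (φ (ℓ w)) * (x - φ (ℓ w))⁻¹ := by
  have hinj : Set.InjOn (fun w => φ (ℓ w)) (Finset.univ : Finset W) :=
    (φ.injective.comp hℓ).injOn
  have h := Lagrange.eq_interpolate hinj (f := P) (by simpa using hP)
  rw [h, Lagrange.eval_interpolate_not_at_node _ fun w _ => hx w, ← h]
  have hw : ∀ w : W, Lagrange.nodalWeight Finset.univ (fun w => φ (ℓ w)) w =
      (φ (∏ w ∈ Finset.univ.erase (0 : W), (-ℓ w)))⁻¹ := fun w => by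
    rw [Lagrange.nodalWeight, map_prod, ← Finset.prod_inv_distrib]
    refine Finset.prod_nbij' (fun j => j - w) (fun j => j + w) (fun j hj => ?_) (fun j hj => ?_)
      (fun j _ => sub_add_cancel _ _) (fun j _ => add_sub_cancel_right _ _) fun j _ => ?_
    · simpa [sub_eq_zero] using hj
    · simpa using hj
    · rw [← map_sub, ← map_sub, ← map_neg, neg_sub]
  simp only [hw]
  have hn : Polynomial.eval x (Lagrange.nodal Finset.univ fun w => φ (ℓ w)) =
      φ (∏ w ∈ Finset.univ.erase (0 : W), (-ℓ w)) * ((subPoly ℓ).map φ).eval x := by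
    have := congrArg (fun P => (P.map φ).eval x) (prod_X_sub_eq_C_mul_subPoly hℓ)
    simp only [Polynomial.map_prod, Polynomial.map_sub, Polynomial.map_X, Polynomial.map_C,
      Polynomial.map_mul, Polynomial.eval_mul, Polynomial.eval_C] at this
    rw [← this, Lagrange.nodal]
  rw [hn, mul_comm (φ _), mul_assoc, Finset.mul_sum]
  congr 1
  refine Finset.sum_congr rfl fun w _ => ?_
  rw [← mul_assoc, ← mul_assoc,
    mul_inv_cancel₀ ((map_ne_zero φ).2 (prod_neg_ne_zero hℓ)), one_mul, mul_comm]

end Linearised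

/-! ### The Frobenius of `𝕂` and the constants -/

section Frobenius

variable (Fq : Type*) [Field Fq] [Fintype Fq] (s : ℕ)

theorem norm_tau (x : KK Fq s) : ‖tau Fq s x‖ = ‖x‖ ^ Fintype.card Fq := by
  induction x using UniformSpace.Completion.induction_on with
  | hp => exact isClosed_eq (continuous_norm.comp (continuous_tau Fq s)) (continuous_norm.pow _)
  | ih a =>
    have h : tau Fq s (a : (absOfValuation (gaussRatVal (Cinf Fq) s)).Completion) =
        (tauAbs Fq s a : (absOfValuation (gaussRatVal (Cinf Fq) s)).Completion) :=
      UniformSpace.Completion.mapRingHom_coe (continuous_tauAbs Fq s) a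
    rw [h]
    change ‖((tauAbs Fq s a : _) : (absOfValuation (gaussRatVal (Cinf Fq) s)).Completion)‖ =
      ‖(a : (absOfValuation (gaussRatVal (Cinf Fq) s)).Completion)‖ ^ _
    rw [UniformSpace.Completion.norm_coe, UniformSpace.Completion.norm_coe, norm_tauAbs]

theorem tau_pow_succ_apply (i : ℕ) (x : KK Fq s) :
    (tau Fq s ^ (i + 1)) x = tau Fq s ((tau Fq s ^ i) x) := by
  rw [pow_succ', RingAut.mul_apply]

theorem norm_tau_pow (i : ℕ) (x : KK Fq s) :
    ‖(tau Fq s ^ i) x‖ = ‖x‖ ^ Fintype.card Fq ^ i := by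
  induction i with
  | zero => simp
  | succ i ih => rw [tau_pow_succ_apply, norm_tau, ih, ← pow_mul, pow_succ]

theorem tau_pow_cToKK (i : ℕ) (z : Cinf Fq) :
    (tau Fq s ^ i) (cToKK Fq s z) = cToKK Fq s z ^ Fintype.card Fq ^ i := by
  induction i with
  | zero => simp
  | succ i ih => rw [tau_pow_succ_apply, ih, map_pow, tau_cToKK, ← pow_mul, pow_succ']

theorem tau_pow_of_fixed {x : KK Fq s} (hx : tau Fq s x = x) (i : ℕ) : (tau Fq s ^ i) x = x := by
  induction i with
  | zero => simp
  | succ i ih => rw [tau_pow_succ_apply, ih, hx]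

theorem tau_inv_pow_tau_pow (k : ℕ) (x : KK Fq s) :
    ((tau Fq s)⁻¹ ^ k) ((tau Fq s ^ k) x) = x := by
  rw [← RingAut.mul_apply, inv_pow, inv_mul_cancel, RingAut.one_apply]

theorem tau_pow_tau_inv_pow (k : ℕ) (x : KK Fq s) :
    (tau Fq s ^ k) (((tau Fq s)⁻¹ ^ k) x) = x := by
  rw [← RingAut.mul_apply, inv_pow, mul_inv_cancel, RingAut.one_apply]

theorem tau_inv_pow_of_fixed {x : KK Fq s} (hx : tau Fq s x = x) (k : ℕ) :
    ((tau Fq s)⁻¹ ^ k) x = x := by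
  conv_lhs => rw [← tau_pow_of_fixed Fq s hx k]
  exact tau_inv_pow_tau_pow Fq s k x

theorem continuous_tau_pow (k : ℕ) : Continuous (tau Fq s ^ k) := by
  induction k with
  | zero => exact continuous_id
  | succ k ih =>
    have : ⇑(tau Fq s ^ (k + 1)) = tau Fq s ∘ ⇑(tau Fq s ^ k) :=
      funext (tau_pow_succ_apply Fq s k)
    rw [this]
    exact (continuous_tau Fq s).comp ih

theorem norm_algebraMap_Fq {c : Fq} (hc : c ≠ 0) : ‖algebraMap Fq (Cinf Fq) c‖ = 1 := by
  have h : algebraMap Fq (Cinf Fq) c ^ (Fintype.card Fq - 1) = 1 := by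
    rw [← map_pow, FiniteField.pow_card_sub_one_eq_one c hc, map_one]
  have h2 := congrArg norm h
  rw [norm_pow, norm_one] at h2
  exact (pow_eq_one_iff_of_nonneg (norm_nonneg _)
    (Nat.sub_ne_zero_of_lt Fintype.one_lt_card)).1 h2

/-- The Gauss norm is trivial on `𝔽_q[t₁,…,t_s]`. -/
theorem gauss_map_eq_one {f : MvPolynomial (Fin s) Fq} (hf : f ≠ 0) :
    gauss (MvPolynomial.map (algebraMap Fq (Cinf Fq)) f) = 1 := by
  have hle : ∀ c : Fq, ‖algebraMap Fq (Cinf Fq) c‖₊ ≤ 1 := fun c => by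
    by_cases hc : c = 0
    · simp [hc]
    · exact (NNReal.coe_le_coe.1 (norm_algebraMap_Fq Fq hc).le)
  refine le_antisymm (gauss_le fun m => ?_) ?_
  · rw [MvPolynomial.coeff_map]
    exact hle _
  · obtain ⟨m, hm⟩ := MvPolynomial.ne_zero_iff.1 hf
    refine le_trans (le_of_eq ?_) (le_gauss _ m)
    rw [MvPolynomial.coeff_map]
    exact NNReal.coe_injective (norm_algebraMap_Fq Fq hm).symm

theorem norm_constToKK_le (f : FractionRing (MvPolynomial (Fin s) Fq)) :
    ‖constToKK Fq s f‖ ≤ 1 := by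
  have key : ∀ a : MvPolynomial (Fin s) Fq, a ≠ 0 →
      ‖constToKK Fq s (algebraMap _ _ a)‖ = 1 := fun a ha => by
    have h1 : constToKK Fq s (algebraMap _ _ a) = ratToKK Fq s (algebraMap _ _
        (MvPolynomial.map (algebraMap Fq (Cinf Fq)) a)) :=
      congrArg (ratToKK Fq s) (IsLocalization.map_eq _ a)
    rw [h1, norm_ratToKK, gaussRatVal_algebraMap, gauss_map_eq_one Fq s ha, NNReal.coe_one]
  obtain ⟨a, b, hb, rfl⟩ := IsFractionRing.div_surjective (A := MvPolynomial (Fin s) Fq) f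
  rw [map_div₀, norm_div, key b (nonZeroDivisors.ne_zero hb), div_one]
  by_cases ha : a = 0
  · simp [ha]
  · exact (key a ha).le

theorem constToKK_algebraMap (c : Fq) :
    constToKK Fq s (algebraMap Fq _ c) = cToKK Fq s (algebraMap Fq (Cinf Fq) c) := by
  have h1 : constToKK Fq s (algebraMap _ _ (MvPolynomial.C c)) = ratToKK Fq s (algebraMap _ _
      (MvPolynomial.map (algebraMap Fq (Cinf Fq)) (MvPolynomial.C c))) :=
    congrArg (ratToKK Fq s) (IsLocalization.map_eq _ _)
  rw [MvPolynomial.map_C] at h1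
  rw [cToKK_apply, ← h1, IsScalarTower.algebraMap_apply Fq (MvPolynomial (Fin s) Fq)
    (FractionRing (MvPolynomial (Fin s) Fq))]
  rfl

instance : IsScalarTower Fq Fq[X] (Cinf Fq) := IsScalarTower.of_algebraMap_eq' rfl

theorem continuous_cToKK : Continuous (cToKK Fq s) := by
  refine Metric.continuous_iff.2 fun x ε hε => ⟨ε, hε, fun y hy => ?_⟩
  rwa [dist_eq_norm, ← map_sub, norm_cToKK, ← dist_eq_norm]

end Frobenius

/-! ### Twisted evaluation of power series -/

section Twisted

variable {Fq : Type*} [Field Fq] [Fintype Fq] {s : ℕ}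

/-- The value `∑ α_i τ^i(x)` at `x` in `𝕂` of `∑ α_i Z ^ (q ^ i)`; the other coefficients of the
power series are ignored. -/
def twEval (E : PowerSeries (Cinf Fq)) (x : KK Fq s) : KK Fq s :=
  ∑' i : ℕ, cToKK Fq s (PowerSeries.coeff (Fintype.card Fq ^ i) E) * (tau Fq s ^ i) x

/-- The coefficients of the power series decay faster than any geometric sequence. -/
def IsEntire (E : PowerSeries (Cinf Fq)) : Prop :=
  ∀ R : ℝ, 0 < R → ∃ B, ∀ m, ‖PowerSeries.coeff m E‖ * R ^ m ≤ B

theorem norm_twTerm (E : PowerSeries (Cinf Fq)) (x : KK Fq s) (i : ℕ) :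
    ‖cToKK Fq s (PowerSeries.coeff (Fintype.card Fq ^ i) E) * (tau Fq s ^ i) x‖ =
      ‖PowerSeries.coeff (Fintype.card Fq ^ i) E‖ * ‖x‖ ^ Fintype.card Fq ^ i := by
  rw [norm_mul, norm_cToKK, norm_tau_pow]

/-- The geometric bound for the terms of `twEval`. -/
theorem norm_twTerm_le {E : PowerSeries (Cinf Fq)} {x : KK Fq s} {B : ℝ}
    (h : ∀ m, ‖PowerSeries.coeff m E‖ * (2 * (‖x‖ + 1)) ^ m ≤ B) (i : ℕ) :
    ‖cToKK Fq s (PowerSeries.coeff (Fintype.card Fq ^ i) E) * (tau Fq s ^ i) x‖ ≤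
      B * (1 / 2) ^ i := by
  have hx : 0 ≤ ‖x‖ := norm_nonneg x
  have hB : 0 ≤ B := le_trans (by positivity) (h 0)
  rw [norm_twTerm]
  refine (norm_mul_pow_le_geometric (by positivity) (h _) hx).trans
    (mul_le_mul_of_nonneg_left ?_ hB)
  refine (pow_le_pow_left₀ (by positivity) (b := 1 / 2) ?_ _).trans
    (pow_le_pow_of_le_one (by norm_num) (by norm_num) (Nat.lt_pow_self Fintype.one_lt_card).le)
  rw [div_le_div_iff₀ (by positivity) two_pos]
  linarith

theorem summable_twTerm {E : PowerSeries (Cinf Fq)} (hE : IsEntire E) (x : KK Fq s) :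
    Summable fun i : ℕ =>
      cToKK Fq s (PowerSeries.coeff (Fintype.card Fq ^ i) E) * (tau Fq s ^ i) x := by
  obtain ⟨B, hB⟩ := hE (2 * (‖x‖ + 1)) (by positivity)
  exact Summable.of_norm_bounded
    ((summable_geometric_of_lt_one (by norm_num) (by norm_num)).mul_left B) (norm_twTerm_le hB)

theorem twEval_add {E : PowerSeries (Cinf Fq)} (hE : IsEntire E) (x y : KK Fq s) :
    twEval E (x + y) = twEval E x + twEval E y := by
  simp only [twEval, map_add, mul_add]
  exact (summable_twTerm hE x).tsum_add (summable_twTerm hE y)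

theorem twEval_mul_of_fixed (E : PowerSeries (Cinf Fq)) {k : KK Fq s} (hk : tau Fq s k = k)
    (x : KK Fq s) : twEval E (k * x) = k * twEval E x := by
  simp only [twEval, map_mul, tau_pow_of_fixed Fq s hk, mul_left_comm _ k, tsum_mul_left]

theorem twEval_zero (E : PowerSeries (Cinf Fq)) : twEval E (0 : KK Fq s) = 0 := by
  simp [twEval]

theorem twEval_sum {E : PowerSeries (Cinf Fq)} (hE : IsEntire E) {ι : Type*} (S : Finset ι)
    (x : ι → KK Fq s) : twEval E (∑ i ∈ S, x i) = ∑ i ∈ S, twEval E (x i) := by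
  classical
  induction S using Finset.induction_on with
  | empty => simp [twEval_zero]
  | insert a S ha ih => rw [Finset.sum_insert ha, Finset.sum_insert ha, twEval_add hE, ih]

/-- Uniformly entire power series which converge coefficientwise converge as functions. -/
theorem tendsto_twEval {E : ℕ → PowerSeries (Cinf Fq)} {E' : PowerSeries (Cinf Fq)}
    (hB : ∀ R : ℝ, 0 < R → ∃ B, ∀ d m, ‖PowerSeries.coeff m (E d)‖ * R ^ m ≤ B)
    (hE : ∀ m, Tendsto (fun d => PowerSeries.coeff m (E d)) atTop (𝓝 (PowerSeries.coeff m E')))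
    (x : KK Fq s) : Tendsto (fun d => twEval (E d) x) atTop (𝓝 (twEval E' x)) := by
  obtain ⟨B, hB⟩ := hB (2 * (‖x‖ + 1)) (by positivity)
  exact tendsto_tsum_of_dominated_convergence
    ((summable_geometric_of_lt_one (by norm_num) (by norm_num)).mul_left B)
    (fun i => (((continuous_cToKK Fq s).tendsto _).comp (hE _)).mul_const _)
    (Eventually.of_forall fun d i => norm_twTerm_le (hB d) i)

theorem IsLinearised.eq_sum_coeff {L : Type*} [Field L] [Algebra Fq L] {D : ℕ} {P : L[X]}
    (hP : IsLinearised Fq D P) : (∀ i, D < i → P.coeff (Fintype.card Fq ^ i) = 0) ∧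
      P = ∑ i ∈ Finset.range (D + 1), Polynomial.C (P.coeff (Fintype.card Fq ^ i)) *
        Polynomial.X ^ Fintype.card Fq ^ i := by
  obtain ⟨α, hα⟩ := hP
  have hinj : ∀ i j, Fintype.card Fq ^ i = Fintype.card Fq ^ j ↔ i = j := fun i j =>
    (Nat.pow_right_injective Fintype.one_lt_card).eq_iff
  have hc : ∀ i, P.coeff (Fintype.card Fq ^ i) = if i < D + 1 then α i else 0 := fun i => by
    rw [hα]
    simp only [Polynomial.finsetSum_coeff, Polynomial.coeff_C_mul, Polynomial.coeff_X_pow, hinj]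
    simp
  refine ⟨fun i hi => by rw [hc, if_neg (by omega)], ?_⟩
  nth_rewrite 1 [hα]
  exact Finset.sum_congr rfl fun i hi => by rw [hc, if_pos (Finset.mem_range.1 hi)]

theorem IsLinearised.twEval_eq {D : ℕ} {P : (Cinf Fq)[X]} (hP : IsLinearised Fq D P)
    (x : KK Fq s) : twEval (P : PowerSeries (Cinf Fq)) x =
      ∑ i ∈ Finset.range (D + 1),
        cToKK Fq s (P.coeff (Fintype.card Fq ^ i)) * (tau Fq s ^ i) x := by
  rw [twEval, tsum_eq_sum (s := Finset.range (D + 1)) fun i hi => ?_]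
  · simp only [Polynomial.coeff_coe]
  · rw [Polynomial.coeff_coe, hP.eq_sum_coeff.1 i (by simpa using hi), map_zero, zero_mul]

theorem IsLinearised.twEval_cToKK {D : ℕ} {P : (Cinf Fq)[X]} (hP : IsLinearised Fq D P)
    (z : Cinf Fq) : twEval (P : PowerSeries (Cinf Fq)) (cToKK Fq s z) =
      cToKK Fq s (P.eval z) := by
  rw [hP.twEval_eq]
  conv_rhs => rw [hP.eq_sum_coeff.2]
  simp [Polynomial.eval_finsetSum, map_sum, tau_pow_cToKK]

/-- Partial fractions for `twEval E (z m)` with `E = X ∏ (1 - X / ℓ(w))`: subtracting `τ^D(m) E`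
lowers the degree in `z`, so that Lagrange interpolation applies. -/
theorem twEval_subPoly_mul {W : Type*} [AddCommGroup W] [Module Fq W] [Fintype W] [DecidableEq W]
    {ℓ : W →ₗ[Fq] Cinf Fq} (hℓ : Function.Injective ℓ) {z : Cinf Fq} (hz : ∀ w, z ≠ ℓ w)
    (m : KK Fq s) :
    twEval (subPoly ℓ : PowerSeries (Cinf Fq)) (cToKK Fq s z * m) =
      cToKK Fq s ((subPoly ℓ).eval z) * ((tau Fq s ^ Module.finrank Fq W) m +
        ∑ w, twEval (subPoly ℓ : PowerSeries (Cinf Fq)) (cToKK Fq s (ℓ w) * m) *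
          (cToKK Fq s z - cToKK Fq s (ℓ w))⁻¹) := by
  set D := Module.finrank Fq W
  have hlin := isLinearised_subPoly hℓ
  set P : (KK Fq s)[X] := ∑ i ∈ Finset.range (D + 1),
    Polynomial.C (cToKK Fq s ((subPoly ℓ).coeff (Fintype.card Fq ^ i)) *
      ((tau Fq s ^ i) m - (tau Fq s ^ D) m)) * Polynomial.X ^ Fintype.card Fq ^ i with hP
  have heval : ∀ z : Cinf Fq, P.eval (cToKK Fq s z) =
      twEval (subPoly ℓ : PowerSeries (Cinf Fq)) (cToKK Fq s z * m) -
        (tau Fq s ^ D) m * cToKK Fq s ((subPoly ℓ).eval z) := fun z => by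
    rw [hlin.twEval_eq, ← hlin.twEval_cToKK, hlin.twEval_eq, hP, Finset.mul_sum,
      ← Finset.sum_sub_distrib, Polynomial.eval_finsetSum]
    refine Finset.sum_congr rfl fun i _ => ?_
    simp only [Polynomial.eval_mul, Polynomial.eval_C, Polynomial.eval_pow, Polynomial.eval_X,
      map_mul, tau_pow_cToKK]
    ring
  have hdeg : P.degree < Fintype.card W := by
    rw [Module.card_eq_pow_finrank (K := Fq) (V := W)]
    rw [hP, Finset.sum_range_succ, sub_self, mul_zero, Polynomial.C_0, zero_mul, add_zero]
    refine (Polynomial.degree_sum_le _ _).trans_lt ((Finset.sup_lt_iff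
      (by exact_mod_cast WithBot.bot_lt_coe _)).2 fun i hi => ?_)
    refine (Polynomial.degree_C_mul_X_pow_le _ _).trans_lt ?_
    exact_mod_cast Nat.pow_lt_pow_right Fintype.one_lt_card (Finset.mem_range.1 hi)
  have h := eval_eq_subPoly_mul_sum (cToKK Fq s) hℓ hdeg (x := cToKK Fq s z)
    fun w hw => hz w ((cToKK Fq s).injective hw)
  rw [heval, sub_eq_iff_eq_add] at h
  simp only [heval, eval_subPoly_apply, map_zero, mul_zero, sub_zero, Polynomial.eval_map_apply]
    at h
  rw [h]
  ring

end Twisted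

/-! ### Lattices: coordinates and exhaustion by finite spaces -/

section Lattice

variable {Fq : Type*} [Field Fq] [Fintype Fq] {r : ℕ}

/-- The index set of the nonzero lattice points. -/
abbrev Idx (Fq : Type*) [Field Fq] (r : ℕ) : Type _ := {a : Fin r → Fq[X] // a ≠ 0}

/-- The map `a ↦ a_1 λ_1 + ⋯ + a_r λ_r`, as an `𝔽_q`-linear map. -/
def latLin (lam : Fin r → Cinf Fq) : (Fin r → Fq[X]) →ₗ[Fq] Cinf Fq where
  toFun := latticePoint lam
  map_add' a b := by simp [latticePoint, add_smul, Finset.sum_add_distrib]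
  map_smul' c a := by simp [latticePoint, Finset.smul_sum]

@[simp] theorem latLin_apply (lam : Fin r → Cinf Fq) (a : Fin r → Fq[X]) :
    latLin lam a = latticePoint lam a := rfl

theorem latticePoint_X_smul (lam : Fin r → Cinf Fq) (a : Fin r → Fq[X]) :
    latticePoint lam ((Polynomial.X : Fq[X]) • a) = theta Fq * latticePoint lam a := by
  simp only [latticePoint, Pi.smul_apply, smul_assoc, Finset.mul_sum, ← Finset.smul_sum]
  rw [Algebra.smul_def, Finset.mul_sum]
  rfl

/-- `lam` is an `A`-basis of the lattice `Λ`, in terms of coordinates. -/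
structure IsLatticeBasis (Λ : Submodule Fq[X] (Cinf Fq)) (lam : Fin r → Cinf Fq) : Prop where
  inj : Function.Injective (latticePoint lam)
  mem_iff : ∀ z, z ∈ Λ ↔ ∃ a, latticePoint lam a = z
  tendsto : Tendsto (fun a => ‖latticePoint lam a‖) cofinite atTop

theorem isLatticeBasis_of_basis {Λ : Submodule Fq[X] (Cinf Fq)} (hΛ : IsLattice Λ)
    (b : Module.Basis (Fin r) Fq[X] Λ) {lam : Fin r → Cinf Fq}
    (hlam : ∀ i, lam i = (b i : Cinf Fq)) : IsLatticeBasis Λ lam := by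
  have hpt : ∀ a, latticePoint lam a = (b.equivFun.symm a : Cinf Fq) := fun a => by
    simp [latticePoint, Module.Basis.equivFun_symm_apply, hlam]
  have hinj : Function.Injective (latticePoint lam) := fun a a' h => by
    rw [hpt, hpt] at h
    exact b.equivFun.symm.injective (Subtype.coe_injective h)
  refine ⟨hinj, fun z => ⟨fun hz => ⟨b.equivFun ⟨z, hz⟩, by simp [hpt]⟩, ?_⟩, ?_⟩
  · rintro ⟨a, rfl⟩
    rw [hpt]
    exact (b.equivFun.symm a).2
  · refine tendsto_atTop.2 fun R => ?_
    rw [eventually_cofinite]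
    refine ((hΛ.strongly_discrete 0 R).preimage hinj.injOn).subset fun a ha => ?_
    refine ⟨by rw [hpt]; exact (b.equivFun.symm a).2, ?_⟩
    simpa using (not_le.1 ha).le

variable (Fq r) in
/-- The tuples of polynomials of degree less than `d`. -/
def box (d : ℕ) : Submodule Fq (Fin r → Fq[X]) :=
  Submodule.pi Set.univ fun _ => Polynomial.degreeLT Fq d

theorem mem_box {d : ℕ} {a : Fin r → Fq[X]} : a ∈ box Fq r d ↔ ∀ i, (a i).degree < d := by
  simp [box, Submodule.mem_pi, Polynomial.mem_degreeLT]

instance (d : ℕ) : Finite (box Fq r d) := by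
  have : Finite (Polynomial.degreeLT Fq d) :=
    Finite.of_equiv _ (Polynomial.degreeLTEquiv Fq d).symm.toEquiv
  refine Finite.of_injective
    (fun (a : box Fq r d) (i : Fin r) => (⟨a.1 i, a.2 i (Set.mem_univ i)⟩ :
      Polynomial.degreeLT Fq d)) fun a a' h => Subtype.ext (funext fun i => ?_)
  exact congrArg Subtype.val (congrFun h i)

instance (d : ℕ) : Fintype (box Fq r d) := Fintype.ofFinite _

instance (d : ℕ) : DecidableEq (box Fq r d) := Classical.decEq _

variable (Fq r) in
/-- The nonzero elements of the box, as a set of indices. -/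
def boxF (d : ℕ) : Finset (Idx Fq r) :=
  ((show (box Fq r d : Set (Fin r → Fq[X])).Finite from
    inferInstanceAs (Finite (box Fq r d))).preimage
    (Subtype.val_injective (p := fun a : Fin r → Fq[X] => a ≠ 0)).injOn).toFinset

theorem mem_boxF {d : ℕ} {a : Idx Fq r} : a ∈ boxF Fq r d ↔ a.1 ∈ box Fq r d := by
  simp [boxF]

theorem tendsto_boxF : Tendsto (boxF Fq r) atTop atTop := by
  refine tendsto_atTop_finset_of_monotone (fun d d' h a ha => ?_) fun a => ?_
  · rw [mem_boxF, mem_box] at ha ⊢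
    exact fun i => (ha i).trans_le (by exact_mod_cast h)
  · refine ⟨Finset.univ.sup (fun i => (a.1 i).natDegree) + 1, ?_⟩
    rw [mem_boxF, mem_box]
    intro i
    refine (Polynomial.degree_le_natDegree).trans_lt ?_
    exact_mod_cast Nat.lt_succ_of_le
      (Finset.le_sup (f := fun i => (a.1 i).natDegree) (Finset.mem_univ i))

/-- The nonzero elements of the box correspond to `boxF`. -/
theorem prod_box {d : ℕ} {α : Type*} [CommMonoid α] (f : (Fin r → Fq[X]) → α) :
    ∏ a ∈ Finset.univ.erase (0 : box Fq r d), f a = ∏ a ∈ boxF Fq r d, f a.1 := by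
  refine Finset.prod_bij (fun a ha => ⟨a.1, fun h => (Finset.mem_erase.1 ha).1 (Subtype.ext h)⟩)
    (fun a _ => mem_boxF.2 a.2) (fun a _ a' _ h => Subtype.ext (Subtype.mk.inj h))
    (fun a ha => ?_) fun a _ => rfl
  exact ⟨⟨a.1, mem_boxF.1 ha⟩, Finset.mem_erase.2
    ⟨fun h => a.2 (congrArg Subtype.val h), Finset.mem_univ _⟩, rfl⟩

theorem sum_box {d : ℕ} {α : Type*} [AddCommMonoid α] (f : (Fin r → Fq[X]) → α) (hf : f 0 = 0) :
    ∑ a : box Fq r d, f a = ∑ a ∈ boxF Fq r d, f a.1 := by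
  rw [← Finset.add_sum_erase _ _ (Finset.mem_univ (0 : box Fq r d))]
  have := prod_box (d := d) (α := Multiplicative α) f
  change f 0 + _ = _
  rw [hf, zero_add]
  exact this

theorem le_finrank_box (hr : 0 < r) (d : ℕ) : d ≤ Module.finrank Fq (box Fq r d) := by
  let f : Polynomial.degreeLT Fq d →ₗ[Fq] box Fq r d :=
    { toFun := fun p => ⟨fun _ => p.1, fun i _ => p.2⟩
      map_add' := fun _ _ => rfl
      map_smul' := fun _ _ => rfl }
  have hf : Function.Injective f := fun p p' h =>
    Subtype.ext (congrFun (congrArg Subtype.val h) ⟨0, hr⟩)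
  have h := LinearMap.finrank_le_finrank_of_injective hf
  rwa [(Polynomial.degreeLTEquiv Fq d).finrank_eq, Module.finrank_fin_fun] at h

end Lattice

/-! ### The exponential function of a lattice -/

section Exponential

variable {Fq : Type*} [Field Fq] [Fintype Fq] {r s : ℕ} {Λ : Submodule Fq[X] (Cinf Fq)}
  {lam : Fin r → Cinf Fq}

/-- The embedding in `ℂ_∞` of the tuples of polynomials of degree less than `d`. -/
def boxLin (lam : Fin r → Cinf Fq) (d : ℕ) : box Fq r d →ₗ[Fq] Cinf Fq :=
  (latLin lam).comp (box Fq r d).subtype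

/-- The polynomial `Z ∏ (1 - Z / λ)`, over the nonzero lattice points with coordinates of degree
less than `d`. -/
def expPoly (lam : Fin r → Cinf Fq) (d : ℕ) : (Cinf Fq)[X] := subPoly (boxLin lam d)

/-- The partial products of `exp_Λ(Z) / Z`. -/
def divProd (lam : Fin r → Cinf Fq) (T : Finset (Idx Fq r)) : PowerSeries (Cinf Fq) :=
  ∏ a ∈ T, (1 - PowerSeries.C (latticePoint lam a.1)⁻¹ * PowerSeries.X)

theorem coe_expPoly (lam : Fin r → Cinf Fq) (d : ℕ) :
    (expPoly lam d : PowerSeries (Cinf Fq)) = PowerSeries.X * divProd lam (boxF Fq r d) := by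
  have h := prod_box (d := d) fun a : Fin r → Fq[X] =>
    (1 - Polynomial.C (latticePoint lam a)⁻¹ * Polynomial.X)
  have h2 := congrArg (fun P : (Cinf Fq)[X] => (P : PowerSeries (Cinf Fq))) h
  rw [expPoly, subPoly, Polynomial.coe_mul, Polynomial.coe_X]
  congr 1
  refine h2.trans ?_
  rw [← Polynomial.coeToPowerSeries.ringHom_apply, map_prod, divProd]
  refine Finset.prod_congr rfl fun a _ => ?_
  simp

theorem eval_expPoly (lam : Fin r → Cinf Fq) (d : ℕ) (z : Cinf Fq) :
    (expPoly lam d).eval z = z * ∏ a ∈ boxF Fq r d, (1 - z / latticePoint lam a.1) := by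
  rw [← prod_box (fun a => 1 - z / latticePoint lam a), expPoly, subPoly,
    Polynomial.eval_mul, Polynomial.eval_prod, Polynomial.eval_X]
  congr 1
  refine Finset.prod_congr rfl fun a _ => ?_
  simp [boxLin, div_eq_inv_mul]

theorem coeff_divProd_bound (lam : Fin r → Cinf Fq) {R : ℝ} (hR : 0 < R)
    (T : Finset (Idx Fq r)) (m : ℕ) :
    ‖PowerSeries.coeff m (divProd lam T)‖ * R ^ m ≤
      ∏ a ∈ T, max 1 (R / ‖latticePoint lam a.1‖) := by
  classical
  induction T using Finset.induction_on generalizing m with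
  | empty =>
    simp only [divProd, Finset.prod_empty, PowerSeries.coeff_one]
    split_ifs with h <;> simp [h]
  | insert a T ha ih =>
    rw [divProd, Finset.prod_insert ha, Finset.prod_insert ha, mul_comm (max _ _)]
    have h1 : ∀ k, ‖PowerSeries.coeff k (1 - PowerSeries.C (latticePoint lam a.1)⁻¹ *
        PowerSeries.X)‖ * R ^ k ≤ max 1 (R / ‖latticePoint lam a.1‖) := fun k => by
      rw [map_sub, PowerSeries.coeff_one, PowerSeries.coeff_C_mul, PowerSeries.coeff_X]
      rcases k with _ | _ | k
      · simp
      · refine le_max_of_le_right (le_of_eq ?_)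
        simp [div_eq_inv_mul]
      · simp
    rw [mul_comm (1 - _)]
    exact coeff_mul_bound hR ih h1 m

namespace IsLatticeBasis

variable (h : IsLatticeBasis Λ lam)
include h

theorem ne_zero (a : Idx Fq r) : latticePoint lam a.1 ≠ 0 := fun h0 =>
  a.2 (h.inj (h0.trans (map_zero (latLin lam)).symm))

theorem boxLin_injective (d : ℕ) : Function.Injective (boxLin lam d) := fun _ _ hab =>
  Subtype.ext (h.inj hab)

theorem tendsto_idx : Tendsto (fun a : Idx Fq r => ‖latticePoint lam a.1‖) cofinite atTop :=
  h.tendsto.comp Subtype.val_injective.tendsto_cofinite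

theorem tendsto_inv : Tendsto (fun a : Idx Fq r => (latticePoint lam a.1)⁻¹) cofinite (𝓝 0) := by
  rw [tendsto_zero_iff_norm_tendsto_zero]
  simp only [norm_inv]
  exact h.tendsto_idx.inv_tendsto_atTop

theorem finite_ball (R : ℝ) : {a : Idx Fq r | ‖latticePoint lam a.1‖ ≤ R}.Finite := by
  have := h.tendsto_idx.eventually_gt_atTop R
  rw [eventually_cofinite] at this
  simpa using this

/-- The maximum of `|exp_Λ(z) / z|` on the circle `|z| = R`, namely the product of the `R / |λ|`
over the nonzero lattice points with `|λ| ≤ R`. -/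
def growth (R : ℝ) : ℝ := ∏ a ∈ (h.finite_ball R).toFinset, R / ‖latticePoint lam a.1‖

theorem one_le_div {R : ℝ} {a : Idx Fq r} (ha : a ∈ (h.finite_ball R).toFinset) :
    1 ≤ R / ‖latticePoint lam a.1‖ := by
  rw [one_le_div₀ (norm_pos_iff.2 (h.ne_zero a))]
  simpa using ha

theorem growth_pos {R : ℝ} : 0 < h.growth R :=
  zero_lt_one.trans_le (Finset.one_le_prod fun _ ha => h.one_le_div ha)

theorem prod_max_le_growth {R : ℝ} (hR : 0 < R) (T : Finset (Idx Fq r)) :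
    ∏ a ∈ T, max 1 (R / ‖latticePoint lam a.1‖) ≤ h.growth R := by
  classical
  have h1 : ∏ a ∈ (h.finite_ball R).toFinset, max 1 (R / ‖latticePoint lam a.1‖) =
      h.growth R :=
    Finset.prod_congr rfl fun a ha => max_eq_right (h.one_le_div ha)
  rw [← h1, ← Finset.prod_filter_mul_prod_filter_not T (· ∈ (h.finite_ball R).toFinset)]
  rw [Finset.prod_eq_one (s := T.filter (· ∉ (h.finite_ball R).toFinset)), mul_one]
  · exact Finset.prod_le_prod_of_subset_of_one_le (fun a ha => (Finset.mem_filter.1 ha).2)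
      (fun _ _ => by positivity) fun _ _ _ => le_max_left _ _
  · intro a ha
    have ha' := (Finset.mem_filter.1 ha).2
    simp only [Set.Finite.mem_toFinset, Set.mem_ofPred_eq, not_le] at ha'
    exact max_eq_left ((div_le_one (hR.trans ha')).2 ha'.le)

theorem coeff_divProd_le {R : ℝ} (hR : 0 < R) (T : Finset (Idx Fq r)) (m : ℕ) :
    ‖PowerSeries.coeff m (divProd lam T)‖ * R ^ m ≤ h.growth R :=
  (coeff_divProd_bound lam hR T m).trans (h.prod_max_le_growth hR T)

/-- The nonzero lattice points, indexed by their coordinates. -/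
def idxEquiv : Idx Fq r ≃ Nonzero Λ :=
  Equiv.ofBijective (fun a => ⟨latticePoint lam a.1, (h.mem_iff _).2 ⟨_, rfl⟩, h.ne_zero a⟩)
    ⟨fun _ _ hab => Subtype.ext (h.inj (Subtype.mk.inj hab)), fun l => by
      obtain ⟨a, ha⟩ := (h.mem_iff l.1).1 l.2.1
      refine ⟨⟨a, fun h0 => l.2.2 ?_⟩, Subtype.ext ha⟩
      rw [← ha, h0]
      exact map_zero (latLin lam)⟩

open scoped PowerSeries.WithPiTopology in
theorem tendsto_coeff_divProd (m : ℕ) :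
    Tendsto (fun T => PowerSeries.coeff m (divProd lam T)) atTop
      (𝓝 (PowerSeries.coeff m (expDivSeries Λ))) := by
  have h1 : expDivSeries Λ = ∏' a : Idx Fq r,
      (1 - PowerSeries.C (latticePoint lam a.1)⁻¹ * PowerSeries.X) :=
    (h.idxEquiv.tprod_eq fun l : Nonzero Λ =>
      (1 - PowerSeries.C (l : Cinf Fq)⁻¹ * PowerSeries.X : PowerSeries (Cinf Fq))).symm
  have h2 : Multipliable fun a : Idx Fq r =>
      (1 - PowerSeries.C (latticePoint lam a.1)⁻¹ * PowerSeries.X : PowerSeries (Cinf Fq)) := by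
    have := multipliable_one_add_C_mul_X (f := fun a : Idx Fq r => -(latticePoint lam a.1)⁻¹)
      (by simpa using h.tendsto_inv.neg)
    simpa [sub_eq_add_neg] using this
  rw [h1]
  exact ((PowerSeries.WithPiTopology.continuous_coeff _ m).tendsto _).comp h2.hasProd

theorem coeff_expDivSeries_le {R : ℝ} (hR : 0 < R) (m : ℕ) :
    ‖PowerSeries.coeff m (expDivSeries Λ)‖ * R ^ m ≤ h.growth R :=
  le_of_tendsto ((h.tendsto_coeff_divProd m).norm.mul_const _)
    (Eventually.of_forall fun T => h.coeff_divProd_le hR T m)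

theorem coeff_zero_expDivSeries : PowerSeries.coeff 0 (expDivSeries Λ) = 1 := by
  refine tendsto_nhds_unique (h.tendsto_coeff_divProd 0) ?_
  have : ∀ T, PowerSeries.coeff 0 (divProd lam T) = 1 := fun T => by
    simp [divProd, map_prod]
  simp only [this]
  exact tendsto_const_nhds

theorem hasProd_expC (z : Cinf Fq) :
    HasProd (fun a : Idx Fq r => 1 - z / latticePoint lam a.1)
      (∏' l : Nonzero Λ, (1 - z / (l : Cinf Fq))) := by
  rw [← h.idxEquiv.tprod_eq]
  have := multipliable_one_add_of_tendsto (f := fun a : Idx Fq r => -(z * (latticePoint lam a.1)⁻¹))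
    (by simpa using (h.tendsto_inv.const_mul z).neg)
  refine Multipliable.hasProd ?_
  simpa [sub_eq_add_neg, div_eq_mul_inv] using this

theorem tendsto_eval_expPoly (z : Cinf Fq) :
    Tendsto (fun d => (expPoly lam d).eval z) atTop (𝓝 (expC Λ z)) := by
  simp only [eval_expPoly]
  exact (Tendsto.comp (h.hasProd_expC z) tendsto_boxF).const_mul z

theorem coeff_X_mul_le {f : PowerSeries (Cinf Fq)} {R B : ℝ} (hR : 0 < R)
    (hf : ∀ m, ‖PowerSeries.coeff m f‖ * R ^ m ≤ B) (m : ℕ) :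
    ‖PowerSeries.coeff m (PowerSeries.X * f)‖ * R ^ m ≤ R * B := by
  have hB : 0 ≤ B := le_trans (by positivity) (hf 0)
  rcases m with _ | m
  · simpa using by positivity
  · rw [PowerSeries.coeff_succ_X_mul, pow_succ, ← mul_assoc, mul_comm]
    exact mul_le_mul_of_nonneg_left (hf m) hR.le

theorem isEntire : IsEntire (PowerSeries.X * expDivSeries Λ) := fun _ hR =>
  ⟨_, h.coeff_X_mul_le hR (h.coeff_expDivSeries_le hR)⟩

theorem isEntire_expPoly (d : ℕ) : IsEntire (expPoly lam d : PowerSeries (Cinf Fq)) :=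
  fun _ hR => ⟨_, by
    rw [coe_expPoly]
    exact h.coeff_X_mul_le hR (h.coeff_divProd_le hR _)⟩

theorem expK_eq_twEval (x : KK Fq s) :
    expK Λ x = twEval (PowerSeries.X * expDivSeries Λ) x := rfl

theorem tendsto_twEval_expPoly (x : KK Fq s) :
    Tendsto (fun d => twEval (expPoly lam d : PowerSeries (Cinf Fq)) x) atTop (𝓝 (expK Λ x)) := by
  rw [h.expK_eq_twEval]
  refine tendsto_twEval (fun R hR => ⟨R * h.growth R, fun d m => ?_⟩) (fun m => ?_) x
  · rw [coe_expPoly]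
    exact h.coeff_X_mul_le hR (h.coeff_divProd_le hR _) m
  · simp only [coe_expPoly]
    rcases m with _ | m
    · simp
    · simp only [PowerSeries.coeff_succ_X_mul]
      exact (h.tendsto_coeff_divProd m).comp tendsto_boxF

/-- The two definitions of the exponential agree on `ℂ_∞`. -/
theorem expK_cToKK (z : Cinf Fq) : expK Λ (cToKK Fq s z) = cToKK Fq s (expC Λ z) := by
  refine tendsto_nhds_unique (h.tendsto_twEval_expPoly _) ?_
  simp only [expPoly, (isLinearised_subPoly (h.boxLin_injective _)).twEval_cToKK]
  exact ((continuous_cToKK Fq s).tendsto _).comp (h.tendsto_eval_expPoly z)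

theorem expC_latticePoint (a : Fin r → Fq[X]) : expC Λ (latticePoint lam a) = 0 := by
  by_cases ha : a = 0
  · have : latticePoint lam a = 0 := by rw [ha]; exact map_zero (latLin lam)
    rw [this, expC, zero_mul]
  · refine tendsto_nhds_unique (h.tendsto_eval_expPoly _) (tendsto_const_nhds.congr' ?_)
    filter_upwards [tendsto_boxF.eventually_ge_atTop {(⟨a, ha⟩ : Idx Fq r)}] with d hd
    rw [eval_expPoly, Finset.prod_eq_zero (hd (Finset.mem_singleton_self _)), mul_zero]
    rw [div_self (h.ne_zero ⟨a, ha⟩), sub_self]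

theorem expK_add (x y : KK Fq s) : expK Λ (x + y) = expK Λ x + expK Λ y :=
  twEval_add h.isEntire x y

theorem expC_add (x y : Cinf Fq) : expC Λ (x + y) = expC Λ x + expC Λ y := by
  apply (cToKK Fq 0).injective
  rw [← h.expK_cToKK, map_add, h.expK_add, h.expK_cToKK, h.expK_cToKK, map_add]

theorem expC_smul (c : Fq) (x : Cinf Fq) : expC Λ (c • x) = c • expC Λ x := by
  apply (cToKK Fq 0).injective
  rw [← h.expK_cToKK, Algebra.smul_def, map_mul, h.expK_eq_twEval, twEval_mul_of_fixed,
    ← h.expK_eq_twEval, h.expK_cToKK, Algebra.smul_def, map_mul]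
  rw [← constToKK_algebraMap, tau_constToKK]

/-- `exp_Λ`, as an `𝔽_q`-linear map. -/
def expLin : Cinf Fq →ₗ[Fq] Cinf Fq where
  toFun := expC Λ
  map_add' := h.expC_add
  map_smul' := h.expC_smul

/-- At the points which `0` approximates as well as any lattice point, `exp_Λ` is as large as its
maximum on the circle. -/
theorem norm_mul_growth_le_norm_expC {x : Cinf Fq} (hx0 : x ≠ 0)
    (hx : ∀ a : Idx Fq r, ‖x‖ ≤ ‖x - latticePoint lam a.1‖) :
    ‖x‖ * h.growth ‖x‖ ≤ ‖expC Λ x‖ := by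
  classical
  rw [expC, norm_mul]
  refine mul_le_mul_of_nonneg_left ?_ (norm_nonneg _)
  refine ge_of_tendsto (Tendsto.norm (h.hasProd_expC x)) ?_
  filter_upwards [eventually_ge_atTop (h.finite_ball ‖x‖).toFinset] with T hT
  rw [norm_prod, growth, ← Finset.prod_sdiff hT]
  have hpos : ∀ a : Idx Fq r, 0 < ‖latticePoint lam a.1‖ := fun a => norm_pos_iff.2 (h.ne_zero a)
  refine (le_mul_of_one_le_left (Finset.prod_nonneg fun _ _ => by positivity)
    (Finset.one_le_prod fun a ha => ?_)).trans
    (mul_le_mul_of_nonneg_left (Finset.prod_le_prod (fun _ _ => by positivity) fun a _ => ?_)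
      (Finset.prod_nonneg fun _ _ => norm_nonneg _))
  · have ha' : ‖x‖ < ‖latticePoint lam a.1‖ := by
      simpa using (Finset.mem_sdiff.1 ha).2
    have h1 : ‖x / latticePoint lam a.1‖ < 1 := by rwa [norm_div, div_lt_one (hpos a)]
    rw [sub_eq_add_neg, IsUltrametricDist.norm_add_eq_max_of_norm_ne_norm, norm_neg, norm_one]
    · exact le_max_left _ _
    · rw [norm_neg, norm_one]
      exact h1.ne'
  · rw [one_sub_div (h.ne_zero a), norm_div, norm_sub_rev]
    exact div_le_div_of_nonneg_right (hx a) (norm_nonneg _)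

theorem norm_expK_le {x : KK Fq s} {R : ℝ} (hR : 0 < R) (hx : ‖x‖ ≤ R) :
    ‖expK Λ x‖ ≤ ‖x‖ * h.growth R := by
  refine IsUltrametricDist.norm_tsum_le_of_forall_le_of_nonneg
    (mul_nonneg (norm_nonneg _) h.growth_pos.le) fun i => ?_
  have h1 := norm_twTerm (PowerSeries.X * expDivSeries Λ) x i
  refine (h1.le).trans ((norm_mul_pow_le_geometric hR
    (h.coeff_X_mul_le hR (h.coeff_expDivSeries_le hR) _) (norm_nonneg x)).trans ?_)
  have h2 : (‖x‖ / R) ^ Fintype.card Fq ^ i ≤ ‖x‖ / R :=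
    pow_le_of_le_one (by positivity) ((div_le_one hR).2 hx) (pow_ne_zero _ Fintype.card_ne_zero)
  refine (mul_le_mul_of_nonneg_left h2 (mul_nonneg hR.le h.growth_pos.le)).trans_eq ?_
  field_simp

end IsLatticeBasis

end Exponential

/-! ### The matrices attached to the representation -/

section Representation

variable {Fq : Type*} [Field Fq] [Fintype Fq] {r s n : ℕ}
  (χ : Fq[X] →ₐ[Fq] Matrix (Fin n) (Fin n) (FractionRing (MvPolynomial (Fin s) Fq)))

theorem chiK_add (a b : Fq[X]) : chiK χ (a + b) = chiK χ a + chiK χ b := by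
  simp only [chiK, map_add]
  exact map_add (constToKK Fq s).mapMatrix _ _

theorem chiK_zero : chiK χ 0 = 0 := by
  simp only [chiK, map_zero]
  exact map_zero (constToKK Fq s).mapMatrix

theorem chiK_mul (a b : Fq[X]) : chiK χ (a * b) = chiK χ a * chiK χ b := by
  simp only [chiK, map_mul]
  exact map_mul (constToKK Fq s).mapMatrix _ _

theorem chiK_one : chiK χ 1 = 1 := by
  simp only [chiK, map_one]
  exact map_one (constToKK Fq s).mapMatrix

theorem chiK_smul (c : Fq) (a : Fq[X]) :
    chiK χ (c • a) = cToKK Fq s (algebraMap Fq (Cinf Fq) c) • chiK χ a := by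
  ext i j
  rw [chiK, map_smul, Matrix.map_apply, Matrix.smul_apply, Algebra.smul_def, map_mul,
    constToKK_algebraMap]
  rfl

theorem norm_chiK_le (a : Fq[X]) (i j : Fin n) : ‖chiK χ a i j‖ ≤ 1 :=
  norm_constToKK_le Fq s _

theorem tau_chiK (a : Fq[X]) (i j : Fin n) : tau Fq s (chiK χ a i j) = chiK χ a i j :=
  tau_constToKK Fq s _

theorem norm_chiRow_le (a : Fin r → Fq[X]) (i : Fin n) (c : Fin r × Fin n) :
    ‖chiRow χ a i c‖ ≤ 1 := norm_chiK_le χ _ _ _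

theorem tau_chiRow (a : Fin r → Fq[X]) (i : Fin n) (c : Fin r × Fin n) :
    tau Fq s (chiRow χ a i c) = chiRow χ a i c := tau_chiK χ _ _ _

theorem chiRow_zero : chiRow χ (0 : Fin r → Fq[X]) = 0 := by
  ext i c
  simp [chiRow, chiK_zero]

theorem one_lt_norm_theta : 1 < ‖theta Fq‖ := by
  rw [norm_theta]
  exact_mod_cast Fintype.one_lt_card

theorem theta_ne_zero : theta Fq ≠ 0 :=
  norm_pos_iff.1 (zero_lt_one.trans one_lt_norm_theta)

theorem isUnit_thetaSubChi : IsUnit (thetaSubChi χ) := by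
  refine isUnit_of_norm_sub_smul_one_lt (c := cToKK Fq s (theta Fq)) fun i j => ?_
  rw [← Matrix.sub_apply, thetaSubChi, sub_sub_cancel_left, Matrix.neg_apply, norm_neg, norm_cToKK]
  exact (norm_chiK_le χ _ i j).trans_lt one_lt_norm_theta

/-- `θ M = 1 + χ(θ) M`, for `M = (θ - χ(θ))⁻¹`. -/
theorem theta_mul_inv (i j : Fin n) : cToKK Fq s (theta Fq) * (thetaSubChi χ)⁻¹ i j =
    (1 : Matrix (Fin n) (Fin n) (KK Fq s)) i j +
      ∑ k, chiK χ Polynomial.X i k * (thetaSubChi χ)⁻¹ k j := by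
  have h := Matrix.mul_nonsing_inv (thetaSubChi χ)
    ((Matrix.isUnit_iff_isUnit_det _).1 (isUnit_thetaSubChi χ))
  nth_rewrite 1 [thetaSubChi] at h
  rw [sub_mul, smul_mul_assoc, one_mul, sub_eq_iff_eq_add] at h
  have h2 := congrFun (congrFun h i) j
  rwa [Matrix.smul_apply, smul_eq_mul, Matrix.add_apply, Matrix.mul_apply] at h2

theorem norm_one_apply_le (i j : Fin n) :
    ‖(1 : Matrix (Fin n) (Fin n) (KK Fq s)) i j‖ ≤ 1 := by
  rw [Matrix.one_apply]
  split_ifs <;> simp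

theorem norm_inv_thetaSubChi_le (i j : Fin n) :
    ‖(thetaSubChi χ)⁻¹ i j‖ ≤ ‖theta Fq‖⁻¹ := by
  have : Nonempty (Fin n × Fin n) := ⟨(i, j)⟩
  obtain ⟨p, hp⟩ := Finite.exists_max fun p : Fin n × Fin n => ‖(thetaSubChi χ)⁻¹ p.1 p.2‖
  set B := ‖(thetaSubChi χ)⁻¹ p.1 p.2‖ with hB
  have hB0 : 0 ≤ B := norm_nonneg _
  have h1 : ‖theta Fq‖ * B ≤ max 1 B := by
    rw [← norm_cToKK Fq s (theta Fq), hB, ← norm_mul, theta_mul_inv]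
    refine (IsUltrametricDist.norm_add_le_max _ _).trans
      (max_le_max (norm_one_apply_le _ _) ?_)
    refine IsUltrametricDist.norm_sum_le_of_forall_le_of_nonneg hB0 fun k _ => ?_
    rw [norm_mul]
    exact (mul_le_of_le_one_left (norm_nonneg _) (norm_chiK_le χ _ _ _)).trans (hp (k, p.2))
  have hθ := one_lt_norm_theta (Fq := Fq)
  have hθ0 : 0 < ‖theta Fq‖ := zero_lt_one.trans hθ
  refine (hp (i, j)).trans ?_
  change B ≤ _
  rw [← mul_one ‖theta Fq‖⁻¹, le_inv_mul_iff₀ hθ0]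
  rcases le_total B 1 with hB1 | hB1
  · rwa [max_eq_left hB1] at h1
  · rw [max_eq_right hB1] at h1
    exact absurd h1 (not_le.2 (lt_mul_of_one_lt_left (zero_lt_one.trans_le hB1) hθ))

theorem norm_inv_thetaSubChi_sub_le (i j : Fin n) :
    ‖(thetaSubChi χ)⁻¹ i j - (cToKK Fq s (theta Fq)⁻¹ • (1 : Matrix (Fin n) (Fin n) (KK Fq s))) i j‖
      ≤ ‖theta Fq‖⁻¹ * ‖theta Fq‖⁻¹ := by
  have hθ : cToKK Fq s (theta Fq) ≠ 0 := (map_ne_zero _).2 theta_ne_zero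
  have h : (thetaSubChi χ)⁻¹ i j - (cToKK Fq s (theta Fq)⁻¹ •
      (1 : Matrix (Fin n) (Fin n) (KK Fq s))) i j = (cToKK Fq s (theta Fq))⁻¹ *
        ∑ k, chiK χ Polynomial.X i k * (thetaSubChi χ)⁻¹ k j := by
    rw [Matrix.smul_apply, map_inv₀, smul_eq_mul, eq_inv_mul_iff_mul_eq₀ hθ, mul_sub,
      mul_inv_cancel_left₀ hθ, theta_mul_inv, add_sub_cancel_left]
  rw [h, norm_mul, norm_inv, norm_cToKK]
  refine mul_le_mul_of_nonneg_left ?_ (by positivity)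
  refine IsUltrametricDist.norm_sum_le_of_forall_le_of_nonneg (by positivity) fun k _ => ?_
  rw [norm_mul]
  exact (mul_le_of_le_one_left (norm_nonneg _) (norm_chiK_le χ _ _ _)).trans
    (norm_inv_thetaSubChi_le χ k j)

/-- The matrix of the values at `(θ - χ(θ))⁻¹ z` of a twisted power series. -/
def twChi (E : PowerSeries (Cinf Fq)) (z : Cinf Fq) : Matrix (Fin n) (Fin n) (KK Fq s) :=
  (cToKK Fq s z • (thetaSubChi χ)⁻¹).map (twEval E)

theorem twChi_apply (E : PowerSeries (Cinf Fq)) (z : Cinf Fq) (i j : Fin n) :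
    twChi χ E z i j = twEval E (cToKK Fq s z * (thetaSubChi χ)⁻¹ i j) := rfl

variable {E : PowerSeries (Cinf Fq)}

theorem twChi_smul (c : Fq) (z : Cinf Fq) :
    twChi χ E (c • z) = cToKK Fq s (algebraMap Fq (Cinf Fq) c) • twChi χ E z := by
  ext i j
  rw [Matrix.smul_apply, twChi_apply, Algebra.smul_def, map_mul, mul_assoc, twEval_mul_of_fixed]
  · rfl
  · rw [← constToKK_algebraMap, tau_constToKK]

/-- The column of the blocks `twChi E λ_i`. -/
def twOmega (E : PowerSeries (Cinf Fq)) (lam : Fin r → Cinf Fq) :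
    Matrix (Fin r × Fin n) (Fin n) (KK Fq s) :=
  Matrix.of fun p j => twChi χ E (lam p.1) p.2 j

variable (hE : IsEntire E)
include hE

theorem twChi_add (z w : Cinf Fq) : twChi χ E (z + w) = twChi χ E z + twChi χ E w := by
  ext i j
  rw [Matrix.add_apply, twChi_apply, map_add, add_mul, twEval_add hE]
  rfl

theorem twChi_sum {ι : Type*} (S : Finset ι) (z : ι → Cinf Fq) :
    twChi χ E (∑ i ∈ S, z i) = ∑ i ∈ S, twChi χ E (z i) := by
  ext i j
  rw [Matrix.sum_apply, twChi_apply, map_sum, Finset.sum_mul, twEval_sum hE]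
  rfl

theorem twChi_theta_mul (z : Cinf Fq) : twChi χ E (theta Fq * z) =
    twEval E (cToKK Fq s z) • 1 + chiK χ Polynomial.X * twChi χ E z := by
  ext i j
  have h1 : twEval E ((1 : Matrix (Fin n) (Fin n) (KK Fq s)) i j * cToKK Fq s z) =
      (1 : Matrix (Fin n) (Fin n) (KK Fq s)) i j * twEval E (cToKK Fq s z) :=
    twEval_mul_of_fixed E (by rw [Matrix.one_apply]; split_ifs <;> simp) _
  rw [twChi_apply, map_mul, mul_right_comm, theta_mul_inv, add_mul, twEval_add hE, h1,
    Finset.sum_mul, twEval_sum hE, Matrix.add_apply, Matrix.smul_apply, smul_eq_mul, mul_comm,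
    Matrix.mul_apply]
  congr 1
  refine Finset.sum_congr rfl fun k _ => ?_
  rw [mul_assoc, twEval_mul_of_fixed E (tau_chiK χ _ _ _), mul_comm _ (cToKK Fq s z)]
  rfl

/-- If `E` vanishes at the multiples of `z` by polynomials of degree less than `d`, then these
multiply `twChi` through `χ`. -/
theorem twChi_polynomial_smul {d : ℕ} {z : Cinf Fq}
    (hz : ∀ p : Fq[X], p.degree < d → twEval E (cToKK Fq s (p • z)) = 0) {p : Fq[X]}
    (hp : p.degree < d) : twChi χ E (p • z) = chiK χ p * twChi χ E z := by
  suffices h : ∀ k ≤ d, ∀ p : Fq[X], p.degree < k →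
      twChi χ E (p • z) = chiK χ p * twChi χ E z from h d le_rfl p hp
  intro k
  induction k with
  | zero =>
    intro _ p hp
    have hp0 : p = 0 := by
      ext m
      simpa using (Polynomial.degree_lt_iff_coeff_zero p 0).1 hp m (Nat.zero_le m)
    rw [hp0, zero_smul, chiK_zero, zero_mul]
    ext i j
    simp [twChi_apply, twEval_zero]
  | succ k ih =>
    intro hk p hp
    have hdiv : p.divX.degree < k := by
      rw [Polynomial.degree_lt_iff_coeff_zero] at hp ⊢
      intro m hm
      rw [Polynomial.coeff_divX]
      exact hp _ (by omega)
    have hdec : p = Polynomial.X * p.divX + p.coeff 0 • (1 : Fq[X]) := by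
      conv_lhs => rw [← Polynomial.divX_mul_X_add p]
      rw [mul_comm, Polynomial.smul_eq_C_mul, mul_one]
    have hsm : p • z = theta Fq * (p.divX • z) + p.coeff 0 • z := by
      conv_lhs => rw [hdec]
      rw [add_smul, mul_smul, smul_assoc, one_smul, Algebra.smul_def Polynomial.X]
      rfl
    rw [hsm, twChi_add χ hE, twChi_theta_mul χ hE,
      hz _ (hdiv.trans_le (by exact_mod_cast (Nat.le_succ k).trans hk)), zero_smul, zero_add,
      ih ((Nat.le_succ k).trans hk) _ hdiv, twChi_smul]
    conv_rhs => rw [hdec]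
    rw [chiK_add, chiK_mul, chiK_smul, chiK_one, add_mul, smul_mul_assoc, one_mul, mul_assoc]

theorem twChi_latticePoint {lam : Fin r → Cinf Fq} {d : ℕ}
    (hz : ∀ a ∈ box Fq r d, twEval E (cToKK Fq s (latticePoint lam a)) = 0)
    {a : Fin r → Fq[X]} (ha : a ∈ box Fq r d) (i j : Fin n) :
    twChi χ E (latticePoint lam a) i j = (chiRow χ a * twOmega χ E lam) i j := by
  classical
  have hi : ∀ k, twChi χ E (a k • lam k) = chiK χ (a k) * twChi χ E (lam k) := fun k => by
    refine twChi_polynomial_smul χ hE (d := d) (fun p hp => ?_) (mem_box.1 ha k)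
    have := hz (Pi.single k p) (mem_box.2 fun l => ?_)
    · simpa [latticePoint, Pi.single_apply, ite_smul] using this
    · by_cases hl : l = k
      · subst hl; simpa using hp
      · simp [hl]
  rw [latticePoint, twChi_sum χ hE, Matrix.sum_apply, Matrix.mul_apply, Fintype.sum_prod_type]
  refine Finset.sum_congr rfl fun k _ => ?_
  rw [hi, Matrix.mul_apply]
  rfl

end Representation

/-! ### Partial fractions -/

section PartialFractions

variable {Fq : Type*} [Field Fq] [Fintype Fq] {r s n : ℕ} {Λ : Submodule Fq[X] (Cinf Fq)}
  {lam : Fin r → Cinf Fq}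
  (χ : Fq[X] →ₐ[Fq] Matrix (Fin n) (Fin n) (FractionRing (MvPolynomial (Fin s) Fq)))

/-- The general term of the double series which expands `∑ u_λ (λ - z)^(-k-1)`. -/
def doubleTerm (lam : Fin r → Cinf Fq) (u : Idx Fq r → KK Fq s) (z : Cinf Fq) (k : ℕ)
    (a : Idx Fq r) (m : ℕ) : KK Fq s :=
  ((m + k).choose k : KK Fq s) *
    (u a * cToKK Fq s (latticePoint lam a.1)⁻¹ ^ (m + k + 1)) * cToKK Fq s z ^ m

namespace IsLatticeBasis

variable (h : IsLatticeBasis Λ lam)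
include h

theorem twChi_expPoly (d : ℕ) {a : Fin r → Fq[X]} (ha : a ∈ box Fq r d) (i j : Fin n) :
    twChi χ (expPoly lam d : PowerSeries (Cinf Fq)) (latticePoint lam a) i j =
      (chiRow χ a * twOmega χ (expPoly lam d : PowerSeries (Cinf Fq)) lam) i j := by
  refine twChi_latticePoint χ (h.isEntire_expPoly d) (fun a ha => ?_) ha i j
  rw [expPoly, (isLinearised_subPoly (h.boxLin_injective d)).twEval_cToKK]
  have := eval_subPoly_apply (boxLin lam d) ⟨a, ha⟩
  rw [show latticePoint lam a = boxLin lam d ⟨a, ha⟩ from rfl, this, map_zero]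

/-- The values of `exp_Λ((θ - χ(θ))⁻¹ Z)` at the lattice points; they are the numerators of the
partial fractions. -/
theorem expChi_latticePoint (a : Fin r → Fq[X]) (i j : Fin n) :
    expChi Λ χ (latticePoint lam a) i j = (chiRow χ a * omega Λ χ lam) i j := by
  obtain ⟨d, hd⟩ : ∃ d, a ∈ box Fq r d := by
    refine ⟨Finset.univ.sup (fun i => (a i).natDegree) + 1, mem_box.2 fun i => ?_⟩
    refine (Polynomial.degree_le_natDegree).trans_lt ?_
    exact_mod_cast Nat.lt_succ_of_le
      (Finset.le_sup (f := fun i => (a i).natDegree) (Finset.mem_univ i))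
  refine twChi_latticePoint χ h.isEntire (fun a _ => ?_) hd i j
  rw [← h.expK_eq_twEval, h.expK_cToKK, h.expC_latticePoint, map_zero]

theorem tendsto_inv_sub (z : Cinf Fq) :
    Tendsto (fun a : Idx Fq r => (z - latticePoint lam a.1)⁻¹) cofinite (𝓝 0) := by
  rw [tendsto_zero_iff_norm_tendsto_zero]
  simp only [norm_inv]
  refine Tendsto.inv_tendsto_atTop (tendsto_atTop_mono (fun a => ?_)
    (tendsto_atTop_add_const_right _ (-‖z‖) h.tendsto_idx))
  rw [← sub_eq_add_neg, norm_sub_rev]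
  exact norm_sub_norm_le _ _

theorem summable_mul_inv_sub {u : Idx Fq r → KK Fq s} {B : ℝ} (hu : ∀ a, ‖u a‖ ≤ B)
    (z : Cinf Fq) : Summable fun a => u a * cToKK Fq s (z - latticePoint lam a.1)⁻¹ := by
  refine NonarchimedeanAddGroup.summable_of_tendsto_cofinite_zero ?_
  rw [tendsto_zero_iff_norm_tendsto_zero]
  have := (tendsto_zero_iff_norm_tendsto_zero.1 (h.tendsto_inv_sub z)).const_mul B
  rw [mul_zero] at this
  refine squeeze_zero (fun _ => norm_nonneg _) (fun a => ?_) this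
  rw [norm_mul, norm_cToKK]
  exact mul_le_mul_of_nonneg_right (hu a) (norm_nonneg _)

theorem hasSum_psiTerm_apply (z : Cinf Fq) (i : Fin n) (c : Fin r × Fin n) :
    HasSum (fun a : Idx Fq r => chiRow χ a.1 i c * cToKK Fq s (z - latticePoint lam a.1)⁻¹)
      (∑' a : Idx Fq r, chiRow χ a.1 i c * cToKK Fq s (z - latticePoint lam a.1)⁻¹) :=
  (h.summable_mul_inv_sub (fun a => norm_chiRow_le χ a.1 i c) z).hasSum

theorem hasSum_psi (z : Cinf Fq) : HasSum (psiTerm χ lam z) (Matrix.of fun i c =>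
    ∑' a : Idx Fq r, chiRow χ a.1 i c * cToKK Fq s (z - latticePoint lam a.1)⁻¹) := by
  refine Pi.hasSum.2 fun i => Pi.hasSum.2 fun c => ?_
  have h1 := h.hasSum_psiTerm_apply χ z i c
  refine (hasSum_subtype_iff_of_support_subset (s := {a : Fin r → Fq[X] | a ≠ 0})
    (f := fun a => psiTerm χ lam z a i c) fun a ha h0 => ha ?_).1 ?_
  · simp [psiTerm, h0, chiRow_zero]
  · have h2 : (fun a => psiTerm χ lam z a i c) ∘ Subtype.val = fun a : Idx Fq r =>
        chiRow χ a.1 i c * cToKK Fq s (z - latticePoint lam a.1)⁻¹ :=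
      funext fun a => mul_comm (cToKK Fq s _) (chiRow χ a.1 i c)
    rw [Matrix.of_apply]
    exact h2 ▸ h1

theorem psi_apply (z : Cinf Fq) (i : Fin n) (c : Fin r × Fin n) : psi χ lam z i c =
    ∑' a : Idx Fq r, chiRow χ a.1 i c * cToKK Fq s (z - latticePoint lam a.1)⁻¹ :=
  congrFun (congrFun (h.hasSum_psi χ z).tsum_eq i) c

/-- The constant term `m₀` of the partial fraction expansion is the limit of the matrices
`τ^D((θ - χ(θ))⁻¹)`, for `D` the dimension of the box; it is zero unless the lattice is zero. -/
theorem exists_tendsto_tau_pow : ∃ m₀ : Matrix (Fin n) (Fin n) (KK Fq s),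
    (∀ i j, Tendsto (fun d => (tau Fq s ^ Module.finrank Fq (box Fq r d))
      ((thetaSubChi χ)⁻¹ i j)) atTop (𝓝 (m₀ i j))) ∧ (0 < r → m₀ = 0) := by
  rcases Nat.eq_zero_or_pos r with hr | hr
  · subst hr
    have h0 : ∀ d, Module.finrank Fq (box Fq 0 d) = 0 := fun d =>
      Module.finrank_zero_of_subsingleton
    refine ⟨(thetaSubChi χ)⁻¹, fun i j => ?_, fun h => absurd h (lt_irrefl 0)⟩
    simp only [h0, pow_zero, RingAut.one_apply]
    exact tendsto_const_nhds
  · refine ⟨0, fun i j => ?_, fun _ => rfl⟩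
    rw [Matrix.zero_apply, tendsto_zero_iff_norm_tendsto_zero]
    simp only [norm_tau_pow]
    have hlt : ‖(thetaSubChi χ)⁻¹ i j‖ < 1 :=
      (norm_inv_thetaSubChi_le χ i j).trans_lt (inv_lt_one_of_one_lt₀ one_lt_norm_theta)
    refine (tendsto_pow_atTop_nhds_zero_of_lt_one (norm_nonneg _) hlt).comp ?_
    refine tendsto_atTop_mono (fun d => ?_) tendsto_id
    exact (le_finrank_box hr d).trans (Nat.lt_pow_self Fintype.one_lt_card).le

/-- The partial fraction expansion `exp_Λ((θ - χ(θ))⁻¹ Z) = exp_Λ(Z) (m₀ + ψ_Λ(Z) ω_Λ)`. -/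
theorem expChi_eq {m₀ : Matrix (Fin n) (Fin n) (KK Fq s)}
    (hm₀ : ∀ i j, Tendsto (fun d => (tau Fq s ^ Module.finrank Fq (box Fq r d))
      ((thetaSubChi χ)⁻¹ i j)) atTop (𝓝 (m₀ i j)))
    {z : Cinf Fq} (hz : ∀ a, z ≠ latticePoint lam a) (i j : Fin n) :
    expChi Λ χ z i j = cToKK Fq s (expC Λ z) *
      (m₀ i j + (psi χ lam z * omega Λ χ lam) i j) := by
  have hfin : ∀ d, twEval (expPoly lam d : PowerSeries (Cinf Fq))
      (cToKK Fq s z * (thetaSubChi χ)⁻¹ i j) = cToKK Fq s ((expPoly lam d).eval z) *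
        ((tau Fq s ^ Module.finrank Fq (box Fq r d)) ((thetaSubChi χ)⁻¹ i j) +
        ∑ c, (∑ a ∈ boxF Fq r d, chiRow χ a.1 i c * cToKK Fq s (z - latticePoint lam a.1)⁻¹) *
          twOmega χ (expPoly lam d : PowerSeries (Cinf Fq)) lam c j) := fun d => by
    rw [expPoly, twEval_subPoly_mul (h.boxLin_injective d) (fun w => hz w.1) _]
    congr 2
    have h1 := sum_box (d := d) (fun a : Fin r → Fq[X] =>
      twEval (expPoly lam d : PowerSeries (Cinf Fq)) (cToKK Fq s (latticePoint lam a) *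
        (thetaSubChi χ)⁻¹ i j) * (cToKK Fq s z - cToKK Fq s (latticePoint lam a))⁻¹)
      (by rw [show latticePoint lam (0 : Fin r → Fq[X]) = 0 from map_zero (latLin lam), map_zero,
            zero_mul, twEval_zero, zero_mul])
    refine h1.trans ?_
    simp only [Finset.sum_mul]
    rw [Finset.sum_comm]
    refine Finset.sum_congr rfl fun a ha => ?_
    rw [← twChi_apply, h.twChi_expPoly χ d (mem_boxF.1 ha), Matrix.mul_apply, Finset.sum_mul,
      map_inv₀, map_sub]
    refine Finset.sum_congr rfl fun c _ => ?_
    rw [mul_right_comm]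
    rfl
  have hlim := h.tendsto_twEval_expPoly (cToKK Fq s z * (thetaSubChi χ)⁻¹ i j)
  refine tendsto_nhds_unique hlim ?_
  simp only [hfin]
  refine Tendsto.mul (((continuous_cToKK Fq s).tendsto _).comp (h.tendsto_eval_expPoly z))
    ((hm₀ i j).add ?_)
  rw [Matrix.mul_apply]
  refine tendsto_finsetSum _ fun c _ => Tendsto.mul ?_ (h.tendsto_twEval_expPoly _)
  rw [h.psi_apply]
  have hsum : Tendsto (fun T : Finset (Idx Fq r) => ∑ a ∈ T,
      chiRow χ a.1 i c * cToKK Fq s (z - latticePoint lam a.1)⁻¹) atTop (𝓝 _) :=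
    h.hasSum_psiTerm_apply χ z i c
  exact hsum.comp tendsto_boxF

/-! ### Expansions at the origin -/

theorem exists_lt_norm : ∃ R : ℝ, 0 < R ∧ ∀ a : Idx Fq r, R < ‖latticePoint lam a.1‖ := by
  by_cases hne : (h.finite_ball 1).toFinset.Nonempty
  · obtain ⟨a, -, ha⟩ := Finset.exists_min_image _ (fun a => ‖latticePoint lam a.1‖) hne
    have hpos : 0 < ‖latticePoint lam a.1‖ := norm_pos_iff.2 (h.ne_zero a)
    refine ⟨min 1 (‖latticePoint lam a.1‖ / 2), lt_min one_pos (half_pos hpos), fun b => ?_⟩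
    by_cases hb : ‖latticePoint lam b.1‖ ≤ 1
    · exact (min_le_right _ _).trans_lt ((half_lt_self hpos).trans_le (ha b (by simpa using hb)))
    · exact (min_le_left _ _).trans_lt (not_le.1 hb)
  · refine ⟨1, one_pos, fun b => ?_⟩
    by_contra hb
    exact hne ⟨b, by simpa using hb⟩

variable {R : ℝ} (hR : 0 < R) (hlt : ∀ a : Idx Fq r, R < ‖latticePoint lam a.1‖)
include hlt

theorem growth_eq_one : h.growth R = 1 := by
  refine Finset.prod_eq_one fun a ha => ?_
  exact absurd (hlt a) (not_lt.2 (by simpa using ha))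

include hR

variable {u : Idx Fq r → KK Fq s} {B : ℝ} (hu : ∀ a, ‖u a‖ ≤ B)
include hu

theorem norm_mul_inv_pow_le (a : Idx Fq r) (j : ℕ) :
    ‖u a * cToKK Fq s (latticePoint lam a.1)⁻¹ ^ j‖ * R ^ j ≤ B := by
  rw [norm_mul, norm_pow, norm_cToKK, mul_assoc, ← mul_pow]
  refine (mul_le_of_le_one_right (norm_nonneg _) (pow_le_one₀ (by positivity) ?_)).trans (hu a)
  rw [norm_inv, inv_mul_le_iff₀ (hR.trans (hlt a)), mul_one]
  exact (hlt a).le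

theorem norm_tsum_mul_inv_pow_le (j : ℕ) :
    ‖∑' a : Idx Fq r, u a * cToKK Fq s (latticePoint lam a.1)⁻¹ ^ j‖ * R ^ j ≤ max B 0 := by
  rw [← le_div_iff₀ (pow_pos hR j)]
  refine IsUltrametricDist.norm_tsum_le_of_forall_le_of_nonneg (by positivity) fun a => ?_
  rw [le_div_iff₀ (pow_pos hR j)]
  exact (h.norm_mul_inv_pow_le hR hlt hu a j).trans (le_max_left _ _)

theorem summable_mul_inv_pow (k : ℕ) :
    Summable fun a : Idx Fq r => u a * cToKK Fq s (latticePoint lam a.1)⁻¹ ^ (k + 1) := by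
  refine NonarchimedeanAddGroup.summable_of_tendsto_cofinite_zero ?_
  rw [tendsto_zero_iff_norm_tendsto_zero]
  have := (tendsto_zero_iff_norm_tendsto_zero.1 h.tendsto_inv).const_mul (B / R ^ k)
  rw [mul_zero] at this
  refine squeeze_zero (fun _ => norm_nonneg _) (fun a => ?_) this
  rw [pow_succ, ← mul_assoc, norm_mul, norm_cToKK]
  refine mul_le_mul_of_nonneg_right ?_ (norm_nonneg _)
  rw [le_div_iff₀ (pow_pos hR k)]
  exact h.norm_mul_inv_pow_le hR hlt hu a k

theorem summable_doubleTerm {z : Cinf Fq} (hz : ‖z‖ < R) (k : ℕ) :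
    Summable fun p : Idx Fq r × ℕ => doubleTerm lam u z k p.1 p.2 := by
  refine NonarchimedeanAddGroup.summable_of_tendsto_cofinite_zero ?_
  rw [tendsto_zero_iff_norm_tendsto_zero]
  have h1 := (tendsto_zero_iff_norm_tendsto_zero.1 h.tendsto_inv).const_mul (B / R ^ k)
  rw [mul_zero] at h1
  have h2 : Tendsto (fun m : ℕ => (‖z‖ / R) ^ m) cofinite (𝓝 0) := by
    rw [Nat.cofinite_eq_atTop]
    exact tendsto_pow_atTop_nhds_zero_of_lt_one (by positivity) ((div_lt_one hR).2 hz)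
  refine squeeze_zero (fun _ => norm_nonneg _) (fun p => ?_)
    (tendsto_mul_cofinite_nhds_zero h1 h2)
  have h3 := h.norm_mul_inv_pow_le hR hlt hu p.1 (p.2 + k)
  rw [← le_div_iff₀ (pow_pos hR _)] at h3
  rw [doubleTerm, norm_mul, norm_mul, norm_pow, norm_cToKK, pow_succ, ← mul_assoc (u p.1),
    norm_mul, norm_cToKK]
  have h4 : ‖((p.2 + k).choose k : KK Fq s)‖ ≤ 1 := IsUltrametricDist.norm_natCast_le_one _ _
  generalize ‖((p.2 + k).choose k : KK Fq s)‖ = x at h4 ⊢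
  have hy := norm_nonneg (u p.1 * cToKK Fq s (latticePoint lam p.1.1)⁻¹ ^ (p.2 + k))
  generalize ‖u p.1 * cToKK Fq s (latticePoint lam p.1.1)⁻¹ ^ (p.2 + k)‖ = y at h3 hy ⊢
  have hz0 : 0 ≤ ‖z‖ := norm_nonneg z
  have hl0 : 0 ≤ ‖(latticePoint lam p.1.1)⁻¹‖ := norm_nonneg _
  have hB : 0 ≤ B := (norm_nonneg _).trans (hu p.1)
  calc x * (y * ‖(latticePoint lam p.1.1)⁻¹‖) * ‖z‖ ^ p.2
      ≤ 1 * (B / R ^ (p.2 + k) * ‖(latticePoint lam p.1.1)⁻¹‖) * ‖z‖ ^ p.2 := by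
        refine mul_le_mul_of_nonneg_right (mul_le_mul_of_nonneg' h4
          (mul_le_mul_of_nonneg_right h3 hl0) ?_ ?_) (pow_nonneg hz0 _) <;> positivity
    _ = B / R ^ k * ‖(latticePoint lam p.1.1)⁻¹‖ * (‖z‖ / R) ^ p.2 := by
        rw [pow_add, div_pow]
        field_simp

theorem hasSum_doubleTerm {z : Cinf Fq} (hz : ‖z‖ < R) (k : ℕ) (a : Idx Fq r) :
    HasSum (doubleTerm lam u z k a) (u a * cToKK Fq s (latticePoint lam a.1 - z)⁻¹ ^ (k + 1)) := by
  have ha := h.ne_zero a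
  have hx : ‖cToKK Fq s (z / latticePoint lam a.1)‖ < 1 := by
    rw [norm_cToKK, norm_div, div_lt_one (norm_pos_iff.2 ha)]
    exact hz.trans (hlt a)
  have h1 := (hasSum_choose_mul_geometric_of_norm_lt_one k hx).mul_left
    (u a * cToKK Fq s (latticePoint lam a.1)⁻¹ ^ (k + 1))
  have h2 : (u a * cToKK Fq s (latticePoint lam a.1)⁻¹ ^ (k + 1)) *
      (1 / (1 - cToKK Fq s (z / latticePoint lam a.1)) ^ (k + 1)) =
        u a * cToKK Fq s (latticePoint lam a.1 - z)⁻¹ ^ (k + 1) := by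
    rw [mul_assoc, one_div, ← inv_pow, ← mul_pow, ← map_one (cToKK Fq s), ← map_sub, ← map_inv₀,
      ← map_mul, ← mul_inv, mul_sub, mul_one, mul_div_cancel₀ _ ha]
  rw [h2] at h1
  have h3 : doubleTerm lam u z k a = fun m => u a * cToKK Fq s (latticePoint lam a.1)⁻¹ ^ (k + 1) *
      (((m + k).choose k : KK Fq s) * cToKK Fq s (z / latticePoint lam a.1) ^ m) := by
    funext m
    rw [doubleTerm, div_eq_mul_inv, map_mul, mul_pow, add_assoc, pow_add]
    ring
  rw [h3]
  exact h1

/-- The expansion of `∑ u_λ (λ - z)^(-k-1)`, obtained by expanding each term and exchanging the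
sums. -/
theorem hasSum_choose_mul {z : Cinf Fq} (hz : ‖z‖ < R) (k : ℕ) :
    HasSum (fun m : ℕ => ((m + k).choose k : KK Fq s) *
        (∑' a : Idx Fq r, u a * cToKK Fq s (latticePoint lam a.1)⁻¹ ^ (m + k + 1)) *
          cToKK Fq s z ^ m)
      (∑' a : Idx Fq r, u a * cToKK Fq s (latticePoint lam a.1 - z)⁻¹ ^ (k + 1)) := by
  have hsum := h.summable_doubleTerm hR hlt hu hz k
  have htot : HasSum (fun p : Idx Fq r × ℕ => doubleTerm lam u z k p.1 p.2)
      (∑' a : Idx Fq r, u a * cToKK Fq s (latticePoint lam a.1 - z)⁻¹ ^ (k + 1)) := by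
    rw [(hsum.hasSum.prod_fiberwise fun a => h.hasSum_doubleTerm hR hlt hu hz k a).tsum_eq]
    exact hsum.hasSum
  have hswap : HasSum (fun p : ℕ × Idx Fq r => doubleTerm lam u z k p.2 p.1)
      (∑' a : Idx Fq r, u a * cToKK Fq s (latticePoint lam a.1 - z)⁻¹ ^ (k + 1)) :=
    (Equiv.hasSum_iff (f := fun p : Idx Fq r × ℕ => doubleTerm lam u z k p.1 p.2)
      (Equiv.prodComm ℕ (Idx Fq r))).2 htot
  have hcol : ∀ m, HasSum (fun a : Idx Fq r => doubleTerm lam u z k a m)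
      (((m + k).choose k : KK Fq s) *
        (∑' a : Idx Fq r, u a * cToKK Fq s (latticePoint lam a.1)⁻¹ ^ (m + k + 1)) *
          cToKK Fq s z ^ m) := fun m => by
    have h1 := (h.summable_mul_inv_pow hR hlt hu (m + k)).hasSum
    have h2 := (h1.mul_left ((m + k).choose k : KK Fq s)).mul_right (cToKK Fq s z ^ m)
    exact h2
  exact hswap.prod_fiberwise hcol

end IsLatticeBasis

end PartialFractions

/-! ### The functions `𝓗_k` -/

section HFunctions

variable {Fq : Type*} [Field Fq] [Fintype Fq] {r s n : ℕ} {Λ : Submodule Fq[X] (Cinf Fq)}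
  {lam : Fin r → Cinf Fq}
  (χ : Fq[X] →ₐ[Fq] Matrix (Fin n) (Fin n) (FractionRing (MvPolynomial (Fin s) Fq)))

theorem coeff_pow_expSeriesAt (Λ : Submodule Fq[X] (Cinf Fq)) (w : KK Fq s) (i : ℕ) :
    PowerSeries.coeff (Fintype.card Fq ^ i) (expSeriesAt Λ w) =
      cToKK Fq s (alpha Λ i) * (tau Fq s ^ i) w := by
  have hinj : ∀ k, Fintype.card Fq ^ k = Fintype.card Fq ^ i ↔ k = i := fun k =>
    (Nat.pow_right_injective Fintype.one_lt_card).eq_iff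
  rw [expSeriesAt, PowerSeries.coeff_mk]
  simp only [hinj]
  rw [Finset.sum_ite_eq' (Finset.range _), if_pos]
  exact Finset.mem_range.2 ((Nat.lt_pow_self Fintype.one_lt_card).trans (Nat.lt_succ_self _))

theorem coeff_expSeriesAt_of_ne (Λ : Submodule Fq[X] (Cinf Fq)) (w : KK Fq s) {m : ℕ}
    (hm : ∀ i, Fintype.card Fq ^ i ≠ m) : PowerSeries.coeff m (expSeriesAt Λ w) = 0 := by
  rw [expSeriesAt, PowerSeries.coeff_mk]
  exact Finset.sum_eq_zero fun i _ => if_neg (hm i)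

theorem tsum_expSeriesAt (Λ : Submodule Fq[X] (Cinf Fq)) (w : KK Fq s) (z : Cinf Fq) :
    ∑' m, PowerSeries.coeff m (expSeriesAt Λ w) * cToKK Fq s z ^ m =
      expK Λ (cToKK Fq s z * w) := by
  rw [← (Nat.pow_right_injective (Fintype.one_lt_card (α := Fq))).tsum_eq]
  · rw [expK]
    refine tsum_congr fun i => ?_
    rw [coeff_pow_expSeriesAt, map_mul, tau_pow_cToKK]
    ring
  · intro m hm
    by_contra hne
    refine hm ?_
    simp only
    rw [coeff_expSeriesAt_of_ne Λ w fun i hi => hne ⟨i, hi⟩, zero_mul]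

theorem exists_norm_chiRow_mul_omega_le (Λ : Submodule Fq[X] (Cinf Fq))
    (lam : Fin r → Cinf Fq) (i j : Fin n) :
    ∃ B, ∀ a : Idx Fq r, ‖(chiRow χ a.1 * omega Λ χ lam) i j‖ ≤ B := by
  obtain ⟨B, hB⟩ := Finite.exists_le fun c : Fin r × Fin n => ‖omega Λ χ lam c j‖
  refine ⟨max B 0, fun a => ?_⟩
  rw [Matrix.mul_apply]
  refine IsUltrametricDist.norm_sum_le_of_forall_le_of_nonneg (le_max_right _ _) fun c _ => ?_
  rw [norm_mul]
  exact (mul_le_of_le_one_left (norm_nonneg _) (norm_chiRow_le χ _ _ _)).trans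
    ((hB c).trans (le_max_left _ _))

namespace IsLatticeBasis

variable (h : IsLatticeBasis Λ lam)
include h

theorem exists_coeff_expSeriesAt_le {R : ℝ} (hR : 0 < R) (w : KK Fq s) :
    ∃ B, ∀ m, ‖PowerSeries.coeff m (expSeriesAt Λ w)‖ * R ^ m ≤ B := by
  obtain ⟨B, hB⟩ := h.isEntire ((‖w‖ + 1) * R) (by positivity)
  have hB0 : 0 ≤ B := le_trans (by positivity) (hB 0)
  refine ⟨B, fun m => ?_⟩
  by_cases hm : ∃ i, Fintype.card Fq ^ i = m
  · obtain ⟨i, rfl⟩ := hm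
    rw [coeff_pow_expSeriesAt, norm_mul, norm_cToKK, norm_tau_pow, mul_assoc, ← mul_pow]
    refine le_trans (mul_le_mul_of_nonneg_left (pow_le_pow_left₀ (by positivity) ?_ _)
      (norm_nonneg _)) (hB _)
    exact mul_le_mul_of_nonneg_right (le_add_of_nonneg_right zero_le_one) hR.le
  · rw [coeff_expSeriesAt_of_ne Λ w (not_exists.1 hm), norm_zero, zero_mul]
    exact hB0

/-- The power series of `exp_Λ` is linearised: only the coefficients `α_i` of `Z ^ (q ^ i)` are
nonzero. -/
theorem X_mul_map_expDivSeries :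
    PowerSeries.X * PowerSeries.map (cToKK Fq s) (expDivSeries Λ) = expSeriesAt Λ 1 := by
  rw [← PowerSeries.map_X (cToKK Fq s), ← map_mul]
  ext m
  rw [PowerSeries.coeff_map]
  by_cases hm : ∃ i, Fintype.card Fq ^ i = m
  · obtain ⟨i, rfl⟩ := hm
    rw [coeff_pow_expSeriesAt, map_one, mul_one, alpha]
  · rw [coeff_expSeriesAt_of_ne Λ 1 (not_exists.1 hm)]
    suffices h0 : PowerSeries.coeff m (PowerSeries.X * expDivSeries Λ) = 0 by rw [h0, map_zero]
    rcases m with _ | m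
    · simp
    rw [PowerSeries.coeff_succ_X_mul]
    refine tendsto_nhds_unique ((h.tendsto_coeff_divProd m).comp tendsto_boxF)
      (tendsto_const_nhds.congr fun d => ?_)
    obtain ⟨α, hα⟩ := isLinearised_subPoly (h.boxLin_injective d)
    have h1 : PowerSeries.coeff m (divProd lam (boxF Fq r d)) = (expPoly lam d).coeff (m + 1) := by
      rw [← Polynomial.coeff_coe, coe_expPoly, PowerSeries.coeff_succ_X_mul]
    rw [Function.comp_apply, h1, expPoly, hα, Polynomial.finsetSum_coeff]
    refine (Finset.sum_eq_zero fun i _ => ?_).symm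
    rw [Polynomial.coeff_C_mul, Polynomial.coeff_X_pow, if_neg, mul_zero]
    exact fun hi => hm ⟨i, hi.symm⟩

theorem expC_ne_zero {z : Cinf Fq} (hz0 : z ≠ 0)
    (hz : ∀ a : Idx Fq r, ‖z‖ < ‖latticePoint lam a.1‖) : expC Λ z ≠ 0 := by
  rw [← norm_pos_iff]
  refine lt_of_lt_of_le (mul_pos (norm_pos_iff.2 hz0) h.growth_pos)
    (h.norm_mul_growth_le_norm_expC hz0 fun a => ?_)
  rw [sub_eq_add_neg, IsUltrametricDist.norm_add_eq_max_of_norm_ne_norm]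
  · exact le_max_left _ _
  · rw [norm_neg]
    exact (hz a).ne

theorem psi_mul_apply (z : Cinf Fq) (v : Fin r × Fin n → KK Fq s) (i : Fin n) :
    HasSum (fun a : Idx Fq r => (∑ c, chiRow χ a.1 i c * v c) *
      cToKK Fq s (latticePoint lam a.1 - z)⁻¹) (-∑ c, psi χ lam z i c * v c) := by
  have h1 := hasSum_sum (s := Finset.univ) fun (c : Fin r × Fin n) _ =>
    (h.hasSum_psiTerm_apply χ z i c).mul_right (v c)
  simp only [← h.psi_apply χ z i] at h1
  have h2 : (fun a : Idx Fq r => (∑ c, chiRow χ a.1 i c * v c) *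
      cToKK Fq s (latticePoint lam a.1 - z)⁻¹) = fun a : Idx Fq r => -∑ c, chiRow χ a.1 i c *
        cToKK Fq s (z - latticePoint lam a.1)⁻¹ * v c := by
    funext a
    rw [Finset.sum_mul, ← Finset.sum_neg_distrib]
    refine Finset.sum_congr rfl fun c _ => ?_
    rw [← neg_sub z, inv_neg, map_neg]
    ring
  rw [h2]
  exact h1.neg

variable {R : ℝ} (hR : 0 < R) (hlt : ∀ a : Idx Fq r, R < ‖latticePoint lam a.1‖)
include hR hlt

theorem coeff_map_expDivSeries_le (m : ℕ) :
    ‖PowerSeries.coeff m (PowerSeries.map (cToKK Fq s) (expDivSeries Λ))‖ * R ^ m ≤ 1 := by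
  rw [PowerSeries.coeff_map, norm_cToKK, ← h.growth_eq_one hlt]
  exact h.coeff_expDivSeries_le hR m

theorem coeff_zero_map_expDivSeries :
    PowerSeries.coeff 0 (PowerSeries.map (cToKK Fq s) (expDivSeries Λ)) = 1 := by
  rw [PowerSeries.coeff_map, h.coeff_zero_expDivSeries, map_one]

/-- A bound for the numerator of `HSeries`. -/
theorem exists_coeff_shift_le (w : KK Fq s) : ∃ B, ∀ m, ‖PowerSeries.coeff m
    (PowerSeries.mk fun m => PowerSeries.coeff (m + 1) (expSeriesAt Λ w))‖ * R ^ m ≤ B := by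
  obtain ⟨B, hB⟩ := h.exists_coeff_expSeriesAt_le hR w
  refine ⟨B / R, fun m => ?_⟩
  rw [PowerSeries.coeff_mk, le_div_iff₀ hR, mul_assoc, ← pow_succ]
  exact hB _

theorem exists_coeff_HSeries_le (i j : Fin n) :
    ∃ B, ∀ m, ‖PowerSeries.coeff m (HSeries Λ χ i j)‖ * R ^ m ≤ B := by
  obtain ⟨B, hB⟩ := h.exists_coeff_shift_le hR hlt ((thetaSubChi χ)⁻¹ i j)
  exact ⟨1 * B, coeff_mul_bound hR (coeff_inv_bound hR (h.coeff_zero_map_expDivSeries hR hlt)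
    (h.coeff_map_expDivSeries_le hR hlt)) hB⟩

theorem tsum_shift_mul (w : KK Fq s) {z : Cinf Fq} (hz : ‖z‖ < R) :
    (∑' m, PowerSeries.coeff m (PowerSeries.mk fun m =>
      PowerSeries.coeff (m + 1) (expSeriesAt Λ w)) * cToKK Fq s z ^ m) * cToKK Fq s z =
      expK Λ (cToKK Fq s z * w) := by
  obtain ⟨B, hB⟩ := h.exists_coeff_expSeriesAt_le hR w
  have hs := (summable_norm_coeff_mul_pow hR hB (x := cToKK Fq s z)
    (by rwa [norm_cToKK])).of_norm
  rw [← tsum_expSeriesAt, hs.tsum_eq_zero_add, coeff_expSeriesAt_of_ne Λ w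
    (fun i => pow_ne_zero i Fintype.card_ne_zero), zero_mul, zero_add, ← tsum_mul_right]
  refine tsum_congr fun m => ?_
  rw [PowerSeries.coeff_mk, pow_succ, mul_assoc]

theorem evalSeries_HSeries (i j : Fin n) {z : Cinf Fq} (hz0 : z ≠ 0) (hz : ‖z‖ < R) :
    evalSeries (HSeries Λ χ i j) z =
      (cToKK Fq s (expC Λ z))⁻¹ * expChi Λ χ z i j := by
  have hzc : ‖cToKK Fq s z‖ < R := by rwa [norm_cToKK]
  have hz' : cToKK Fq s z ≠ 0 := (map_ne_zero _).2 hz0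
  obtain ⟨B, hB⟩ := h.exists_coeff_shift_le hR hlt ((thetaSubChi χ)⁻¹ i j)
  have hA := h.coeff_map_expDivSeries_le (s := s) hR hlt
  have hA0 := h.coeff_zero_map_expDivSeries (s := s) hR hlt
  have hinv := coeff_inv_bound hR hA0 hA
  set A := PowerSeries.map (cToKK Fq s) (expDivSeries Λ) with hAdef
  have h1 : (∑' m, PowerSeries.coeff m A⁻¹ * cToKK Fq s z ^ m) *
      ∑' m, PowerSeries.coeff m A * cToKK Fq s z ^ m = 1 := by
    rw [← tsum_coeff_mul hR hinv hA hzc, PowerSeries.inv_mul_cancel A (by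
      rw [← PowerSeries.coeff_zero_eq_constantCoeff_apply, hA0]; exact one_ne_zero),
      tsum_eq_single 0 fun m hm => by rw [PowerSeries.coeff_one, if_neg hm, zero_mul]]
    simp
  have h2 : (∑' m, PowerSeries.coeff m A * cToKK Fq s z ^ m) * cToKK Fq s z =
      cToKK Fq s (expC Λ z) := by
    rw [← h.expK_cToKK, ← mul_one (cToKK Fq s z), ← h.tsum_shift_mul hR hlt 1 hz,
      ← h.X_mul_map_expDivSeries]
    simp only [PowerSeries.coeff_succ_X_mul, PowerSeries.coeff_mk, mul_one, hAdef]
  have h3 := h.tsum_shift_mul hR hlt ((thetaSubChi χ)⁻¹ i j) hz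
  rw [evalSeries, HSeries, tsum_coeff_mul hR hinv hB hzc, ← h2, mul_inv,
    eq_inv_of_mul_eq_one_left h1]
  change _ = _ * expK Λ (cToKK Fq s z * (thetaSubChi χ)⁻¹ i j)
  rw [← h3]
  field_simp

variable {m₀ : Matrix (Fin n) (Fin n) (KK Fq s)}
  (hm₀ : ∀ i j, Tendsto (fun d => (tau Fq s ^ Module.finrank Fq (box Fq r d))
      ((thetaSubChi χ)⁻¹ i j)) atTop (𝓝 (m₀ i j)))
include hm₀

/-- The coefficients of `𝓗`, from its partial fraction expansion. Both sides define power series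
with the same sums at the points `θ⁻ᵏ` close to `0`, hence are equal. -/
theorem coeff_HSeries (i j : Fin n) (m : ℕ) :
    PowerSeries.coeff m (HSeries Λ χ i j) = (if m = 0 then m₀ i j else 0) -
      ∑' a : Idx Fq r, (chiRow χ a.1 * omega Λ χ lam) i j *
        cToKK Fq s (latticePoint lam a.1)⁻¹ ^ (m + 1) := by
  obtain ⟨B₁, hB₁⟩ := exists_norm_chiRow_mul_omega_le χ Λ lam i j
  obtain ⟨B₂, hB₂⟩ := h.exists_coeff_HSeries_le χ hR hlt i j
  set g : PowerSeries (KK Fq s) := PowerSeries.mk fun m =>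
    ∑' a : Idx Fq r, (chiRow χ a.1 * omega Λ χ lam) i j *
      cToKK Fq s (latticePoint lam a.1)⁻¹ ^ (m + 1) with hg
  have hgB : ∀ m, ‖PowerSeries.coeff m g‖ * R ^ m ≤ max B₁ 0 / R := fun m => by
    rw [hg, PowerSeries.coeff_mk, le_div_iff₀ hR, mul_assoc, ← pow_succ]
    exact h.norm_tsum_mul_inv_pow_le hR hlt hB₁ (m + 1)
  have hC : ∀ m, ‖PowerSeries.coeff m (PowerSeries.C (m₀ i j))‖ * R ^ m ≤ ‖m₀ i j‖ := fun m => by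
    rw [PowerSeries.coeff_C]
    split_ifs with h0 <;> simp [h0]
  have hadd : ∀ {f g : PowerSeries (KK Fq s)} {B B' : ℝ},
      (∀ m, ‖PowerSeries.coeff m f‖ * R ^ m ≤ B) → (∀ m, ‖PowerSeries.coeff m g‖ * R ^ m ≤ B') →
      ∀ m, ‖PowerSeries.coeff m (f - g)‖ * R ^ m ≤ B + B' := by
    intro f g B B' hf hg m
    rw [map_sub]
    refine (mul_le_mul_of_nonneg_right (norm_sub_le _ _) (by positivity)).trans ?_
    rw [add_mul]
    exact add_le_add (hf m) (hg m)
  suffices h0 : HSeries Λ χ i j - (PowerSeries.C (m₀ i j) - g) = 0 by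
    rw [sub_eq_zero.1 h0, map_sub, PowerSeries.coeff_C, hg, PowerSeries.coeff_mk]
  have hθ : 1 < ‖theta Fq‖ := one_lt_norm_theta
  have hx : Tendsto (fun k : ℕ => (theta Fq)⁻¹ ^ k) atTop (𝓝 0) :=
    tendsto_pow_atTop_nhds_zero_of_norm_lt_one (by rw [norm_inv]; exact inv_lt_one_of_one_lt₀ hθ)
  refine eq_zero_of_tsum_coeff_eq_zero hR (hadd hB₂ (hadd hC hgB))
    (x := fun k => cToKK Fq s ((theta Fq)⁻¹ ^ k))
    (fun k => (map_ne_zero _).2 (pow_ne_zero _ (inv_ne_zero theta_ne_zero))) ?_ ?_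
  · rw [← map_zero (cToKK Fq s)]
    exact ((continuous_cToKK Fq s).tendsto _).comp hx
  · filter_upwards [(tendsto_zero_iff_norm_tendsto_zero.1 hx).eventually (gt_mem_nhds hR)] with k hk
    have hz0 : (theta Fq)⁻¹ ^ k ≠ 0 := pow_ne_zero _ (inv_ne_zero theta_ne_zero)
    generalize (theta Fq)⁻¹ ^ k = z at hk hz0 ⊢
    have hzc : ‖cToKK Fq s z‖ < R := by rwa [norm_cToKK]
    have hsH := (summable_norm_coeff_mul_pow hR hB₂ hzc).of_norm
    have hsC := (summable_norm_coeff_mul_pow hR hC hzc).of_norm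
    have hsg := (summable_norm_coeff_mul_pow hR hgB hzc).of_norm
    simp only [map_sub, sub_mul]
    rw [hsH.tsum_sub (hsC.sub hsg), hsC.tsum_sub hsg]
    have hz : ∀ a, z ≠ latticePoint lam a := fun a ha => by
      by_cases ha0 : a = 0
      · rw [ha0] at ha
        exact hz0 (ha.trans (map_zero (latLin lam)))
      · exact lt_asymm (hlt ⟨a, ha0⟩) (ha ▸ hk)
    have e1 := h.evalSeries_HSeries χ hR hlt i j hz0 hk
    rw [evalSeries, h.expChi_eq χ hm₀ hz, inv_mul_cancel_left₀ ((map_ne_zero _).2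
      (h.expC_ne_zero hz0 fun a => hk.trans (hlt a))), Matrix.mul_apply] at e1
    have e2 : ∑' m, PowerSeries.coeff m (PowerSeries.C (m₀ i j)) * cToKK Fq s z ^ m = m₀ i j := by
      rw [tsum_eq_single 0 fun m hm => by rw [PowerSeries.coeff_C, if_neg hm, zero_mul]]
      simp
    have e3 : ∑' m, PowerSeries.coeff m g * cToKK Fq s z ^ m =
        -∑ c, psi χ lam z i c * omega Λ χ lam c j := by
      have h1 := (h.hasSum_choose_mul hR hlt hB₁ hk 0).tsum_eq
      simp only [Nat.choose_zero_right, Nat.cast_one, one_mul, add_zero, zero_add, pow_one] at h1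
      rw [← (h.psi_mul_apply χ z (fun c => omega Λ χ lam c j) i).tsum_eq]
      simp only [hg, PowerSeries.coeff_mk]
      exact h1
    rw [e1, e2, e3]
    ring

/-- The functions `𝓗_k` in terms of `ψ_Λ`: taking the divided derivative of order `q ^ k - 1`
raises the denominators `Z - λ` of `𝓗` to the power `q ^ k`, which `τ^(-k)` undoes. -/
theorem Hk_apply (k : ℕ) {z : Cinf Fq} (hz : ‖z‖ < R) (i j : Fin n) :
    Hk Λ χ k z i j = (if k = 0 then m₀ i j else 0) +
      ∑ c, psi χ lam z i c * ((tau Fq s)⁻¹ ^ k) (omega Λ χ lam c j) := by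
  obtain ⟨B₁, hB₁⟩ := exists_norm_chiRow_mul_omega_le χ Λ lam i j
  have hq : Fintype.card Fq ^ k - 1 + 1 = Fintype.card Fq ^ k :=
    Nat.sub_add_cancel (Nat.pos_of_ne_zero (pow_ne_zero _ Fintype.card_ne_zero))
  have hq0 : Fintype.card Fq ^ k - 1 = 0 ↔ k = 0 := by
    refine ⟨fun hk => ?_, fun hk => by simp [hk]⟩
    by_contra hk0
    have := Nat.one_lt_pow hk0 (Fintype.one_lt_card (α := Fq))
    omega
  have hsum := h.hasSum_choose_mul hR hlt hB₁ hz (Fintype.card Fq ^ k - 1)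
  have hdelta : HasSum (fun m : ℕ => if m = 0 then (if k = 0 then m₀ i j else 0) else 0)
      (if k = 0 then m₀ i j else 0) := by
    simpa using hasSum_ite_eq (0 : ℕ) (if k = 0 then m₀ i j else (0 : KK Fq s))
  have heval : evalSeries (dividedDeriv (Fintype.card Fq ^ k - 1) (HSeries Λ χ i j)) z =
      (if k = 0 then m₀ i j else 0) - ∑' a : Idx Fq r, (chiRow χ a.1 * omega Λ χ lam) i j *
        cToKK Fq s (latticePoint lam a.1 - z)⁻¹ ^ Fintype.card Fq ^ k := by
    rw [← hq, ← (hdelta.sub hsum).tsum_eq, evalSeries, hq]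
    refine tsum_congr fun m => ?_
    rw [dividedDeriv, PowerSeries.coeff_mk, h.coeff_HSeries χ hR hlt hm₀, mul_sub, sub_mul]
    congr 1
    by_cases hm : m = 0
    · subst hm
      by_cases hk : k = 0
      · simp [hk]
      · simp [hk, hq0]
    · simp [hm]
  rw [Hk, Matrix.of_apply, heval, map_sub, sub_eq_add_neg]
  congr 1
  · split_ifs with hk
    · simp [hk]
    · exact map_zero _
  · rw [neg_eq_iff_eq_neg]
    have hmap := (h.psi_mul_apply χ z
      (fun c => ((tau Fq s)⁻¹ ^ k) (omega Λ χ lam c j)) i).map (tau Fq s ^ k)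
        (continuous_tau_pow Fq s k)
    have hterm : (fun a : Idx Fq r => (chiRow χ a.1 * omega Λ χ lam) i j *
        cToKK Fq s (latticePoint lam a.1 - z)⁻¹ ^ Fintype.card Fq ^ k) = (tau Fq s ^ k) ∘
          fun a : Idx Fq r => (∑ c, chiRow χ a.1 i c *
            ((tau Fq s)⁻¹ ^ k) (omega Λ χ lam c j)) *
              cToKK Fq s (latticePoint lam a.1 - z)⁻¹ := by
      funext a
      rw [Function.comp_apply, map_mul, tau_pow_cToKK, Matrix.mul_apply, map_sum]
      congr 1
      refine Finset.sum_congr rfl fun c _ => ?_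
      rw [map_mul, tau_pow_tau_inv_pow, tau_pow_of_fixed Fq s (tau_chiRow χ _ _ _)]
    rw [hterm, hmap.tsum_eq, tau_inv_pow_tau_pow]

end IsLatticeBasis

end HFunctions

/-! ### Eisenstein series -/

section Eisenstein

variable {Fq : Type*} [Field Fq] [Fintype Fq] {r s n : ℕ} {Λ : Submodule Fq[X] (Cinf Fq)}
  {lam : Fin r → Cinf Fq}
  (χ : Fq[X] →ₐ[Fq] Matrix (Fin n) (Fin n) (FractionRing (MvPolynomial (Fin s) Fq)))

namespace IsLatticeBasis

variable (h : IsLatticeBasis Λ lam)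
include h

theorem hasSum_eisenstein (k : ℕ) : HasSum (eisensteinTerm χ lam (k + 1))
    (Matrix.of fun i c => ∑' a : Idx Fq r,
      chiRow χ a.1 i c * cToKK Fq s (latticePoint lam a.1)⁻¹ ^ (k + 1)) := by
  obtain ⟨R, hR, hlt⟩ := h.exists_lt_norm
  refine Pi.hasSum.2 fun i => Pi.hasSum.2 fun c => ?_
  have h1 := (h.summable_mul_inv_pow hR hlt (fun a => norm_chiRow_le χ a.1 i c) k).hasSum
  have h2 : (fun a : Idx Fq r => eisensteinTerm χ lam (k + 1) a i c) = fun a : Idx Fq r =>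
      chiRow χ a.1 i c * cToKK Fq s (latticePoint lam a.1)⁻¹ ^ (k + 1) := by
    funext a
    rw [eisensteinTerm, Matrix.smul_apply, smul_eq_mul, mul_comm, ← inv_pow, map_pow]
  rw [h2]
  exact h1

theorem eisenstein_apply (k : ℕ) (i : Fin n) (c : Fin r × Fin n) :
    eisenstein χ lam (k + 1) i c = ∑' a : Idx Fq r,
      chiRow χ a.1 i c * cToKK Fq s (latticePoint lam a.1)⁻¹ ^ (k + 1) :=
  congrFun (congrFun (h.hasSum_eisenstein χ k).tsum_eq i) c

/-- The Eisenstein series of weight `k + 1` vanishes unless `q - 1` divides `k`, as one sees by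
multiplying the lattice points by a constant. -/
theorem eisenstein_eq_zero {k : ℕ} (hk : ¬ Fintype.card Fq - 1 ∣ k) :
    eisenstein χ lam (k + 1) = 0 := by
  rw [← FiniteField.forall_pow_eq_one_iff Fq] at hk
  push Not at hk
  obtain ⟨ζ, hζ⟩ := hk
  have hζ0 : (ζ : Fq) ≠ 0 := ζ.ne_zero
  let e : Idx Fq r ≃ Idx Fq r :=
    { toFun := fun a => ⟨(ζ : Fq) • a.1, smul_ne_zero hζ0 a.2⟩
      invFun := fun a => ⟨(ζ : Fq)⁻¹ • a.1, smul_ne_zero (inv_ne_zero hζ0) a.2⟩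
      left_inv := fun a => Subtype.ext (inv_smul_smul₀ hζ0 a.1)
      right_inv := fun a => Subtype.ext (smul_inv_smul₀ hζ0 a.1) }
  set x := cToKK Fq s (algebraMap Fq (Cinf Fq) ζ) with hx
  have hx0 : x ≠ 0 := (map_ne_zero _).2 ((map_ne_zero _).2 hζ0)
  ext i c
  rw [h.eisenstein_apply, Matrix.zero_apply]
  set S := ∑' a : Idx Fq r, chiRow χ a.1 i c * cToKK Fq s (latticePoint lam a.1)⁻¹ ^ (k + 1)
    with hS
  have hterm : ∀ a : Idx Fq r,
      chiRow χ (e a).1 i c * cToKK Fq s (latticePoint lam (e a).1)⁻¹ ^ (k + 1) =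
        (x ^ k)⁻¹ * (chiRow χ a.1 i c * cToKK Fq s (latticePoint lam a.1)⁻¹ ^ (k + 1)) :=
    fun a => by
    have h1 : chiRow χ (e a).1 i c = x * chiRow χ a.1 i c :=
      congrFun (congrFun (chiK_smul χ (ζ : Fq) (a.1 c.1)) i) c.2
    have h2 : latticePoint lam (e a).1 = algebraMap Fq (Cinf Fq) ζ * latticePoint lam a.1 := by
      rw [← Algebra.smul_def]
      exact map_smul (latLin lam) (ζ : Fq) a.1
    rw [h1, h2, mul_inv, map_mul, mul_pow, map_inv₀, ← hx, inv_pow, pow_succ x]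
    field_simp
  have h1 : S = (x ^ k)⁻¹ * S := by
    conv_lhs => rw [hS, ← e.tsum_eq]
    rw [tsum_congr hterm, tsum_mul_left]
  have hxk : x ^ k ≠ 1 := by
    rw [hx, ← map_pow, ← map_pow]
    intro h0
    have h2 : (ζ : Fq) ^ k = 1 := (algebraMap Fq (Cinf Fq)).injective
      ((cToKK Fq s).injective (by rw [h0, map_one, map_one]))
    exact hζ (Units.ext (by simpa using h2))
  by_contra hS0
  refine hxk ?_
  have h3 := mul_right_cancel₀ hS0 ((one_mul S).trans h1)
  rw [← inv_eq_one, ← h3]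

variable {R : ℝ} (hR : 0 < R) (hlt : ∀ a : Idx Fq r, R < ‖latticePoint lam a.1‖)
include hR hlt

theorem hasSum_psi_apply {z : Cinf Fq} (hz : ‖z‖ < R) (i : Fin n) (c : Fin r × Fin n) :
    HasSum (fun m => -eisenstein χ lam (m + 1) i c * cToKK Fq s z ^ m) (psi χ lam z i c) := by
  have h1 := (h.hasSum_choose_mul hR hlt (fun a => norm_chiRow_le χ a.1 i c) hz 0).neg
  simp only [Nat.choose_zero_right, Nat.cast_one, one_mul, add_zero, zero_add, pow_one,
    ← h.eisenstein_apply χ, ← neg_mul] at h1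
  convert! h1 using 1
  rw [h.psi_apply, ← tsum_neg]
  refine tsum_congr fun a => ?_
  rw [← neg_sub z, inv_neg, map_neg, mul_neg, neg_neg]

theorem norm_eisenstein_mul_pow_le (m : ℕ) (i : Fin n) (c : Fin r × Fin n) :
    ‖-eisenstein χ lam (m + 1) i c‖ * R ^ m ≤ 1 / R := by
  rw [norm_neg, h.eisenstein_apply, le_div_iff₀ hR, mul_assoc, ← pow_succ]
  simpa using h.norm_tsum_mul_inv_pow_le hR hlt (fun a => norm_chiRow_le χ a.1 i c) (m + 1)

theorem hasSum_psi_eisenstein {z : Cinf Fq} (hz : ‖z‖ < R) :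
    HasSum (fun j : {j : ℕ // 1 ≤ j ∧ j ≡ 1 [MOD Fintype.card Fq - 1]} =>
      -(cToKK Fq s z ^ ((j : ℕ) - 1) • eisenstein χ lam (j : ℕ))) (psi χ lam z) := by
  have h1 : HasSum (fun m : ℕ => -(cToKK Fq s z ^ m • eisenstein χ lam (m + 1)))
      (psi χ lam z) := by
    refine Pi.hasSum.2 fun i => Pi.hasSum.2 fun c => ?_
    have h2 := h.hasSum_psi_apply χ hR hlt hz i c
    have h3 : (fun m => (-(cToKK Fq s z ^ m • eisenstein χ lam (m + 1))) i c) =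
        fun m => -eisenstein χ lam (m + 1) i c * cToKK Fq s z ^ m := by
      funext m
      rw [Matrix.neg_apply, Matrix.smul_apply, smul_eq_mul]
      ring
    rw [h3]
    exact h2
  have hinj : Function.Injective
      fun j : {j : ℕ // 1 ≤ j ∧ j ≡ 1 [MOD Fintype.card Fq - 1]} => (j : ℕ) - 1 := by
    intro j j' hjj
    have := j.2.1
    have := j'.2.1
    exact Subtype.ext (by simp only at hjj; omega)
  have h2 := (hinj.hasSum_iff (f := fun m : ℕ =>
    -(cToKK Fq s z ^ m • eisenstein χ lam (m + 1))) fun m hm => ?_).2 h1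
  · convert! h2 using 1
    funext j
    rw [Function.comp_apply, Nat.sub_add_cancel j.2.1]
  · rw [h.eisenstein_eq_zero χ fun hdvd => hm ?_, smul_zero, neg_zero]
    exact ⟨⟨m + 1, Nat.le_add_left _ _, ((Nat.modEq_iff_dvd' (Nat.le_add_left 1 m)).2
      (by simpa using hdvd)).symm⟩, by simp⟩

end IsLatticeBasis

/-! ### Analyticity -/

theorem convergesOnDisk_of_le {f : PowerSeries (KK Fq s)} {B R ρ : ℝ} (hρ : 0 ≤ ρ) (hρR : ρ < R)
    (hf : ∀ m, ‖PowerSeries.coeff m f‖ * R ^ m ≤ B) : ConvergesOnDisk f ρ := by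
  have hR : 0 < R := hρ.trans_lt hρR
  have h1 := (tendsto_pow_atTop_nhds_zero_of_lt_one (div_nonneg hρ hR.le)
    ((div_lt_one hR).2 hρR)).const_mul B
  rw [mul_zero] at h1
  exact squeeze_zero (fun m => by positivity)
    (fun m => norm_mul_pow_le_geometric hR (hf m) hρ) h1

theorem convergesOnDisk_dividedDeriv {f : PowerSeries (KK Fq s)} {B R ρ : ℝ} (hρ : 0 ≤ ρ)
    (hρR : ρ < R) (hf : ∀ m, ‖PowerSeries.coeff m f‖ * R ^ m ≤ B) (k : ℕ) :
    ConvergesOnDisk (dividedDeriv k f) ρ := by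
  have hR : 0 < R := hρ.trans_lt hρR
  refine convergesOnDisk_of_le (B := B / R ^ k) hρ hρR fun m => ?_
  rw [dividedDeriv, PowerSeries.coeff_mk, le_div_iff₀ (pow_pos hR k), mul_assoc, ← pow_add,
    norm_mul]
  refine le_trans (mul_le_mul_of_nonneg_right (mul_le_of_le_one_left (norm_nonneg _)
    (IsUltrametricDist.norm_natCast_le_one _ _)) (by positivity)) (hf _)

theorem isAnalyticOnDisk_const (x : KK Fq s) (ρ : ℝ) : IsAnalyticOnDisk (fun _ => x) ρ := by
  have hm : ∀ m, m ≠ 0 → PowerSeries.coeff m (PowerSeries.C x) = 0 := fun m hm => by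
    rw [PowerSeries.coeff_C, if_neg hm]
  refine ⟨PowerSeries.C x, tendsto_const_nhds.congr' ?_, fun z _ => ?_⟩
  · filter_upwards [eventually_ne_atTop 0] with m h0
    rw [hm m h0, norm_zero, zero_mul]
  · have := hasSum_single (f := fun m => PowerSeries.coeff m (PowerSeries.C x) *
      cToKK Fq s z ^ m) 0 fun m h0 => by rw [hm m h0, zero_mul]
    simpa using this

theorem IsAnalyticOnDisk.add {f g : Cinf Fq → KK Fq s} {ρ : ℝ} (hρ : 0 ≤ ρ)
    (hf : IsAnalyticOnDisk f ρ) (hg : IsAnalyticOnDisk g ρ) :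
    IsAnalyticOnDisk (fun z => f z + g z) ρ := by
  obtain ⟨f', hf1, hf2⟩ := hf
  obtain ⟨g', hg1, hg2⟩ := hg
  refine ⟨f' + g', ?_, fun z hz => ?_⟩
  · have h1 := hf1.add hg1
    rw [add_zero] at h1
    refine squeeze_zero (fun m => by positivity) (fun m => ?_) h1
    rw [map_add, ← add_mul]
    exact mul_le_mul_of_nonneg_right (norm_add_le _ _) (by positivity)
  · simp only [map_add, add_mul]
    exact (hf2 z hz).add (hg2 z hz)

theorem IsAnalyticOnDisk.mul_const {f : Cinf Fq → KK Fq s} {ρ : ℝ}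
    (hf : IsAnalyticOnDisk f ρ) (x : KK Fq s) : IsAnalyticOnDisk (fun z => f z * x) ρ := by
  obtain ⟨f', hf1, hf2⟩ := hf
  refine ⟨PowerSeries.C x * f', ?_, fun z hz => ?_⟩
  · have h1 := hf1.const_mul ‖x‖
    rw [mul_zero] at h1
    refine h1.congr fun m => ?_
    rw [PowerSeries.coeff_C_mul, norm_mul, mul_assoc]
  · have h1 := (hf2 z hz).mul_left x
    simp only [PowerSeries.coeff_C_mul]
    rw [mul_comm (f z)]
    simpa only [mul_assoc] using h1

theorem IsAnalyticOnDisk.sum {ι : Type*} (S : Finset ι) {f : ι → Cinf Fq → KK Fq s} {ρ : ℝ}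
    (hρ : 0 ≤ ρ) (hf : ∀ c ∈ S, IsAnalyticOnDisk (f c) ρ) :
    IsAnalyticOnDisk (fun z => ∑ c ∈ S, f c z) ρ := by
  classical
  induction S using Finset.induction_on with
  | empty => simpa using isAnalyticOnDisk_const (0 : KK Fq s) ρ
  | insert c S hc ih =>
    simp only [Finset.sum_insert hc]
    exact (hf c (Finset.mem_insert_self _ _)).add hρ
      (ih fun c hc => hf c (Finset.mem_insert_of_mem hc))

/-- Analyticity only depends on the values on the disk. -/
theorem IsAnalyticOnDisk.congr {f g : Cinf Fq → KK Fq s} {ρ : ℝ} (hf : IsAnalyticOnDisk f ρ)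
    (hfg : ∀ z, ‖z‖ ≤ ρ → f z = g z) : IsAnalyticOnDisk g ρ := by
  obtain ⟨f', hf1, hf2⟩ := hf
  exact ⟨f', hf1, fun z hz => hfg z hz ▸ hf2 z hz⟩

namespace IsLatticeBasis

variable (h : IsLatticeBasis Λ lam) {R ρ : ℝ} (hρ : 0 ≤ ρ) (hρR : ρ < R)
  (hlt : ∀ a : Idx Fq r, R < ‖latticePoint lam a.1‖)
include h hρ hρR hlt

theorem isAnalyticOnDisk_psi (i : Fin n) (c : Fin r × Fin n) :
    IsAnalyticOnDisk (fun z => psi χ lam z i c) ρ := by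
  have hR : 0 < R := hρ.trans_lt hρR
  refine ⟨PowerSeries.mk fun m => -eisenstein χ lam (m + 1) i c,
    convergesOnDisk_of_le (B := 1 / R) hρ hρR fun m => ?_, fun z hz => ?_⟩
  · rw [PowerSeries.coeff_mk]
    exact h.norm_eisenstein_mul_pow_le χ hR hlt m i c
  · simp only [PowerSeries.coeff_mk]
    exact h.hasSum_psi_apply χ hR hlt (hz.trans_lt hρR) i c

theorem isAnalyticOnDisk_Hk (k : ℕ) (i j : Fin n) :
    IsAnalyticOnDisk (fun z => Hk Λ χ k z i j) ρ := by
  obtain ⟨m₀, hm₀, -⟩ := h.exists_tendsto_tau_pow χ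
  exact ((isAnalyticOnDisk_const _ ρ).add hρ (IsAnalyticOnDisk.sum Finset.univ hρ fun c _ =>
    (h.isAnalyticOnDisk_psi χ hρ hρR hlt i c).mul_const _)).congr fun z hz =>
      (h.Hk_apply χ (hρ.trans_lt hρR) hlt hm₀ k (hz.trans_lt hρR) i j).symm

/-- The identity `𝓗 = ψ_Λ Ω_Λ`. -/
theorem HMatrix_eq {z : Cinf Fq} (hz : ‖z‖ ≤ ρ) :
    HMatrix r Λ χ z = psi χ lam z * Omega Λ χ lam := by
  obtain ⟨m₀, hm₀, hr⟩ := h.exists_tendsto_tau_pow χ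
  ext i c
  have hm : m₀ = 0 := hr c.1.pos
  rw [HMatrix, Matrix.of_apply, h.Hk_apply χ (hρ.trans_lt hρR) hlt hm₀ _ (hz.trans_lt hρR),
    hm, Matrix.zero_apply, ite_self, zero_add, Matrix.mul_apply]
  rfl

end IsLatticeBasis

end Eisenstein

/-! ### Moore systems with dominant scalar part -/

section Moore

theorem norm_sub_le_max_norm {E : Type*} [SeminormedAddCommGroup E] [IsUltrametricDist E]
    (x y : E) : ‖x - y‖ ≤ max ‖x‖ ‖y‖ := by
  rw [sub_eq_add_neg, ← norm_neg y]
  exact IsUltrametricDist.norm_add_le_max _ _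

/-- A matrix dominated by its scalar part has an inverse of the expected size. -/
theorem norm_inv_apply_le {E : Type*} [NormedField E] [IsUltrametricDist E] {n : ℕ}
    {B : Matrix (Fin n) (Fin n) E} {c : E}
    (h : ∀ i j, ‖B i j - (c • (1 : Matrix (Fin n) (Fin n) E)) i j‖ < ‖c‖) (i j : Fin n) :
    ‖B⁻¹ i j‖ ≤ ‖c‖⁻¹ := by
  have hc : 0 < ‖c‖ := (norm_nonneg _).trans_lt (h i j)
  have hB : B * B⁻¹ = 1 := Matrix.mul_nonsing_inv B
    ((Matrix.isUnit_iff_isUnit_det _).1 (isUnit_of_norm_sub_smul_one_lt h))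
  have : Nonempty (Fin n) := ⟨i⟩
  obtain ⟨p, hp⟩ := Finite.exists_max fun p : Fin n => ‖B⁻¹ p j‖
  refine (hp i).trans ?_
  have h1 : c * B⁻¹ p j = (1 : Matrix (Fin n) (Fin n) E) p j -
      ∑ k, (B p k - (c • (1 : Matrix (Fin n) (Fin n) E)) p k) * B⁻¹ k j := by
    have h0 : (1 : Matrix (Fin n) (Fin n) E) p j = ∑ k, B p k * B⁻¹ k j := by
      rw [← Matrix.mul_apply, hB]
    rw [h0]
    simp [sub_mul, Finset.sum_sub_distrib, Matrix.one_apply]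
  by_contra! hlt
  have hpos : 0 < ‖B⁻¹ p j‖ := (inv_pos.2 hc).trans hlt
  have h2 : ‖c * B⁻¹ p j‖ < ‖c‖ * ‖B⁻¹ p j‖ := by
    conv_lhs => rw [h1]
    refine (norm_sub_le_max_norm _ _).trans_lt (max_lt ?_ ?_)
    · refine lt_of_le_of_lt ?_ ((inv_lt_iff_one_lt_mul₀' hc).1 hlt)
      rw [Matrix.one_apply]
      split_ifs <;> simp
    · obtain ⟨k, -, hk⟩ := IsUltrametricDist.exists_norm_finsetSum_le_of_nonempty
        (t := (Finset.univ : Finset (Fin n))) Finset.univ_nonempty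
        (fun k => (B p k - (c • (1 : Matrix (Fin n) (Fin n) E)) p k) * B⁻¹ k j)
      refine hk.trans_lt ?_
      rw [norm_mul]
      exact (mul_le_mul_of_nonneg_left (hp k) (norm_nonneg _)).trans_lt
        (mul_lt_mul_of_pos_right (h p k) hpos)
  exact absurd (norm_mul c _) h2.ne

/-- Division of matrices with dominant scalar part. -/
theorem norm_mul_inv_sub_smul_one_lt {E : Type*} [NormedField E] [IsUltrametricDist E] {n : ℕ}
    {A B : Matrix (Fin n) (Fin n) E} {c d : E}
    (hA : ∀ i j, ‖A i j - (c • (1 : Matrix (Fin n) (Fin n) E)) i j‖ < ‖c‖)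
    (hB : ∀ i j, ‖B i j - (d • (1 : Matrix (Fin n) (Fin n) E)) i j‖ < ‖d‖) (i j : Fin n) :
    ‖(A * B⁻¹) i j - ((c / d) • (1 : Matrix (Fin n) (Fin n) E)) i j‖ < ‖c / d‖ := by
  have hd : 0 < ‖d‖ := (norm_nonneg _).trans_lt (hB i j)
  have hd0 : d ≠ 0 := norm_pos_iff.1 hd
  have hc : 0 < ‖c‖ := (norm_nonneg _).trans_lt (hA i j)
  have hBu : B * B⁻¹ = 1 := Matrix.mul_nonsing_inv B
    ((Matrix.isUnit_iff_isUnit_det _).1 (isUnit_of_norm_sub_smul_one_lt hB))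
  have h1 : A * B⁻¹ - (c / d) • 1 =
      ((A - c • 1) - (c / d) • (B - d • 1)) * B⁻¹ := by
    rw [smul_sub, smul_smul, div_mul_cancel₀ _ hd0, sub_sub_sub_cancel_right, sub_mul,
      smul_mul_assoc, hBu]
  rw [← Matrix.sub_apply, h1, Matrix.mul_apply]
  have : Nonempty (Fin n) := ⟨i⟩
  obtain ⟨k, -, hk⟩ := IsUltrametricDist.exists_norm_finsetSum_le_of_nonempty
    (t := (Finset.univ : Finset (Fin n))) Finset.univ_nonempty
    (fun k => ((A - c • 1) - (c / d) • (B - d • 1)) i k * B⁻¹ k j)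
  refine hk.trans_lt ?_
  rw [norm_mul, norm_div, div_eq_mul_inv ‖c‖]
  refine (mul_le_mul_of_nonneg_left (norm_inv_apply_le hB k j) (norm_nonneg _)).trans_lt
    (mul_lt_mul_of_pos_right ?_ (inv_pos.2 hd))
  rw [Matrix.sub_apply]
  refine (norm_sub_le_max_norm _ _).trans_lt (max_lt (hA i k) ?_)
  rw [Matrix.smul_apply, smul_eq_mul, norm_mul, norm_div]
  calc ‖c‖ / ‖d‖ * ‖(B - d • 1) i k‖ < ‖c‖ / ‖d‖ * ‖d‖ :=
        mul_lt_mul_of_pos_left (hB i k) (div_pos hc hd)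
    _ = ‖c‖ := div_mul_cancel₀ _ hd.ne'

variable {Fq : Type*} [Field Fq] [Fintype Fq] {s n : ℕ}

variable (Fq s n) in
/-- The automorphism `τ`, applied to the entries of a square matrix. -/
def tauMat : RingAut (Matrix (Fin n) (Fin n) (KK Fq s)) := RingEquiv.mapMatrix (tau Fq s)

theorem tauMat_pow_apply (k : ℕ) (M : Matrix (Fin n) (Fin n) (KK Fq s)) (i j : Fin n) :
    (tauMat Fq s n ^ k) M i j = (tau Fq s ^ k) (M i j) := by
  induction k with
  | zero => simp
  | succ k ih =>
    rw [tau_pow_succ_apply, ← ih, pow_succ', RingAut.mul_apply]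
    rfl

/-- Summation by parts in a Moore system. -/
theorem sum_tauMat_mulVec (z : Matrix (Fin n) (Fin n) (KK Fq s)) (u : ℕ → Fin n → KK Fq s)
    (r : ℕ) : ∑ k ∈ Finset.range (r + 1), Matrix.mulVec ((tauMat Fq s n ^ k) z) (u k) =
      Matrix.mulVec ((tauMat Fq s n ^ r) z) (∑ i ∈ Finset.range (r + 1), u i) -
        ∑ k ∈ Finset.range r, Matrix.mulVec ((tauMat Fq s n ^ k) (tauMat Fq s n z - z))
          (∑ i ∈ Finset.range (k + 1), u i) := by
  induction r with
  | zero => simp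
  | succ r ih =>
    have h1 : (tauMat Fq s n ^ r) (tauMat Fq s n z - z) =
        (tauMat Fq s n ^ (r + 1)) z - (tauMat Fq s n ^ r) z := by
      rw [map_sub, pow_succ, RingAut.mul_apply]
    rw [Finset.sum_range_succ, ih, Finset.sum_range_succ u (r + 1), Matrix.mulVec_add,
      Finset.sum_range_succ (fun k => Matrix.mulVec ((tauMat Fq s n ^ k) (tauMat Fq s n z - z))
        (∑ i ∈ Finset.range (k + 1), u i)) r, h1, Matrix.sub_mulVec]
    abel

/-- The size of `g ^ q - g`, for `g` at distance at least `1` from `𝔽_q`. -/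
theorem norm_pow_le_norm_pow_sub {g : Cinf Fq}
    (hg : ∀ c : Fq, 1 ≤ ‖g - algebraMap Fq (Cinf Fq) c‖) :
    ‖g‖ ^ Fintype.card Fq ≤ ‖g ^ Fintype.card Fq - g‖ := by
  rw [← prod_sub_algebraMap, norm_prod, ← Finset.card_univ, ← Finset.prod_const]
  refine Finset.prod_le_prod (fun _ _ => norm_nonneg _) fun c _ => ?_
  have h1 : ‖algebraMap Fq (Cinf Fq) c‖ ≤ 1 := by
    by_cases hc : c = 0
    · simp [hc]
    · exact (norm_algebraMap_Fq Fq hc).le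
  have h2 := IsUltrametricDist.norm_add_le_max (g - algebraMap Fq (Cinf Fq) c)
    (algebraMap Fq (Cinf Fq) c)
  rw [sub_add_cancel] at h2
  exact h2.trans (max_le le_rfl (h1.trans (hg c)))

/-- A Moore system has no nonzero solution if its matrices are dominated by scalars which are the
values of an injective `𝔽_q`-linear map. A vector of least value serves as a pivot: after division
by its matrix, summation by parts leaves a system of the same kind on a complement. -/
theorem eq_zero_of_sum_tauMat_mulVec_eq_zero (r : ℕ) : ∀ {V : Type*} [AddCommGroup V] [Module Fq V]
    [Module.Finite Fq V], Module.finrank Fq V = r → ∀ (f : V →ₗ[Fq] Cinf Fq),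
    Function.Injective f → ∀ (Y : V → Matrix (Fin n) (Fin n) (KK Fq s)),
    (∀ v, v ≠ 0 → ∀ i j, ‖Y v i j -
      (cToKK Fq s (f v) • (1 : Matrix (Fin n) (Fin n) (KK Fq s))) i j‖ < ‖f v‖) →
    ∀ w : ℕ → Fin n → KK Fq s, (∀ v, v ≠ 0 →
      ∑ k ∈ Finset.range r, Matrix.mulVec ((tauMat Fq s n ^ k) (Y v)) (w k) = 0) →
    ∀ k < r, w k = 0 := by
  induction r with
  | zero => intro _ _ _ _ _ _ _ _ _ _ _ k hk; exact absurd hk (Nat.not_lt_zero k)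
  | succ r ih =>
    intro V _ _ _ hV f hf Y hY w hw
    have : Finite V := Module.finite_of_finite Fq
    have : Nontrivial V := Module.nontrivial_of_finrank_pos (R := Fq) (by omega)
    obtain ⟨v₀, hv₀⟩ := exists_ne (0 : V)
    have : Nonempty {v : V // v ≠ 0} := ⟨⟨v₀, hv₀⟩⟩
    obtain ⟨⟨v₁, hv₁⟩, hmin⟩ := Finite.exists_min fun v : {v : V // v ≠ 0} => ‖f v‖
    have hf0 : ∀ v, v ≠ 0 → f v ≠ 0 := fun v hv => (map_ne_zero_iff f hf).2 hv
    have hf₁ : 0 < ‖f v₁‖ := norm_pos_iff.2 (hf0 v₁ hv₁)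
    set P := Y v₁ with hP
    have hnorm : ∀ v, v ≠ 0 → ∀ i j, ‖Y v i j -
      (cToKK Fq s (f v) • (1 : Matrix (Fin n) (Fin n) (KK Fq s))) i j‖ < ‖cToKK Fq s (f v)‖ :=
      fun v hv i j => by rw [norm_cToKK]; exact hY v hv i j
    have hPu : IsUnit P := isUnit_of_norm_sub_smul_one_lt (hnorm v₁ hv₁)
    have hPi : P⁻¹ * P = 1 :=
      Matrix.nonsing_inv_mul P ((Matrix.isUnit_iff_isUnit_det _).1 hPu)
    have hPi' : P * P⁻¹ = 1 :=
      Matrix.mul_nonsing_inv P ((Matrix.isUnit_iff_isUnit_det _).1 hPu)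
    set u : ℕ → Fin n → KK Fq s := fun k => Matrix.mulVec ((tauMat Fq s n ^ k) P) (w k) with hu
    have hsys : ∀ v, v ≠ 0 →
        ∑ k ∈ Finset.range (r + 1), Matrix.mulVec ((tauMat Fq s n ^ k) (Y v * P⁻¹)) (u k) = 0 := by
      intro v hv
      rw [← hw v hv]
      refine Finset.sum_congr rfl fun k _ => ?_
      rw [hu, Matrix.mulVec_mulVec, ← map_mul, mul_assoc, hPi, mul_one]
    have hS : ∑ i ∈ Finset.range (r + 1), u i = 0 := by
      simpa [← hP, hPi'] using hsys v₁ hv₁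
    -- The partial sums solve a Moore system on a complement of the line of `v₁`.
    obtain ⟨V', hV'⟩ := Submodule.exists_isCompl (Fq ∙ v₁)
    have hrank : Module.finrank Fq V' = r := by
      have h1 := Submodule.finrank_add_eq_of_isCompl hV'
      rw [finrank_span_singleton hv₁, hV] at h1
      omega
    have hne : ∀ v : V', v ≠ 0 → ∀ c : Fq, (v : V) - c • v₁ ≠ 0 := fun v hv c h0 => by
      refine hv (Subtype.ext (Submodule.disjoint_def.1 hV'.disjoint v ?_ v.2))
      rw [sub_eq_zero.1 h0]
      exact Submodule.smul_mem _ _ (Submodule.mem_span_singleton_self v₁)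
    have hdist : ∀ v : V', v ≠ 0 → ∀ c : Fq, 1 ≤ ‖f v / f v₁ - algebraMap Fq (Cinf Fq) c‖ := by
      intro v hv c
      have h1 : f v / f v₁ - algebraMap Fq (Cinf Fq) c = f ((v : V) - c • v₁) / f v₁ := by
        rw [map_sub, map_smul, Algebra.smul_def, sub_div, mul_div_cancel_right₀ _ (hf0 v₁ hv₁)]
      rw [h1, norm_div, one_le_div₀ hf₁]
      exact hmin ⟨_, hne v hv c⟩
    let f' : V' →ₗ[Fq] Cinf Fq :=
      ((FiniteField.frobeniusAlgHom Fq (Cinf Fq)).toLinearMap - LinearMap.id) ∘ₗ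
        (LinearMap.mulRight Fq (f v₁)⁻¹) ∘ₗ f ∘ₗ V'.subtype
    have hf' : ∀ v : V', f' v = (f v / f v₁) ^ Fintype.card Fq - f v / f v₁ := fun v => by
      rw [div_eq_mul_inv]
      rfl
    have hone : ∀ v : V', v ≠ 0 → 1 ≤ ‖f v / f v₁‖ := fun v hv => by
      simpa using hdist v hv 0
    have hsize : ∀ v : V', v ≠ 0 → ‖f v / f v₁‖ ^ Fintype.card Fq ≤ ‖f' v‖ := fun v hv => by
      rw [hf']
      exact norm_pow_le_norm_pow_sub (hdist v hv)
    have hinj : Function.Injective f' := (injective_iff_map_eq_zero f').2 fun v h0 => by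
      by_contra hv
      have h1 := (one_le_pow₀ (hone v hv)).trans (hsize v hv)
      rw [h0, norm_zero] at h1
      exact absurd h1 (by norm_num)
    have hzero := ih hrank f' hinj
      (fun v => tauMat Fq s n (Y v * P⁻¹) - Y v * P⁻¹) (fun v hv i j => ?_)
      (fun k => ∑ i ∈ Finset.range (k + 1), u i) (fun v hv => ?_)
    · have hS' : ∀ k ≤ r + 1, ∑ i ∈ Finset.range k, u i = 0 := fun k hk => by
        rcases k with _ | k
        · simp
        · rcases (Nat.le_of_succ_le_succ hk).lt_or_eq with hlt | rfl
          · exact hzero k hlt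
          · exact hS
      intro k hk
      have huk : u k = 0 := by
        have h1 := hS' (k + 1) (by omega)
        rwa [Finset.sum_range_succ, hS' k hk.le, zero_add] at h1
      have h1 := congrArg (Matrix.mulVec ((tauMat Fq s n ^ k) P⁻¹)) huk
      rwa [hu, Matrix.mulVec_mulVec, ← map_mul, hPi, map_one, Matrix.one_mulVec,
        Matrix.mulVec_zero] at h1
    · have hv' : (v : V) ≠ 0 := fun h0 => hv (Subtype.ext h0)
      set D := (Y v * P⁻¹) i j -
        (cToKK Fq s (f v / f v₁) • (1 : Matrix (Fin n) (Fin n) (KK Fq s))) i j with hD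
      have hDlt : ‖D‖ < ‖f v / f v₁‖ := by
        have := norm_mul_inv_sub_smul_one_lt (hnorm v hv') (hnorm v₁ hv₁) i j
        rwa [← map_div₀, norm_cToKK] at this
      have h1 : (tauMat Fq s n (Y v * P⁻¹) - Y v * P⁻¹) i j -
          (cToKK Fq s (f' v) • (1 : Matrix (Fin n) (Fin n) (KK Fq s))) i j =
            tau Fq s D - D := by
        have h2 : tau Fq s ((1 : Matrix (Fin n) (Fin n) (KK Fq s)) i j) =
            (1 : Matrix (Fin n) (Fin n) (KK Fq s)) i j := by
          rw [Matrix.one_apply]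
          split_ifs <;> simp
        have h3 : tauMat Fq s n (Y v * P⁻¹) i j = tau Fq s ((Y v * P⁻¹) i j) := rfl
        rw [hD, Matrix.sub_apply, h3, Matrix.smul_apply, Matrix.smul_apply, smul_eq_mul,
          smul_eq_mul, map_sub (tau Fq s), map_mul (tau Fq s), h2, tau_cToKK, hf', map_sub,
          map_pow]
        ring
      rw [h1]
      refine ((norm_sub_le_max_norm _ _).trans_lt (max_lt ?_ ?_)).trans_le (hsize v hv)
      · rw [norm_tau]
        exact pow_lt_pow_left₀ hDlt (norm_nonneg _) Fintype.card_ne_zero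
      · exact hDlt.trans_le (le_self_pow₀ (hone v hv) Fintype.card_ne_zero)
    · have hv' : (v : V) ≠ 0 := fun h0 => hv (Subtype.ext h0)
      have h1 := sum_tauMat_mulVec (Y v * P⁻¹) u r
      rw [hsys v hv', hS, Matrix.mulVec_zero, zero_sub, eq_comm, neg_eq_zero] at h1
      exact h1

end Moore

/-! ### Invertibility of `Ω_Λ` -/

section Invertibility

variable {Fq : Type*} [Field Fq] [Fintype Fq] {r s n : ℕ} {Λ : Submodule Fq[X] (Cinf Fq)}
  {lam : Fin r → Cinf Fq}
  (χ : Fq[X] →ₐ[Fq] Matrix (Fin n) (Fin n) (FractionRing (MvPolynomial (Fin s) Fq)))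

/-- A lattice point of least size among those with given constant terms. -/
theorem IsLatticeBasis.exists_shortest_lift (h : IsLatticeBasis Λ lam) (c : Fin r → Fq) :
    ∃ a : Fin r → Fq[X], (∀ i, (a i).coeff 0 = c i) ∧ ∀ a' : Fin r → Fq[X],
      (∀ i, (a' i).coeff 0 = c i) → ‖latticePoint lam a‖ ≤ ‖latticePoint lam a'‖ :=
  h.tendsto.exists_within_forall_le (s := {a : Fin r → Fq[X] | ∀ i, (a i).coeff 0 = c i})
    ⟨fun i => Polynomial.C (c i), fun _ => Polynomial.coeff_C_zero⟩

namespace IsLatticeBasis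

variable (h : IsLatticeBasis Λ lam)
include h

/-- The map `c ↦ exp_Λ((c_1 λ_1 + ⋯ + c_r λ_r) / θ)` on `𝔽_q^r`; its values are the `θ`-torsion
points of the Drinfeld module of `Λ`. -/
def torsionLin : (Fin r → Fq) →ₗ[Fq] Cinf Fq :=
  h.expLin ∘ₗ LinearMap.mulRight Fq (theta Fq)⁻¹ ∘ₗ latLin lam ∘ₗ
    (Polynomial.monomial 0 : Fq →ₗ[Fq] Fq[X]).compLeft (Fin r)

theorem torsionLin_eq {c : Fin r → Fq} {a : Fin r → Fq[X]} (ha : ∀ i, (a i).coeff 0 = c i) :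
    h.torsionLin c = expC Λ (latticePoint lam a * (theta Fq)⁻¹) := by
  have hdec : a = (Polynomial.X : Fq[X]) • (fun i => (a i).divX) +
      fun i => Polynomial.monomial 0 (c i) := by
    funext i
    conv_lhs => rw [← Polynomial.divX_mul_X_add (a i), ha, mul_comm]
    rfl
  have h1 : latticePoint lam a * (theta Fq)⁻¹ = latticePoint lam (fun i => (a i).divX) +
      latticePoint lam (fun i => Polynomial.monomial 0 (c i)) * (theta Fq)⁻¹ := by
    conv_lhs => rw [hdec, ← latLin_apply, map_add, latLin_apply, latLin_apply,
      latticePoint_X_smul, add_mul, mul_comm (theta Fq), mul_inv_cancel_right₀ theta_ne_zero]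
  rw [h1, h.expC_add, h.expC_latticePoint, zero_add]
  rfl

section ShortestLift

variable {c : Fin r → Fq} (hc : c ≠ 0) {a : Fin r → Fq[X]} (ha : ∀ i, (a i).coeff 0 = c i)
include hc ha

theorem latticePoint_ne_zero_of_coeff : latticePoint lam a ≠ 0 :=
  h.ne_zero ⟨a, fun h0 => hc (funext fun i => by rw [← ha, h0]; simp)⟩

theorem norm_latticePoint_div_theta_pos : 0 < ‖latticePoint lam a * (theta Fq)⁻¹‖ :=
  norm_pos_iff.2 (mul_ne_zero (h.latticePoint_ne_zero_of_coeff hc ha) (inv_ne_zero theta_ne_zero))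

variable (hmin : ∀ a' : Fin r → Fq[X], (∀ i, (a' i).coeff 0 = c i) →
  ‖latticePoint lam a‖ ≤ ‖latticePoint lam a'‖)
include hmin

/-- If `λ` is a shortest lift of `c`, no lattice point is closer to `λ / θ` than `0` is. -/
theorem norm_mul_growth_le_norm_torsionLin :
    ‖latticePoint lam a * (theta Fq)⁻¹‖ * h.growth ‖latticePoint lam a * (theta Fq)⁻¹‖ ≤
      ‖h.torsionLin c‖ := by
  rw [h.torsionLin_eq ha]
  refine h.norm_mul_growth_le_norm_expC
    (norm_pos_iff.1 (h.norm_latticePoint_div_theta_pos hc ha)) fun a' => ?_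
  have h1 : latticePoint lam a * (theta Fq)⁻¹ - latticePoint lam a'.1 =
      latticePoint lam (a - (Polynomial.X : Fq[X]) • a'.1) * (theta Fq)⁻¹ := by
    rw [← latLin_apply lam (a - _), map_sub, latLin_apply, latLin_apply, latticePoint_X_smul,
      sub_mul, mul_comm (theta Fq), mul_inv_cancel_right₀ theta_ne_zero]
  rw [h1, norm_mul, norm_mul]
  refine mul_le_mul_of_nonneg_right (hmin _ fun i => ?_) (norm_nonneg _)
  simp [ha]

/-- For a shortest lift `a` of `c ≠ 0`, with lattice point `λ`, the matrix `χ(a) ω_Λ` is dominated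
by the scalar `exp_Λ(λ / θ)`: it is the exponential at `(θ - χ(θ))⁻¹ λ`, which is `λ / θ` up to
terms of size at most `|λ| / |θ|²`. -/
theorem norm_expChi_sub_lt (i j : Fin n) : ‖expChi Λ χ (latticePoint lam a) i j -
    (cToKK Fq s (h.torsionLin c) • (1 : Matrix (Fin n) (Fin n) (KK Fq s))) i j‖ <
      ‖h.torsionLin c‖ := by
  refine lt_of_lt_of_le ?_ (h.norm_mul_growth_le_norm_torsionLin hc ha hmin)
  rw [h.torsionLin_eq ha]
  have hl := h.latticePoint_ne_zero_of_coeff hc ha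
  have hx := h.norm_latticePoint_div_theta_pos hc ha
  set l := latticePoint lam a
  set y := (cToKK Fq s (theta Fq)⁻¹ • (1 : Matrix (Fin n) (Fin n) (KK Fq s))) i j with hy
  have h1 : (cToKK Fq s (expC Λ (l * (theta Fq)⁻¹)) •
      (1 : Matrix (Fin n) (Fin n) (KK Fq s))) i j = expK Λ (cToKK Fq s l * y) := by
    rw [hy, Matrix.smul_apply, Matrix.smul_apply, Matrix.one_apply]
    split_ifs
    · rw [smul_eq_mul, smul_eq_mul, mul_one, mul_one, ← map_mul, h.expK_cToKK]
    · rw [smul_zero, smul_zero, mul_zero, h.expK_eq_twEval, twEval_zero]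
  have h2 : expChi Λ χ l i j = expK Λ (cToKK Fq s l * ((thetaSubChi χ)⁻¹ i j - y)) +
      expK Λ (cToKK Fq s l * y) := by
    rw [← h.expK_add, ← mul_add, sub_add_cancel]
    rfl
  rw [h1, h2, add_sub_cancel_right]
  have h3 : ‖cToKK Fq s l * ((thetaSubChi χ)⁻¹ i j - y)‖ < ‖l * (theta Fq)⁻¹‖ := by
    rw [norm_mul, norm_cToKK, norm_mul, norm_inv]
    refine mul_lt_mul_of_pos_left ((norm_inv_thetaSubChi_sub_le χ i j).trans_lt ?_)
      (norm_pos_iff.2 hl)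
    exact mul_lt_of_lt_one_left (inv_pos.2 (norm_pos_iff.2 theta_ne_zero))
      (inv_lt_one_of_one_lt₀ one_lt_norm_theta)
  exact (h.norm_expK_le hx h3.le).trans_lt (mul_lt_mul_of_pos_right h3 h.growth_pos)

end ShortestLift

theorem torsionLin_injective : Function.Injective h.torsionLin := by
  refine (injective_iff_map_eq_zero _).2 fun c h0 => ?_
  by_contra hc
  obtain ⟨a, ha, hmin⟩ := h.exists_shortest_lift c
  have h1 := (mul_pos (h.norm_latticePoint_div_theta_pos hc ha) h.growth_pos).trans_le
    (h.norm_mul_growth_le_norm_torsionLin hc ha hmin)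
  rw [h0, norm_zero] at h1
  exact lt_irrefl _ h1

theorem chiRow_mul_Omega (a : Fin r → Fq[X]) (i : Fin n) (c : Fin r × Fin n) :
    (chiRow χ a * Omega Λ χ lam) i c =
      ((tau Fq s)⁻¹ ^ (c.1 : ℕ)) (expChi Λ χ (latticePoint lam a) i c.2) := by
  rw [h.expChi_latticePoint, Matrix.mul_apply, Matrix.mul_apply, map_sum]
  refine Finset.sum_congr rfl fun p _ => ?_
  rw [map_mul, tau_inv_pow_of_fixed Fq s (tau_chiRow χ a i p)]
  rfl

theorem isUnit_Omega : IsUnit (Omega Λ χ lam) := by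
  rw [← Matrix.mulVec_injective_iff_isUnit]
  refine (injective_iff_map_eq_zero (Omega Λ χ lam).mulVecLin).2 fun v hv => ?_
  rw [Matrix.mulVecLin_apply] at hv
  choose a ha hmin using h.exists_shortest_lift
  -- `τ^(r-1)` turns the powers of `τ⁻¹` in `Ω_Λ` into powers of `τ`, in the reverse order.
  let w : ℕ → Fin n → KK Fq s := fun k j =>
    if hk : k < r then (tau Fq s ^ (r - 1)) (v (Fin.rev ⟨k, hk⟩, j)) else 0
  have hw := eq_zero_of_sum_tauMat_mulVec_eq_zero r (by simp) h.torsionLin h.torsionLin_injective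
    (fun c => expChi Λ χ (latticePoint lam (a c)))
    (fun c hc => h.norm_expChi_sub_lt χ hc (ha c) (hmin c)) w fun c _ => by
      ext i
      have h1 : Matrix.mulVec (chiRow χ (a c) * Omega Λ χ lam) v = 0 := by
        rw [← Matrix.mulVec_mulVec, hv, Matrix.mulVec_zero]
      have h2 := congrArg (tau Fq s ^ (r - 1)) (congrFun h1 i)
      rw [Pi.zero_apply, map_zero, Matrix.mulVec, dotProduct, Fintype.sum_prod_type, map_sum] at h2
      rw [Finset.sum_apply, Pi.zero_apply, ← h2, Finset.sum_range]
      refine Eq.trans (Finset.sum_congr rfl fun k _ => ?_) (Equiv.sum_comp Fin.revPerm _)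
      rw [map_sum, Matrix.mulVec, dotProduct]
      refine Finset.sum_congr rfl fun j _ => ?_
      have h3 : r - 1 = (k : ℕ) + (Fin.rev k : ℕ) := by
        rw [Fin.val_rev]
        omega
      rw [tauMat_pow_apply, h.chiRow_mul_Omega, map_mul, Fin.revPerm_apply]
      simp only [w, k.2, dif_pos, Fin.eta]
      congr 1
      conv_rhs => rw [h3]
      rw [pow_add, RingAut.mul_apply, tau_pow_tau_inv_pow]
  ext ⟨k, j⟩
  have h1 := congrFun (hw (Fin.rev k) (Fin.rev k).2) j
  simp only [w, (Fin.rev k).2, dif_pos, Fin.eta, Fin.rev_rev] at h1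
  exact (map_eq_zero_iff _ (tau Fq s ^ (r - 1)).injective).1 h1

end IsLatticeBasis

end Invertibility

end Perkins

end

theorem mainTheorem7 (Fq : Type*) [Field Fq] [Fintype Fq] (s n r : ℕ)
    (χ : Fq[X] →ₐ[Fq] Matrix (Fin n) (Fin n) (FractionRing (MvPolynomial (Fin s) Fq)))
    (hχ : Function.Injective χ)
    (Λ : Submodule Fq[X] (Perkins.Cinf Fq)) (hΛ : Perkins.IsLattice Λ)
    (b : Module.Basis (Fin r) Fq[X] Λ)
    (lam : Fin r → Perkins.Cinf Fq) (hlam : ∀ i, lam i = (b i : Perkins.Cinf Fq)) :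
    IsUnit (Perkins.thetaSubChi χ) ∧
    IsUnit (Perkins.Omega Λ χ lam) ∧
    (∀ j : ℕ, 1 ≤ j → Summable (Perkins.eisensteinTerm χ lam j)) ∧
    ∃ ρ : ℝ, 0 < ρ ∧
      (∀ (k : ℕ) (i j : Fin n), Perkins.ConvergesOnDisk
        (Perkins.dividedDeriv (Fintype.card Fq ^ k - 1) (Perkins.HSeries Λ χ i j)) ρ) ∧
      (∀ Z : Perkins.Cinf Fq, Z ≠ 0 → ‖Z‖ ≤ ρ → Perkins.expC Λ Z ≠ 0 ∧
        ∀ i j : Fin n, Perkins.evalSeries (Perkins.HSeries Λ χ i j) Z =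
          (Perkins.cToKK Fq s (Perkins.expC Λ Z))⁻¹ * Perkins.expChi Λ χ Z i j) ∧
      (∀ (k : ℕ) (i j : Fin n),
        Perkins.IsAnalyticOnDisk (fun Z => Perkins.Hk Λ χ k Z i j) ρ) ∧
      (∀ (i : Fin n) (c : Fin r × Fin n),
        Perkins.IsAnalyticOnDisk (fun Z => Perkins.psi χ lam Z i c) ρ) ∧
      ∀ Z : Perkins.Cinf Fq, ‖Z‖ ≤ ρ →
        Summable (Perkins.psiTerm χ lam Z) ∧
        HasSum (fun j : {j : ℕ // 1 ≤ j ∧ j ≡ 1 [MOD Fintype.card Fq - 1]} =>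
          -(Perkins.cToKK Fq s Z ^ ((j : ℕ) - 1) • Perkins.eisenstein χ lam (j : ℕ)))
          (Perkins.psi χ lam Z) ∧
        Perkins.psi χ lam Z =
          Perkins.HMatrix r Λ χ Z * (Perkins.Omega Λ χ lam)⁻¹ := by
  have h := Perkins.isLatticeBasis_of_basis hΛ b hlam
  have hΩ := h.isUnit_Omega χ
  obtain ⟨R, hR, hlt⟩ := h.exists_lt_norm
  have hρ : (0 : ℝ) ≤ R / 2 := (half_pos hR).le
  have hρR : R / 2 < R := half_lt_self hR
  refine ⟨Perkins.isUnit_thetaSubChi χ, hΩ, fun j hj => ?_, R / 2, half_pos hR,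
    fun k i j => ?_, fun Z hZ0 hZ => ?_, h.isAnalyticOnDisk_Hk χ hρ hρR hlt,
    h.isAnalyticOnDisk_psi χ hρ hρR hlt, fun Z hZ => ?_⟩
  · obtain ⟨k, rfl⟩ := Nat.exists_eq_add_of_le' hj
    exact (h.hasSum_eisenstein χ k).summable
  · obtain ⟨B, hB⟩ := h.exists_coeff_HSeries_le χ hR hlt i j
    exact Perkins.convergesOnDisk_dividedDeriv hρ hρR hB _
  · have hZR := hZ.trans_lt hρR
    exact ⟨h.expC_ne_zero hZ0 fun a => hZR.trans (hlt a),
      fun i j => h.evalSeries_HSeries χ hR hlt i j hZ0 hZR⟩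
  · refine ⟨(h.hasSum_psi χ Z).summable, h.hasSum_psi_eisenstein χ hR hlt (hZ.trans_lt hρR), ?_⟩
    rw [h.HMatrix_eq χ hρ hρR hlt hZ, Matrix.mul_assoc,
      Matrix.mul_nonsing_inv _ ((Matrix.isUnit_iff_isUnit_det _).1 hΩ), Matrix.mul_one]
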